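/- Let $1\le k\le n$ be integers. **Setting.** Let $(M^{2n},\omega)$ be a symplectic manifold (smooth, Hausdorff, second countable, without boundary, $\omega$ a closed nondegenerate smooth $2$-form). Let $\Omega^q(M)$ be the space of smooth $q$-forms ($\Omega^q(M)=0$ for $q<0$), $H^q(M)$ the de Rham cohomology and $b_q(M)=\dim H^q(M)$, so that $b_q(M)=0$ for $q<0$. The manifold is of *finite type* if all $b_q(M)$ are finite. Put $L_\omega^k(\alpha)=\alpha\wedge\omega^k$, let $L^k\colon H^q(M)\to H^{q+2k}(M)$ be the induced map, and say that $(M,\omega)$ satisfies the *Hard Lefschetz Condition* (HLC) if $L^j\colon H^{n-j}(M)\to H^{n+j}(M)$ is surjective for every $1\le j\le n$. Let $$\check\Omega^q_{(k)}=\Omega^q(M)/L_\omega^k(\Omega^{q-2k}(M)),\qquad \mathfrak C^q_{(k)}=\{\alpha\in\Omega^q(M):\alpha\wedge\omega^k=0\}.$$ The *extended $k$-coeffective complex* of $(M,\omega)$ is $$0\to\check\Omega^0_{(k)}\to\check\Omega^1_{(k)}\to\cdots\to\check\Omega^{n+k-1}_{(k)}\xrightarrow{\ D\ }\mathfrak C^{n-k+1}_{(k)}\to\mathfrak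 C^{n-k+2}_{(k)}\to\cdots\to\mathfrak C^{2n}_{(k)}\to0,$$ where $\check\Omega^q_{(k)}$ sits in degree $q$ for $q\le n+k-1$ and $\mathfrak C^{q-2k+1}_{(k)}$ sits in degree $q$ for $q\ge n+k$. All arrows are induced by the exterior derivative $d$, except $D$, which sends the class of $\alpha$ to $d\gamma$, where $\gamma$ is the unique $(n-k)$-form with $d\alpha=L_\omega^k(\gamma)$. Its cohomology groups are denoted $\check H^q_{(k)}(M)$, $0\le q\le 2n+2k-1$, and $\check c^{(k)}_q(M)=\dim\check H^q_{(k)}(M)$. **Proposition.** Let $(M^{2n},\omega)$ be a symplectic manifold of finite type and $1\le k\le n$. Then for every $0\le q\le 2n+2k-1$: 1. $\check H^q_{(k)}(M)$ is finite dimensional and $$b_{q-2k+1}(M)-b_{q+1}(M)\ \le\ \check c_q^{(k)}(M)\ \le\ b_{q-2k+1}(M)+b_q(M).$$ 2. If $(M^{2n},\omega)$ satisfies the HLC, then $\check c_q^{(k)}(M)=b_{q-2k+1}(M)-b_{q+1}(M)$ for $q\ge n+k$. 3. If $\omega$ is exact, then $\check c_q^{(k)}(M)=b_{q-2k+1}(M)+b_q(M)$.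 4. If $U$ is the open unit disk in $\mathbb R^{2n}$ with the standard symplectic form $\omega=\sum_{i=1}^n dx^i\wedge dx^{n+i}$, then every $\check H_{(k)}^q(U)$ is finite dimensional, $\check c_0^{(k)}(U)=\check c_{2k-1}^{(k)}(U)=1$, and $\check c_q^{(k)}(U)=0$ for every other $q$ with $0\le q\le 2n+2k-1$. -/

import Mathlib

open scoped Manifold Topology

noncomputable section

namespace SympCoh

/-! ### Wedge product of alternating forms on a topological vector space -/

theorem update_castAdd {p q : ℕ} {V : Type*} (v : Fin (p + q) → V) (i : Fin p) (z : V) :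
    (fun l => Function.update v (Fin.castAdd q i) z (Fin.castAdd q l)) =
        Function.update (fun l => v (Fin.castAdd q l)) i z ∧
      (fun l => Function.update v (Fin.castAdd q i) z (Fin.natAdd p l)) =
        fun l => v (Fin.natAdd p l) := by
  refine ⟨Function.update_comp_eq_of_injective v (Fin.castAdd_injective p q) i z, ?_⟩
  funext l
  apply Function.update_of_ne
  intro h
  have := congrArg Fin.val h
  simp at this
  omega

theorem update_natAdd {p q : ℕ} {V : Type*} (v : Fin (p + q) → V) (j : Fin q) (z : V) :
    (fun l => Function.update v (Fin.natAdd p j) z (Fin.natAdd p l)) =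
        Function.update (fun l => v (Fin.natAdd p l)) j z ∧
      (fun l => Function.update v (Fin.natAdd p j) z (Fin.castAdd q l)) =
        fun l => v (Fin.castAdd q l) := by
  refine ⟨Function.update_comp_eq_of_injective v (Fin.natAdd_injective q p) j z, ?_⟩
  funext l
  apply Function.update_of_ne
  intro h
  have := congrArg Fin.val h
  simp at this
  omega

section Wedge

variable {V : Type*} [AddCommGroup V] [Module ℝ V] [TopologicalSpace V]

/-- The multilinear map `(v₁, …, v_{p+q}) ↦ a (v₁, …, v_p) * b (v_{p+1}, …, v_{p+q})`. -/
def mulForms {p q : ℕ} (a : V [⋀^Fin p]→L[ℝ] ℝ) (b : V [⋀^Fin q]→L[ℝ] ℝ) :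
    ContinuousMultilinearMap ℝ (fun _ : Fin (p + q) => V) ℝ where
  toFun v := a (fun i => v (Fin.castAdd q i)) * b (fun j => v (Fin.natAdd p j))
  map_update_add' := by
    intro dec v i x y
    obtain rfl : dec = instDecidableEqFin (p + q) := Subsingleton.elim _ _
    refine Fin.addCases (fun i => ?_) (fun j => ?_) i
    · simp only [update_castAdd, a.map_update_add, add_mul]
    · simp only [update_natAdd, b.map_update_add, mul_add]
  map_update_smul' := by
    intro dec v i c x
    obtain rfl : dec = instDecidableEqFin (p + q) := Subsingleton.elim _ _
    refine Fin.addCases (fun i => ?_) (fun j => ?_) i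
    · simp only [update_castAdd, a.map_update_smul, smul_eq_mul, mul_assoc]
    · simp only [update_natAdd, b.map_update_smul, smul_eq_mul, mul_left_comm]
  cont := by
    refine (a.cont.comp ?_).mul (b.cont.comp ?_)
    · exact continuous_pi fun i => continuous_apply _
    · exact continuous_pi fun i => continuous_apply _

/-- The wedge product
`(a ∧ b)(v) = 1/(p! q!) ∑_σ sign σ • a (v_{σ 1}, …, v_{σ p}) * b (v_{σ (p+1)}, …, v_{σ (p+q)})`. -/
def wedge {p q : ℕ} (a : V [⋀^Fin p]→L[ℝ] ℝ) (b : V [⋀^Fin q]→L[ℝ] ℝ) :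
    V [⋀^Fin (p + q)]→L[ℝ] ℝ :=
  ((p.factorial : ℝ) * (q.factorial : ℝ))⁻¹ •
    ContinuousMultilinearMap.alternatization (mulForms a b)

theorem wedge_apply {p q : ℕ} (a : V [⋀^Fin p]→L[ℝ] ℝ) (b : V [⋀^Fin q]→L[ℝ] ℝ)
    (v : Fin (p + q) → V) :
    wedge a b v = ((p.factorial : ℝ) * (q.factorial : ℝ))⁻¹ *
      ∑ σ : Equiv.Perm (Fin (p + q)), ((Equiv.Perm.sign σ : ℤ) : ℝ) *
        (a (fun i => v (σ (Fin.castAdd q i))) * b (fun j => v (σ (Fin.natAdd p j)))) := by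
  simp only [wedge, ContinuousAlternatingMap.smul_apply,
    ContinuousMultilinearMap.alternatization_apply_apply, smul_eq_mul]
  congr 1
  refine Finset.sum_congr rfl fun σ _ => ?_
  rw [Units.smul_def, zsmul_eq_mul]
  rfl

theorem wedge_add_left {p q : ℕ} (a a' : V [⋀^Fin p]→L[ℝ] ℝ) (b : V [⋀^Fin q]→L[ℝ] ℝ) :
    wedge (a + a') b = wedge a b + wedge a' b := by
  ext v
  simp only [wedge_apply, ContinuousAlternatingMap.add_apply, ← mul_add, add_mul,
    ← Finset.sum_add_distrib]

theorem wedge_add_right {p q : ℕ} (a : V [⋀^Fin p]→L[ℝ] ℝ) (b b' : V [⋀^Fin q]→L[ℝ] ℝ) :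
    wedge a (b + b') = wedge a b + wedge a b' := by
  ext v
  simp only [wedge_apply, ContinuousAlternatingMap.add_apply, mul_add, Finset.sum_add_distrib]

theorem wedge_smul_left {p q : ℕ} (c : ℝ) (a : V [⋀^Fin p]→L[ℝ] ℝ) (b : V [⋀^Fin q]→L[ℝ] ℝ) :
    wedge (c • a) b = c • wedge a b := by
  ext v
  simp only [wedge_apply, ContinuousAlternatingMap.smul_apply, smul_eq_mul, Finset.mul_sum]
  exact Finset.sum_congr rfl fun σ _ => by ring

theorem wedge_smul_right {p q : ℕ} (c : ℝ) (a : V [⋀^Fin p]→L[ℝ] ℝ) (b : V [⋀^Fin q]→L[ℝ] ℝ) :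
    wedge a (c • b) = c • wedge a b := by
  ext v
  simp only [wedge_apply, ContinuousAlternatingMap.smul_apply, smul_eq_mul, Finset.mul_sum]
  exact Finset.sum_congr rfl fun σ _ => by ring

theorem wedge_compContinuousLinearMap {W : Type*} [AddCommGroup W] [Module ℝ W]
    [TopologicalSpace W] {p q : ℕ} (a : V [⋀^Fin p]→L[ℝ] ℝ) (b : V [⋀^Fin q]→L[ℝ] ℝ)
    (f : W →L[ℝ] V) :
    (wedge a b).compContinuousLinearMap f =
      wedge (a.compContinuousLinearMap f) (b.compContinuousLinearMap f) := by
  ext v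
  simp only [wedge_apply, ContinuousAlternatingMap.compContinuousLinearMap_apply]
  rfl

end Wedge

section WedgeSmooth

variable {V : Type*} [NormedAddCommGroup V] [NormedSpace ℝ V]

theorem norm_wedge_le {p q : ℕ} (a : V [⋀^Fin p]→L[ℝ] ℝ) (b : V [⋀^Fin q]→L[ℝ] ℝ) :
    ‖wedge a b‖ ≤ (((p.factorial : ℝ) * (q.factorial : ℝ))⁻¹ * ((p + q).factorial : ℝ)) *
      ‖a‖ * ‖b‖ := by
  refine ContinuousAlternatingMap.opNorm_le_bound _ (by positivity) fun v => ?_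
  rw [wedge_apply, norm_mul, norm_inv, norm_mul, Real.norm_natCast, Real.norm_natCast]
  have h : ∀ σ : Equiv.Perm (Fin (p + q)), ‖((Equiv.Perm.sign σ : ℤ) : ℝ) *
        (a (fun i => v (σ (Fin.castAdd q i))) * b (fun j => v (σ (Fin.natAdd p j))))‖ ≤
      ‖a‖ * ‖b‖ * ∏ i, ‖v i‖ := by
    intro σ
    have hs : ‖((Equiv.Perm.sign σ : ℤ) : ℝ)‖ = 1 := by
      rcases Int.units_eq_one_or (Equiv.Perm.sign σ) with h | h <;> simp [h]
    rw [norm_mul, hs, one_mul, norm_mul]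
    have hp : ∏ i, ‖v i‖ = (∏ i, ‖v (σ (Fin.castAdd q i))‖) * ∏ j, ‖v (σ (Fin.natAdd p j))‖ := by
      rw [← Equiv.prod_comp σ, Fin.prod_univ_add]
    rw [hp]
    calc _ ≤ (‖a‖ * ∏ i, ‖v (σ (Fin.castAdd q i))‖) * (‖b‖ * ∏ j, ‖v (σ (Fin.natAdd p j))‖) :=
          mul_le_mul (a.le_opNorm _) (b.le_opNorm _) (norm_nonneg _) (by positivity)
      _ = _ := by ring
  calc _ ≤ ((p.factorial : ℝ) * (q.factorial : ℝ))⁻¹ *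
        ∑ σ : Equiv.Perm (Fin (p + q)), ‖a‖ * ‖b‖ * ∏ i, ‖v i‖ := by
        gcongr
        exact (norm_sum_le _ _).trans (Finset.sum_le_sum fun σ _ => h σ)
    _ = _ := by
        rw [Finset.sum_const, Finset.card_univ, Fintype.card_perm, Fintype.card_fin, nsmul_eq_mul]
        ring

theorem isBoundedBilinearMap_wedge (p q : ℕ) :
    IsBoundedBilinearMap ℝ
      (fun ab : (V [⋀^Fin p]→L[ℝ] ℝ) × (V [⋀^Fin q]→L[ℝ] ℝ) => wedge ab.1 ab.2) where
  add_left := wedge_add_left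
  smul_left := wedge_smul_left
  add_right := wedge_add_right
  smul_right := wedge_smul_right
  bound := ⟨((p.factorial : ℝ) * (q.factorial : ℝ))⁻¹ * ((p + q).factorial : ℝ),
    by positivity, norm_wedge_le⟩

end WedgeSmooth

/-! ### Differential forms on a (boundaryless) manifold modelled on `E` -/

section Forms

variable {E : Type*} [NormedAddCommGroup E] [NormedSpace ℝ E]
variable {M : Type*} [TopologicalSpace M] [ChartedSpace E M]

/-- Not necessarily continuous `q`-forms: a choice of an alternating `q`-linear form on every
tangent space. -/
def RoughForm (E : Type*) [NormedAddCommGroup E] [NormedSpace ℝ E]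
    (M : Type*) [TopologicalSpace M] [ChartedSpace E M] (q : ℕ) : Type _ :=
  ∀ x : M, TangentSpace 𝓘(ℝ, E) x [⋀^Fin q]→L[ℝ] ℝ

instance (q : ℕ) : AddCommGroup (RoughForm E M q) :=
  inferInstanceAs (AddCommGroup (∀ x : M, TangentSpace 𝓘(ℝ, E) x [⋀^Fin q]→L[ℝ] ℝ))

instance (q : ℕ) : Module ℝ (RoughForm E M q) :=
  inferInstanceAs (Module ℝ (∀ x : M, TangentSpace 𝓘(ℝ, E) x [⋀^Fin q]→L[ℝ] ℝ))

/-- The local expression of a form in the chart `φ` around `x₀`, that is, the pullback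
`(φ⁻¹)^* α`, a form on the model space (meaningful on the target of the chart). -/
def localRep {q : ℕ} (α : RoughForm E M q) (x₀ : M) (y : E) : E [⋀^Fin q]→L[ℝ] ℝ :=
  (α ((extChartAt 𝓘(ℝ, E) x₀).symm y)).compContinuousLinearMap
    (mfderiv 𝓘(ℝ, E) 𝓘(ℝ, E) (extChartAt 𝓘(ℝ, E) x₀).symm y)

/-- A form is smooth if all its local expressions are smooth. -/
def IsSmoothForm {q : ℕ} (α : RoughForm E M q) : Prop :=
  ∀ x₀ : M, ContDiffOn ℝ ((⊤ : ℕ∞) : WithTop ℕ∞) (localRep α x₀) (extChartAt 𝓘(ℝ, E) x₀).target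

theorem localRep_add {q : ℕ} (α β : RoughForm E M q) (x₀ : M) :
    localRep (α + β) x₀ = localRep α x₀ + localRep β x₀ := rfl

theorem localRep_smul {q : ℕ} (c : ℝ) (α : RoughForm E M q) (x₀ : M) :
    localRep (c • α) x₀ = c • localRep α x₀ := rfl

theorem localRep_wedge {p q : ℕ} (α : RoughForm E M p) (β : RoughForm E M q) (x₀ : M) (y : E) :
    localRep (fun x => wedge (α x) (β x)) x₀ y = wedge (localRep α x₀ y) (localRep β x₀ y) :=
  wedge_compContinuousLinearMap _ _ _

/-- The space `Ω^q(M)` of smooth `q`-forms. -/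
def Form (E : Type*) [NormedAddCommGroup E] [NormedSpace ℝ E]
    (M : Type*) [TopologicalSpace M] [ChartedSpace E M] (q : ℕ) :
    Submodule ℝ (RoughForm E M q) where
  carrier := {α | IsSmoothForm α}
  add_mem' := fun hα hβ x₀ => by
    rw [localRep_add]; exact (hα x₀).add (hβ x₀)
  zero_mem' := fun x₀ => contDiffOn_const (c := (0 : E [⋀^Fin q]→L[ℝ] ℝ))
  smul_mem' := fun c α hα x₀ => by
    rw [localRep_smul]; exact (hα x₀).const_smul c

/-! ### The wedge product and the operators `L_ω^k` -/

/-- The wedge product of smooth forms. -/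
def wedgeForm {p q : ℕ} (α : Form E M p) (β : Form E M q) : Form E M (p + q) :=
  ⟨fun x => wedge (α.1 x) (β.1 x), fun x₀ => by
    have h := (isBoundedBilinearMap_wedge (V := E) p q).contDiff.comp_contDiffOn
      ((α.2 x₀).prodMk (β.2 x₀))
    exact h.congr fun y _ => localRep_wedge α.1 β.1 x₀ y⟩

/-- The operator `L_ω : Ω^q(M) → Ω^{q+2}(M)`, `α ↦ α ∧ ω`. -/
def lef (ω : Form E M 2) {q : ℕ} : Form E M q →ₗ[ℝ] Form E M (q + 2) where
  toFun α := wedgeForm α ω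
  map_add' α β := by
    ext1
    funext x
    exact wedge_add_left _ _ _
  map_smul' c α := by
    ext1
    funext x
    exact wedge_smul_left _ _ _

/-- The operator `L_ω^k : Ω^q(M) → Ω^{q+2k}(M)`, `α ↦ α ∧ ω^k = (⋯(α ∧ ω) ∧ ⋯) ∧ ω`. -/
def lefPow (ω : Form E M 2) : (k : ℕ) → {q : ℕ} → Form E M q →ₗ[ℝ] Form E M (q + 2 * k)
  | 0, _ => LinearMap.id
  | k + 1, _ => (lef ω).comp (lefPow ω k)

/-- The relation `L_ω^k γ = η` between forms whose degrees satisfy `p + 2k = q`. -/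
def LefEq (ω : Form E M 2) (k : ℕ) {p q : ℕ} (γ : Form E M p) (η : Form E M q) : Prop :=
  ∃ h : p + 2 * k = q, h ▸ lefPow ω k γ = η

theorem LefEq.add {ω : Form E M 2} {k p q : ℕ} {γ γ' : Form E M p} {η η' : Form E M q}
    (h : LefEq ω k γ η) (h' : LefEq ω k γ' η') : LefEq ω k (γ + γ') (η + η') := by
  obtain ⟨rfl, rfl⟩ := h
  obtain ⟨_, rfl⟩ := h'
  exact ⟨rfl, map_add _ _ _⟩

theorem LefEq.smul {ω : Form E M 2} {k p q : ℕ} {γ : Form E M p} {η : Form E M q} (c : ℝ)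
    (h : LefEq ω k γ η) : LefEq ω k (c • γ) (c • η) := by
  obtain ⟨rfl, rfl⟩ := h
  exact ⟨rfl, map_smul _ _ _⟩

/-- The subspace `L_ω^k(Ω^{q-2k}(M))` of `Ω^q(M)`; it is zero if `q < 2k`. -/
def lefImage (ω : Form E M 2) (k q : ℕ) : Submodule ℝ (Form E M q) where
  carrier := {η | η = 0 ∨ ∃ (p : ℕ) (γ : Form E M p), LefEq ω k γ η}
  zero_mem' := Or.inl rfl
  add_mem' := by
    rintro η η' (rfl | ⟨p, γ, h⟩) (rfl | ⟨p', γ', h'⟩)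
    · exact Or.inl (add_zero _)
    · exact Or.inr ⟨p', γ', by rwa [zero_add]⟩
    · exact Or.inr ⟨p, γ, by rwa [add_zero]⟩
    · obtain rfl : p = p' := by
        have := h.1
        have := h'.1
        omega
      exact Or.inr ⟨p, γ + γ', h.add h'⟩
  smul_mem' := by
    rintro c η (rfl | ⟨p, γ, h⟩)
    · exact Or.inl (smul_zero _)
    · exact Or.inr ⟨p, c • γ, h.smul c⟩

/-- The space of `k`-coeffective `q`-forms, `α ∧ ω^k = 0`. -/
def coeffective (ω : Form E M 2) (k q : ℕ) : Submodule ℝ (Form E M q) :=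
  LinearMap.ker (lefPow ω k)

/-- The quotient `Ω^q(M) / L_ω^k(Ω^{q-2k}(M))`. -/
abbrev CheckForm (ω : Form E M 2) (k q : ℕ) : Type _ := Form E M q ⧸ lefImage ω k q

/-! ### The exterior derivative -/

/-- The exterior derivative: at `x` it is computed in the chart `φ` around `x`, as
`φ^* d ((φ⁻¹)^* α)`. -/
def extD {q : ℕ} (α : RoughForm E M q) : RoughForm E M (q + 1) := fun x =>
  (extDeriv (localRep α x) (extChartAt 𝓘(ℝ, E) x x)).compContinuousLinearMap
    (mfderiv 𝓘(ℝ, E) 𝓘(ℝ, E) (extChartAt 𝓘(ℝ, E) x) x)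

theorem IsSmoothForm.differentiableAt {q : ℕ} {α : RoughForm E M q} (hα : IsSmoothForm α)
    (x : M) : DifferentiableAt ℝ (localRep α x) (extChartAt 𝓘(ℝ, E) x x) :=
  ((hα x).contDiffAt (extChartAt_target_mem_nhds x)).differentiableAt (by simp)

variable [IsManifold 𝓘(ℝ, E) ((⊤ : ℕ∞) : WithTop ℕ∞) M]

/-- The exterior derivative is given by the usual formula in every chart. -/
theorem localRep_extD {q : ℕ} {α : RoughForm E M q} (hα : IsSmoothForm α) (x₀ : M) {y : E}
    (hy : y ∈ (extChartAt 𝓘(ℝ, E) x₀).target) :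
    localRep (extD α) x₀ y = extDeriv (localRep α x₀) y := by
  set φ₀ := extChartAt 𝓘(ℝ, E) x₀ with hφ₀
  set x : M := φ₀.symm y with hx
  set φ := extChartAt 𝓘(ℝ, E) x with hφ
  have hmem : φ₀.target ∈ 𝓝 y := (isOpen_extChartAt_target x₀).mem_nhds hy
  have hS : ContMDiffAt 𝓘(ℝ, E) 𝓘(ℝ, E) ((⊤ : ℕ∞) : WithTop ℕ∞) φ₀.symm y :=
    (contMDiffOn_extChartAt_symm x₀).contMDiffAt hmem
  have hC : ContMDiffAt 𝓘(ℝ, E) 𝓘(ℝ, E) ((⊤ : ℕ∞) : WithTop ℕ∞) φ x := contMDiffAt_extChartAt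
  have hτ : ContDiffAt ℝ ((⊤ : ℕ∞) : WithTop ℕ∞) (φ ∘ φ₀.symm) y := (hC.comp y hS).contDiffAt
  have hdiff : DifferentiableAt ℝ (localRep α x) ((φ ∘ φ₀.symm) y) :=
    ((hα x).contDiffAt (extChartAt_target_mem_nhds x)).differentiableAt (by simp)
  have hpull := extDeriv_pullback (r := ((⊤ : ℕ∞) : WithTop ℕ∞)) hdiff hτ
    (by rw [minSmoothness_of_isRCLikeNormedField]; exact WithTop.coe_le_coe.2 le_top)
  have hfd : fderiv ℝ (φ ∘ φ₀.symm) y =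
      (mfderiv 𝓘(ℝ, E) 𝓘(ℝ, E) φ x).comp (mfderiv 𝓘(ℝ, E) 𝓘(ℝ, E) φ₀.symm y) := by
    rw [← mfderiv_eq_fderiv]
    exact mfderiv_comp y (hC.mdifferentiableAt (by simp)) (hS.mdifferentiableAt (by simp))
  have hev : (fun z => (localRep α x ((φ ∘ φ₀.symm) z)).compContinuousLinearMap
      (fderiv ℝ (φ ∘ φ₀.symm) z)) =ᶠ[𝓝 y] localRep α x₀ := by
    have hsrc : φ₀.symm ⁻¹' φ.source ∈ 𝓝 y :=
      hS.continuousAt.preimage_mem_nhds (extChartAt_source_mem_nhds x)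
    filter_upwards [eventually_mem_nhds_iff.2 hmem, eventually_mem_nhds_iff.2 hsrc] with z hz hz'
    have hz1 : z ∈ φ₀.target := mem_of_mem_nhds hz
    have hz2 : φ₀.symm z ∈ φ.source := by
      have h := mem_of_mem_nhds hz'
      exact h
    have hSz : ContMDiffAt 𝓘(ℝ, E) 𝓘(ℝ, E) ((⊤ : ℕ∞) : WithTop ℕ∞) φ₀.symm z :=
      (contMDiffOn_extChartAt_symm x₀).contMDiffAt hz
    have hCz : ContMDiffAt 𝓘(ℝ, E) 𝓘(ℝ, E) ((⊤ : ℕ∞) : WithTop ℕ∞) φ (φ₀.symm z) :=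
      contMDiffAt_extChartAt' (by simpa [hφ] using hz2)
    have hτz : MDifferentiableAt 𝓘(ℝ, E) 𝓘(ℝ, E) (φ ∘ φ₀.symm) z :=
      (hCz.comp z hSz).mdifferentiableAt (by simp)
    have hSx : ContMDiffAt 𝓘(ℝ, E) 𝓘(ℝ, E) ((⊤ : ℕ∞) : WithTop ℕ∞) φ.symm ((φ ∘ φ₀.symm) z) :=
      (contMDiffOn_extChartAt_symm x).contMDiffAt
        ((isOpen_extChartAt_target x).mem_nhds (φ.map_source hz2))
    have hpt : φ.symm ((φ ∘ φ₀.symm) z) = φ₀.symm z := φ.left_inv hz2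
    have hcomp : mfderiv 𝓘(ℝ, E) 𝓘(ℝ, E) (φ.symm ∘ (φ ∘ φ₀.symm)) z =
        (mfderiv 𝓘(ℝ, E) 𝓘(ℝ, E) φ.symm ((φ ∘ φ₀.symm) z)).comp
          (mfderiv 𝓘(ℝ, E) 𝓘(ℝ, E) (φ ∘ φ₀.symm) z) :=
      mfderiv_comp z (hSx.mdifferentiableAt (by simp)) hτz
    have heq : (φ.symm ∘ (φ ∘ φ₀.symm)) =ᶠ[𝓝 z] φ₀.symm := by
      filter_upwards [hz'] with w hw
      exact φ.left_inv hw
    ext v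
    have hval : ∀ (p p' : M) (hp : p = p') (w : Fin q → E),
        (α p : E [⋀^Fin q]→L[ℝ] ℝ) w = (α p' : E [⋀^Fin q]→L[ℝ] ℝ) w := by
      rintro p _ rfl w; rfl
    have hder : ∀ u : E, (mfderiv 𝓘(ℝ, E) 𝓘(ℝ, E) φ.symm ((φ ∘ φ₀.symm) z) : E →L[ℝ] E)
        (fderiv ℝ (φ ∘ φ₀.symm) z u) = (mfderiv 𝓘(ℝ, E) 𝓘(ℝ, E) φ₀.symm z : E →L[ℝ] E) u := by
      intro u
      have h2 := heq.mfderiv_eq (I := 𝓘(ℝ, E)) (I' := 𝓘(ℝ, E))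
      rw [← mfderiv_eq_fderiv]
      have h3 : (mfderiv 𝓘(ℝ, E) 𝓘(ℝ, E) (φ.symm ∘ (φ ∘ φ₀.symm)) z : E →L[ℝ] E) u =
        (mfderiv 𝓘(ℝ, E) 𝓘(ℝ, E) φ₀.symm z : E →L[ℝ] E) u := congrArg (fun T : E →L[ℝ] E => T u) h2
      rw [← h3]
      exact (congrArg (fun T : E →L[ℝ] E => T u) hcomp).symm
    refine (hval _ _ hpt _).trans ?_
    change (α (φ₀.symm z) : E [⋀^Fin q]→L[ℝ] ℝ) _ = (α (φ₀.symm z) : E [⋀^Fin q]→L[ℝ] ℝ) _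
    congr 1
    funext i
    exact hder (v i)
  rw [← hev.extDeriv_eq, hpull, hfd]
  rfl

theorem IsSmoothForm.extD {q : ℕ} {α : RoughForm E M q} (hα : IsSmoothForm α) :
    IsSmoothForm (extD α) := by
  intro x₀
  refine ContDiffOn.congr ?_ fun y hy => localRep_extD hα x₀ hy
  have h1 : ContDiffOn ℝ ((⊤ : ℕ∞) : WithTop ℕ∞) (fderiv ℝ (localRep α x₀)) (extChartAt 𝓘(ℝ, E) x₀).target :=
    (hα x₀).fderiv_of_isOpen (isOpen_extChartAt_target x₀) (by simp)
  exact (ContinuousAlternatingMap.alternatizeUncurryFinCLM ℝ E ℝ).contDiff.comp_contDiffOn h1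

/-- The exterior derivative `d : Ω^q(M) → Ω^{q+1}(M)`. -/
def d {q : ℕ} : Form E M q →ₗ[ℝ] Form E M (q + 1) where
  toFun α := ⟨extD α.1, α.2.extD⟩
  map_add' α β := by
    ext1
    funext x
    change (extDeriv (localRep α.1 x + localRep β.1 x) _).compContinuousLinearMap _ = _
    rw [extDeriv_add (α.2.differentiableAt x) (β.2.differentiableAt x)]
    rfl
  map_smul' c α := by
    ext1
    funext x
    change (extDeriv (c • localRep α.1 x) _).compContinuousLinearMap _ = _
    rw [extDeriv_smul]
    rfl

/-! ### De Rham cohomology -/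

/-- The subquotient `Z / (B ∩ Z)`; it is used only for `B ⊆ Z`. -/
abbrev Subquot {V : Type*} [AddCommGroup V] [Module ℝ V] (Z B : Submodule ℝ V) : Type _ :=
  Z ⧸ B.submoduleOf Z

variable (E M) in
/-- Closed `q`-forms. -/
def closedForms (q : ℕ) : Submodule ℝ (Form E M q) := LinearMap.ker d

variable (E M) in
/-- Exact `q`-forms; the only exact `0`-form is zero. -/
def exactForms : (q : ℕ) → Submodule ℝ (Form E M q)
  | 0 => ⊥
  | _ + 1 => LinearMap.range d

variable (E M) in
/-- The de Rham cohomology `H^q(M)`. -/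
abbrev DeRham (q : ℕ) : Type _ := Subquot (closedForms E M q) (exactForms E M q)

variable (E M) in
/-- The Betti number `b_q(M) = dim H^q(M)`, for an integer `q`; it is zero for negative `q`. -/
def betti : ℤ → ℕ
  | Int.ofNat q => Module.finrank ℝ (DeRham E M q)
  | Int.negSucc _ => 0

variable (E M) in
/-- `M` is of finite type: all its de Rham cohomology groups are finite dimensional. -/
def FiniteType : Prop := ∀ q : ℕ, Module.Finite ℝ (DeRham E M q)

/-! ### Symplectic forms and the Hard Lefschetz Condition -/

/-- A symplectic form: a closed and pointwise nondegenerate smooth `2`-form. -/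
def IsSymplectic (ω : Form E M 2) : Prop :=
  d ω = 0 ∧ ∀ (x : M) (v : TangentSpace 𝓘(ℝ, E) x),
    (∀ w : TangentSpace 𝓘(ℝ, E) x, ω.1 x ![v, w] = 0) → v = 0

/-- The Hard Lefschetz Condition on a `2n`-dimensional `M`: for all `1 ≤ k ≤ n` the map
`L^k : H^{n-k}(M) → H^{n+k}(M)`, `[α] ↦ [α ∧ ω^k]`, is surjective. With `p = n - k` one has
`n + k = p + 2k`. -/
def HardLefschetz (ω : Form E M 2) (n : ℕ) : Prop :=
  ∀ k p : ℕ, 1 ≤ k → p + k = n → ∀ β ∈ closedForms E M (p + 2 * k),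
    ∃ α ∈ closedForms E M p, β - lefPow ω k α ∈ exactForms E M (p + 2 * k)

/-! ### The extended `k`-coeffective complex

With `Ω̌^q = Ω^q / L_ω^k(Ω^{q-2k})` and `C^q` the `k`-coeffective forms, it is
`Ω̌^0 → ⋯ → Ω̌^{n+k-1} → C^{n-k+1} → C^{n-k+2} → ⋯ → C^{2n}`.
The term `Ω̌^q` has degree `q ≤ n+k-1`, and the term `C^{q-2k+1}` has degree `q ≥ n+k`.
The arrows are induced by `d`, except for `D : Ω̌^{n+k-1} → C^{n-k+1}`, which sends the class of
`α` to `dγ`, where `γ` is the `(n-k)`-form with `dα = L_ω^k γ`. -/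

/-- The kernel of `Ω̌^q → Ω̌^{q+1}`: classes of forms `α` such that `dα` is zero in `Ω̌^{q+1}`. -/
def checkClosed (ω : Form E M 2) (k q : ℕ) : Submodule ℝ (CheckForm ω k q) :=
  ((lefImage ω k (q + 1)).comap d).map (lefImage ω k q).mkQ

/-- The image of `Ω̌^{q-1} → Ω̌^q` (zero for `q = 0`): classes of exact forms. -/
def checkExact (ω : Form E M 2) (k q : ℕ) : Submodule ℝ (CheckForm ω k q) :=
  (exactForms E M q).map (lefImage ω k q).mkQ

/-- The forms `α` (of degree `q = n+k-1`) such that `dα = L_ω^k γ` with `γ` an `(n-k)`-form and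
`dγ = 0`. -/
def preKerD (ω : Form E M 2) (n k q : ℕ) : Submodule ℝ (Form E M q) where
  carrier := {α | α = 0 ∨ ∃ γ : Form E M (n - k), LefEq ω k γ (d α) ∧ d γ = 0}
  zero_mem' := Or.inl rfl
  add_mem' := by
    rintro α β (rfl | ⟨γ, h1, h2⟩) (rfl | ⟨γ', h1', h2'⟩)
    · exact Or.inl (add_zero _)
    · exact Or.inr ⟨γ', by rwa [zero_add], h2'⟩
    · exact Or.inr ⟨γ, by rwa [add_zero], h2⟩
    · exact Or.inr ⟨γ + γ', by rw [map_add]; exact h1.add h1', by rw [map_add, h2, h2', add_zero]⟩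
  smul_mem' := by
    rintro c α (rfl | ⟨γ, h1, h2⟩)
    · exact Or.inl (smul_zero _)
    · exact Or.inr ⟨c • γ, by rw [map_smul]; exact h1.smul c, by rw [map_smul, h2, smul_zero]⟩

/-- The kernel of `D : Ω̌^{n+k-1} → C^{n-k+1}` (used for `q = n+k-1`). -/
def kerD (ω : Form E M 2) (n k q : ℕ) : Submodule ℝ (CheckForm ω k q) :=
  (preKerD ω n k q).map (lefImage ω k q).mkQ

/-- The image of `D : Ω̌^{n+k-1} → C^{n-k+1}`: the forms `dγ`, where `γ` is an `(n-k)`-form with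
`L_ω^k γ = dα` for some `(n+k-1)`-form `α`. -/
def imD (ω : Form E M 2) (n k : ℕ) : Submodule ℝ (Form E M (n - k + 1)) where
  carrier := {η | η = 0 ∨
    ∃ (γ : Form E M (n - k)) (α : Form E M (n + k - 1)), LefEq ω k γ (d α) ∧ η = d γ}
  zero_mem' := Or.inl rfl
  add_mem' := by
    rintro η η' (rfl | ⟨γ, α, h, rfl⟩) (rfl | ⟨γ', α', h', rfl⟩)
    · exact Or.inl (add_zero _)
    · exact Or.inr ⟨γ', α', h', zero_add _⟩
    · exact Or.inr ⟨γ, α, h, add_zero _⟩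
    · exact Or.inr ⟨γ + γ', α + α', by rw [map_add]; exact h.add h', (map_add _ _ _).symm⟩
  smul_mem' := by
    rintro c η (rfl | ⟨γ, α, h, rfl⟩)
    · exact Or.inl (smul_zero _)
    · exact Or.inr ⟨c • γ, c • α, by rw [map_smul]; exact h.smul c, (map_smul _ _ _).symm⟩

/-- The cohomology `Ȟ^q_{(k)}(M)` of the extended `k`-coeffective complex of `(M^{2n}, ω)`, for
`1 ≤ k ≤ n` and `0 ≤ q ≤ 2n+2k-1`. -/
def checkH (ω : Form E M 2) (n k q : ℕ) : ModuleCat ℝ :=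
  if q + 1 < n + k then
    .of ℝ (Subquot (checkClosed ω k q) (checkExact ω k q))
  else if q + 1 = n + k then
    .of ℝ (Subquot (kerD ω n k q) (checkExact ω k q))
  else if q = n + k then
    .of ℝ (Subquot (coeffective ω k (n - k + 1) ⊓ closedForms E M (n - k + 1)) (imD ω n k))
  else
    .of ℝ (Subquot (coeffective ω k (q - 2 * k + 1) ⊓ closedForms E M (q - 2 * k + 1))
      ((coeffective ω k (q - 2 * k)).map d))

/-- The dimension `č_q^{(k)}(M)` of `Ȟ^q_{(k)}(M)` (when it is finite). -/
def checkC (ω : Form E M 2) (n k q : ℕ) : ℕ := Module.finrank ℝ (checkH ω n k q)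

end Forms

/-! ### The standard symplectic disk -/

/-- The model space `ℝ^{2n}`. -/
abbrev R2 (n : ℕ) : Type := EuclideanSpace ℝ (Fin (2 * n))

/-- The constant `1`-form `dx^j` on `ℝ^{2n}`. -/
def dx {n : ℕ} (j : Fin (2 * n)) : R2 n [⋀^Fin 1]→L[ℝ] ℝ :=
  ContinuousAlternatingMap.ofSubsingleton ℝ (R2 n) ℝ 0 (EuclideanSpace.proj j)

/-- The alternating form `∑_{i=1}^n dx^i ∧ dx^{n+i}` on `ℝ^{2n}`. -/
def stdOmega (n : ℕ) : R2 n [⋀^Fin 2]→L[ℝ] ℝ :=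
  ∑ i : Fin n, wedge (dx ⟨i, by omega⟩) (dx ⟨n + i, by omega⟩)

/-- The open unit disk in `ℝ^{2n}`. -/
def disk (n : ℕ) : TopologicalSpace.Opens (R2 n) := ⟨Metric.ball 0 1, Metric.isOpen_ball⟩

/-- The standard symplectic form on the disk: the pullback of `∑ dx^i ∧ dx^{n+i}` under the
inclusion in `ℝ^{2n}`. -/
def diskForm (n : ℕ) : Form (R2 n) (disk n) 2 :=
  ⟨fun x => (stdOmega n).compContinuousLinearMap
    (mfderiv 𝓘(ℝ, R2 n) 𝓘(ℝ, R2 n) (Subtype.val : disk n → R2 n) x), by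
    intro x₀
    refine ContDiffOn.congr (contDiffOn_const (c := stdOmega n)) fun y hy => ?_
    set φ := extChartAt 𝓘(ℝ, R2 n) x₀ with hφ
    have hmem : φ.target ∈ 𝓝 y := (isOpen_extChartAt_target x₀).mem_nhds hy
    have hS : MDifferentiableAt 𝓘(ℝ, R2 n) 𝓘(ℝ, R2 n) φ.symm y :=
      ((contMDiffOn_extChartAt_symm (n := 1) x₀).contMDiffAt hmem).mdifferentiableAt (by simp)
    have hV : MDifferentiableAt 𝓘(ℝ, R2 n) 𝓘(ℝ, R2 n) (Subtype.val : disk n → R2 n) (φ.symm y) :=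
      (contMDiff_subtype_val (n := 1)).contMDiffAt.mdifferentiableAt (by simp)
    have hcomp := mfderiv_comp y hV hS
    have hid : (Subtype.val : disk n → R2 n) ∘ φ.symm =ᶠ[𝓝 y] id := by
      filter_upwards [hmem] with z hz
      exact φ.right_inv hz
    have hder : ∀ u : R2 n, (mfderiv 𝓘(ℝ, R2 n) 𝓘(ℝ, R2 n) (Subtype.val : disk n → R2 n) (φ.symm y) :
        R2 n →L[ℝ] R2 n) ((mfderiv 𝓘(ℝ, R2 n) 𝓘(ℝ, R2 n) φ.symm y : R2 n →L[ℝ] R2 n) u) = u := by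
      intro u
      have h2 := hid.mfderiv_eq (I := 𝓘(ℝ, R2 n)) (I' := 𝓘(ℝ, R2 n))
      rw [hcomp, mfderiv_id] at h2
      exact congrArg (fun T : R2 n →L[ℝ] R2 n => T u) h2
    ext v
    change stdOmega n _ = stdOmega n v
    congr 1
    funext i
    exact hder (v i)⟩

end SympCoh

end

/-! The extended coeffective complex computes the cohomology of the mapping cone of `L^k` on the de
Rham complex. A cone cocycle in degree `q` is a pair `(α, γ)` with `dα = L^k γ` and `dγ = 0`, and
the coboundaries are the pairs `(L^k β + η, dβ)` with `η` exact. The cone has the exact sequence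
`H^{q-2k} → H^q → Ȟ^q → H^{q-2k+1} → H^{q+1}`, whose outer arrows are `L^k`. If `r₀` and `r₁` are
their ranks, then `č_q + r₀ + r₁ = b_q + b_{q-2k+1}` with `r₀ ≤ b_q` and `r₁ ≤ b_{q+1}`. This gives
both bounds. If `ω = dθ`, then `L^k` vanishes on cohomology and `r₀ = r₁ = 0`. Under the HLC both
arrows are onto for `q ≥ n + k`, so `r₀ = b_q` and `r₁ = b_{q+1}`. `HasRankFormula` records all of
this.

The cone is compared with the complex through the pointwise Lefschetz theorem: on `p`-forms `L^k` is
injective if `p + k ≤ n` (`lefTo_injective`) and surjective if `p + k ≥ n` (`lefTo_surjective`). For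
`q < n + k` injectivity makes `γ` a function of `α`, and the cone becomes the quotient complex
(`exists_equiv_cone_of_injective`). For `q ≥ n + k` surjectivity lets `α` be removed, and the cone
becomes the coeffective complex (`exists_equiv_cone_of_surjective`).

The algebra of forms rests on one device: a form of positive degree is determined by its
contractions (`ext_contract`), and contraction is an antiderivation (`wedge_vecCons`). The
commutation rules, the Leibniz rules for products with 1- and 2-forms, and the Lefschetz theorem
then follow by induction on the degree.

For the disk, the Poincaré lemma (`poincare_lemma`) gives `b_0 = 1`, all other Betti numbers zero,
and the exactness of `ω`, so the exact case applies. -/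

noncomputable section

namespace SympCoh

/-! ### Contraction of wedge products -/

/-- The permutation of `Fin (m + 1)` sending `i` to `0` and the other elements, in increasing
order, to `(e 0).succ, …, (e (m - 1)).succ`. -/
def permOfPosition {m : ℕ} (i : Fin (m + 1)) (e : Equiv.Perm (Fin m)) : Equiv.Perm (Fin (m + 1)) :=
  Equiv.Perm.decomposeFin.symm (0, e) * Fin.cycleRange i

theorem permOfPosition_self {m : ℕ} (i : Fin (m + 1)) (e : Equiv.Perm (Fin m)) :
    permOfPosition i e i = 0 := by
  simp [permOfPosition]

theorem permOfPosition_succAbove {m : ℕ} (i : Fin (m + 1)) (e : Equiv.Perm (Fin m)) (j : Fin m) :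
    permOfPosition i e (i.succAbove j) = (e j).succ := by
  simp [permOfPosition]

theorem sign_permOfPosition {m : ℕ} (i : Fin (m + 1)) (e : Equiv.Perm (Fin m)) :
    Equiv.Perm.sign (permOfPosition i e) = (-1) ^ (i : ℕ) * Equiv.Perm.sign e := by
  simp [permOfPosition, mul_comm]

theorem permOfPosition_bijective (m : ℕ) :
    Function.Bijective fun x : Fin (m + 1) × Equiv.Perm (Fin m) => permOfPosition x.1 x.2 := by
  rw [Fintype.bijective_iff_injective_and_card]
  refine ⟨?_, by simp [Fintype.card_perm, Nat.factorial_succ]⟩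
  rintro ⟨i, e⟩ ⟨i', e'⟩ h
  have h : permOfPosition i e = permOfPosition i' e' := h
  obtain rfl : i = i' := by
    apply (permOfPosition i e).injective
    rw [permOfPosition_self, h, permOfPosition_self]
  congr 1
  ext1 j
  have := congrArg (fun σ => σ (i.succAbove j)) h
  simpa [permOfPosition_succAbove] using this

theorem vecCons_comp_permOfPosition {V : Type*} {m : ℕ} (i : Fin (m + 1))
    (e : Equiv.Perm (Fin m)) (v : V) (u : Fin m → V) :
    (fun l => Matrix.vecCons v u (permOfPosition i e l)) = i.insertNth v (fun j => u (e j)) := by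
  funext l
  rcases Fin.eq_self_or_eq_succAbove i l with rfl | ⟨j, rfl⟩
  · simp [permOfPosition_self]
  · simp [permOfPosition_succAbove]

/-- Laplace expansion along the first vector: permutations are grouped by the slot `i` into which
`v` is placed. -/
theorem sum_perm_vecCons {V : Type*} {m : ℕ} (F : (Fin (m + 1) → V) → ℝ) (v : V) (u : Fin m → V) :
    ∑ σ : Equiv.Perm (Fin (m + 1)), ((Equiv.Perm.sign σ : ℤ) : ℝ) *
        F (fun l => Matrix.vecCons v u (σ l)) =
      ∑ i : Fin (m + 1), (-1 : ℝ) ^ (i : ℕ) * ∑ e : Equiv.Perm (Fin m),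
        ((Equiv.Perm.sign e : ℤ) : ℝ) * F (i.insertNth v fun j => u (e j)) := by
  rw [← (permOfPosition_bijective m).sum_comp fun σ : Equiv.Perm (Fin (m + 1)) =>
    ((Equiv.Perm.sign σ : ℤ) : ℝ) * F (fun l => Matrix.vecCons v u (σ l)), Fintype.sum_prod_type]
  refine Finset.sum_congr rfl fun i _ => ?_
  rw [Finset.mul_sum]
  refine Finset.sum_congr rfl fun e _ => ?_
  rw [vecCons_comp_permOfPosition, sign_permOfPosition]
  push_cast
  ring

theorem insertNth_castAdd {V : Type*} {p q : ℕ} (h : p + (q + 1) = p + 1 + q) (i : Fin (p + 1))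
    (v : V) (w : Fin (p + 1 + q) → V) :
    (fun l => (Fin.insertNth (n := p + 1 + q) (α := fun _ => V) (Fin.castAdd (q + 1) i) v w :
        Fin (p + 1 + (q + 1)) → V) (Fin.castAdd (q + 1) l)) =
        Fin.insertNth (α := fun _ => V) i v (fun j => w (Fin.cast h (Fin.castAdd (q + 1) j))) ∧
      (fun l => (Fin.insertNth (n := p + 1 + q) (α := fun _ => V) (Fin.castAdd (q + 1) i) v w :
        Fin (p + 1 + (q + 1)) → V) (Fin.natAdd (p + 1) l)) =
        fun j => w (Fin.cast h (Fin.natAdd p j)) := by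
  constructor
  · funext l
    rcases Fin.eq_self_or_eq_succAbove i l with rfl | ⟨j, rfl⟩
    · rw [Fin.insertNth_apply_same, Fin.insertNth_apply_same]
    · have : Fin.castAdd (q + 1) (i.succAbove j) =
          (Fin.castAdd (q + 1) i : Fin (p + 1 + q + 1)).succAbove
            (Fin.cast h (Fin.castAdd (q + 1) j)) := by
        ext
        simp [Fin.succAbove, Fin.lt_def]
        split_ifs <;> simp
      rw [this, Fin.insertNth_apply_succAbove]
      simp
  · funext l
    have : Fin.natAdd (p + 1) l =
          (Fin.castAdd (q + 1) i : Fin (p + 1 + q + 1)).succAbove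
            (Fin.cast h (Fin.natAdd p l)) := by
      ext
      have := i.2
      simp [Fin.succAbove, Fin.lt_def]
      split_ifs
      · omega
      · simp; omega
    rw [this, Fin.insertNth_apply_succAbove]

theorem insertNth_natAdd {V : Type*} {p q : ℕ} (i : Fin (q + 1)) (v : V) (w : Fin (p + q) → V) :
    (fun l => (Fin.insertNth (n := p + q) (α := fun _ => V) (Fin.natAdd p i) v w :
        Fin (p + (q + 1)) → V) (Fin.natAdd p l)) =
        Fin.insertNth (α := fun _ => V) i v (fun j => w (Fin.natAdd p j)) ∧
      (fun l => (Fin.insertNth (n := p + q) (α := fun _ => V) (Fin.natAdd p i) v w :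
        Fin (p + (q + 1)) → V) (Fin.castAdd (q + 1) l)) =
        fun j => w (Fin.castAdd q j) := by
  constructor
  · funext l
    rcases Fin.eq_self_or_eq_succAbove i l with rfl | ⟨j, rfl⟩
    · rw [Fin.insertNth_apply_same, Fin.insertNth_apply_same]
    · have : Fin.natAdd p (i.succAbove j) =
          (Fin.natAdd p i : Fin (p + q + 1)).succAbove (Fin.natAdd p j) := by
        ext
        simp [Fin.succAbove, Fin.lt_def]
        split_ifs <;> simp; omega
      rw [this, Fin.insertNth_apply_succAbove]
      simp
  · funext l
    have : Fin.castAdd (q + 1) l =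
          (Fin.natAdd p i : Fin (p + q + 1)).succAbove (Fin.castAdd q l) := by
      ext
      have := l.2
      rw [Fin.succAbove_of_castSucc_lt _ _ (by simp [Fin.lt_def]; omega)]
      simp
    rw [this, Fin.insertNth_apply_succAbove]

section

variable {V : Type*} [NormedAddCommGroup V] [NormedSpace ℝ V]

/-- All `q!` permutations contribute the same term, since the sign produced by `b` cancels the sign
of the permutation; this absorbs the normalization. -/
theorem wedge_zero_left {q : ℕ} (a : V [⋀^Fin 0]→L[ℝ] ℝ) (b : V [⋀^Fin q]→L[ℝ] ℝ)
    (w : Fin (0 + q) → V) : wedge a b w = a ![] * b (fun j => w (Fin.natAdd 0 j)) := by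
  have key : ∀ σ : Equiv.Perm (Fin (0 + q)), ((Equiv.Perm.sign σ : ℤ) : ℝ) *
        (a (fun i => w (σ (Fin.castAdd q i))) * b (fun j => w (σ (Fin.natAdd 0 j)))) =
      a ![] * b (fun j => w (Fin.natAdd 0 j)) := by
    intro σ
    have h0 : ∀ j : Fin q, Fin.natAdd 0 j = finCongr (zero_add q).symm j := by
      intro j; ext; simp
    have h1 : b (fun j => w (σ (Fin.natAdd 0 j))) =
        Equiv.Perm.sign σ • b (fun j => w (Fin.natAdd 0 j)) := by
      simp only [h0]
      exact (b.toAlternatingMap.domDomCongr (finCongr (zero_add q).symm)).map_perm w σ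
    have h2 : (fun j => w (σ (Fin.castAdd q j))) = ![] := Subsingleton.elim _ _
    rw [h1, h2, Units.smul_def, zsmul_eq_mul, mul_left_comm (a _), ← mul_assoc, ← Int.cast_mul,
      ← Units.val_mul, Int.units_mul_self]
    simp
  rw [wedge_apply, Finset.sum_congr rfl fun σ _ => key σ]
  simp [Fintype.card_perm]
  have : (q.factorial : ℝ) ≠ 0 := by positivity
  field_simp

theorem wedge_zero_right {p : ℕ} (a : V [⋀^Fin p]→L[ℝ] ℝ) (b : V [⋀^Fin 0]→L[ℝ] ℝ) :
    wedge a b = b ![] • a := by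
  ext w
  have key : ∀ σ : Equiv.Perm (Fin (p + 0)), ((Equiv.Perm.sign σ : ℤ) : ℝ) *
        (a (fun i => w (σ (Fin.castAdd 0 i))) * b (fun j => w (σ (Fin.natAdd p j)))) =
      a w * b ![] := by
    intro σ
    have h1 : a (fun i => w (σ (Fin.castAdd 0 i))) = Equiv.Perm.sign σ • a w :=
      a.toAlternatingMap.map_perm w σ
    have h2 : (fun j => w (σ (Fin.natAdd p j))) = ![] := Subsingleton.elim _ _
    rw [h1, h2, Units.smul_def, zsmul_eq_mul, ← mul_assoc, ← mul_assoc, ← Int.cast_mul,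
      ← Units.val_mul, Int.units_mul_self]
    simp
  rw [wedge_apply, Finset.sum_congr rfl fun σ _ => key σ]
  simp [Fintype.card_perm]
  have : (p.factorial : ℝ) ≠ 0 := by positivity
  field_simp

/-- The antiderivation rule `ι_v(a ∧ b) = ι_v a ∧ b + (-1)^{deg a} a ∧ ι_v b`. The hypothesis `h`
only names the identification of two degrees that are not definitionally equal. -/
theorem wedge_vecCons {p q : ℕ} (a : V [⋀^Fin (p + 1)]→L[ℝ] ℝ) (b : V [⋀^Fin (q + 1)]→L[ℝ] ℝ)
    (h : p + (q + 1) = p + 1 + q) (v : V) (u : Fin (p + 1 + q) → V) :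
    wedge a b (Matrix.vecCons v u) =
      wedge (a.curryLeft v) b (fun j => u (Fin.cast h j)) +
        (-1) ^ (p + 1) * wedge a (b.curryLeft v) u := by
  have hsum := sum_perm_vecCons (m := p + 1 + q) (fun w =>
    a (fun i => w (Fin.castAdd (q + 1) i)) * b (fun j => w (Fin.natAdd (p + 1) j))) v u
  rw [wedge_apply]
  refine (congrArg _ hsum).trans ?_
  refine (congrArg _ (Fin.sum_univ_add (a := p + 1) (b := q + 1) _)).trans ?_
  rw [mul_add]
  congr 1
  -- Here `v` lands among the arguments of `a`. Moving it to the front costs `(-1)^i`, so all `p +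
  -- 1` slots give the same sum, which turns `1/(p+1)!` into `1/p!`.
  · have hterm : ∀ i : Fin (p + 1), ((-1 : ℝ) ^ ((Fin.castAdd (q + 1) i : Fin _) : ℕ) *
        ∑ e : Equiv.Perm (Fin (p + 1 + q)), ((Equiv.Perm.sign e : ℤ) : ℝ) *
          (a (fun l => (Fin.insertNth (n := p + 1 + q) (α := fun _ => V) (Fin.castAdd (q + 1) i) v
              (fun j => u (e j)) : Fin (p + 1 + (q + 1)) → V) (Fin.castAdd (q + 1) l)) *
            b (fun l => (Fin.insertNth (n := p + 1 + q) (α := fun _ => V) (Fin.castAdd (q + 1) i) v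
              (fun j => u (e j)) : Fin (p + 1 + (q + 1)) → V) (Fin.natAdd (p + 1) l)))) =
        ∑ e : Equiv.Perm (Fin (p + (q + 1))), ((Equiv.Perm.sign e : ℤ) : ℝ) *
          (a.curryLeft v (fun j => u (Fin.cast h (e (Fin.castAdd (q + 1) j)))) *
            b (fun j => u (Fin.cast h (e (Fin.natAdd p j))))) := by
      intro i
      rw [← Equiv.sum_comp (Equiv.permCongr (finCongr h)), Finset.mul_sum]
      refine Finset.sum_congr rfl fun e _ => ?_
      rw [(insertNth_castAdd h i v _).1, (insertNth_castAdd h i v _).2, a.map_insertNth,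
        Equiv.Perm.sign_permCongr]
      have h1 : ((-1 : ℝ) ^ (i : ℕ)) * (-1 : ℝ) ^ (i : ℕ) = 1 := by
        rw [← mul_pow]; simp
      simp only [Fin.val_castAdd, zsmul_eq_mul, Int.cast_pow, Int.cast_neg, Int.cast_one,
        ContinuousAlternatingMap.curryLeft_apply_apply, Equiv.permCongr_apply]
      rw [mul_left_comm, ← mul_assoc ((-1 : ℝ) ^ (i : ℕ)), ← mul_assoc ((-1 : ℝ) ^ (i : ℕ)), h1,
        one_mul]
      rfl
    rw [Finset.sum_congr rfl fun i _ => hterm i, wedge_apply]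
    simp only [Finset.sum_const, Finset.card_univ, Fintype.card_fin, nsmul_eq_mul]
    rw [← mul_assoc, Nat.factorial_succ p]
    congr 1
    push_cast
    have : (p.factorial : ℝ) ≠ 0 := by positivity
    have : ((q + 1).factorial : ℝ) ≠ 0 := by positivity
    have : (p : ℝ) + 1 ≠ 0 := by positivity
    field_simp
  -- Here `v` lands among the arguments of `b`, in position `p + 1 + i`; the part `(-1)^(p+1)` of
  -- the sign survives.
  · have hterm : ∀ i : Fin (q + 1), ((-1 : ℝ) ^ ((Fin.natAdd (p + 1) i : Fin _) : ℕ) *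
        ∑ e : Equiv.Perm (Fin (p + 1 + q)), ((Equiv.Perm.sign e : ℤ) : ℝ) *
          (a (fun l => (Fin.insertNth (n := p + 1 + q) (α := fun _ => V) (Fin.natAdd (p + 1) i) v
              (fun j => u (e j)) : Fin (p + 1 + (q + 1)) → V) (Fin.castAdd (q + 1) l)) *
            b (fun l => (Fin.insertNth (n := p + 1 + q) (α := fun _ => V) (Fin.natAdd (p + 1) i) v
              (fun j => u (e j)) : Fin (p + 1 + (q + 1)) → V) (Fin.natAdd (p + 1) l)))) =
        (-1) ^ (p + 1) * ∑ e : Equiv.Perm (Fin (p + 1 + q)), ((Equiv.Perm.sign e : ℤ) : ℝ) *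
          (a (fun j => u (e (Fin.castAdd q j))) *
            b.curryLeft v (fun j => u (e (Fin.natAdd (p + 1) j)))) := by
      intro i
      rw [Finset.mul_sum, Finset.mul_sum]
      refine Finset.sum_congr rfl fun e _ => ?_
      rw [(insertNth_natAdd i v _).1, (insertNth_natAdd i v _).2, b.map_insertNth]
      have h1 : ((-1 : ℝ) ^ (i : ℕ)) * (-1 : ℝ) ^ (i : ℕ) = 1 := by
        rw [← mul_pow]; simp
      simp only [Fin.val_natAdd, zsmul_eq_mul, Int.cast_pow, Int.cast_neg, Int.cast_one,
        ContinuousAlternatingMap.curryLeft_apply_apply, pow_add (-1 : ℝ) (p + 1)]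
      linear_combination ((-1 : ℝ) ^ (p + 1) * ((Equiv.Perm.sign e : ℤ) : ℝ) *
        (a (fun j => u (e (Fin.castAdd q j))) *
            b (Matrix.vecCons v (fun j => u (e (Fin.natAdd (p + 1) j)))))) * h1
    rw [Finset.sum_congr rfl fun i _ => hterm i, wedge_apply]
    simp only [Finset.sum_const, Finset.card_univ, Fintype.card_fin, nsmul_eq_mul]
    rw [← mul_assoc, ← mul_assoc, ← mul_assoc, Nat.factorial_succ q]
    congr 1
    push_cast
    have : (q.factorial : ℝ) ≠ 0 := by positivity
    have : ((p + 1).factorial : ℝ) ≠ 0 := by positivity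
    have : (q : ℝ) + 1 ≠ 0 := by positivity
    field_simp

end

/-! ### Calculus of contractions -/

section

variable {V : Type*} [NormedAddCommGroup V] [NormedSpace ℝ V]

/-- The contraction `a ↦ a (v, ·)`. -/
def contract (v : V) {m : ℕ} : (V [⋀^Fin (m + 1)]→L[ℝ] ℝ) →L[ℝ] V [⋀^Fin m]→L[ℝ] ℝ :=
  (ContinuousLinearMap.apply ℝ (V [⋀^Fin m]→L[ℝ] ℝ) v).comp
    (ContinuousAlternatingMap.curryLeftLI (𝕜 := ℝ) (E := V) (F := ℝ)).toContinuousLinearMap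

theorem contract_apply (v : V) {m : ℕ} (a : V [⋀^Fin (m + 1)]→L[ℝ] ℝ) (u : Fin m → V) :
    contract v a u = a (Matrix.vecCons v u) := rfl

/-- The engine of the inductions on the degree: an identity between forms of positive degree may be
checked after contraction with every vector. -/
theorem ext_contract {m : ℕ} {a b : V [⋀^Fin (m + 1)]→L[ℝ] ℝ}
    (h : ∀ v, contract v a = contract v b) : a = b := by
  ext w
  rw [← Matrix.cons_head_tail w]
  exact congrArg (fun c : V [⋀^Fin m]→L[ℝ] ℝ => c (Matrix.vecTail w)) (h (Matrix.vecHead w))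

/-- Right multiplication by a form. -/
def wedgeRight (p : ℕ) {q : ℕ} (b : V [⋀^Fin q]→L[ℝ] ℝ) :
    (V [⋀^Fin p]→L[ℝ] ℝ) →L[ℝ] V [⋀^Fin (p + q)]→L[ℝ] ℝ :=
  (isBoundedBilinearMap_wedge p q).toContinuousLinearMap.flip b

/-- Left multiplication by a form. -/
def wedgeLeft {p : ℕ} (a : V [⋀^Fin p]→L[ℝ] ℝ) (q : ℕ) :
    (V [⋀^Fin q]→L[ℝ] ℝ) →L[ℝ] V [⋀^Fin (p + q)]→L[ℝ] ℝ :=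
  (isBoundedBilinearMap_wedge p q).toContinuousLinearMap a

theorem zero_wedge (p : ℕ) {q : ℕ} (b : V [⋀^Fin q]→L[ℝ] ℝ) :
    wedge (0 : V [⋀^Fin p]→L[ℝ] ℝ) b = 0 := map_zero (wedgeRight p b)

theorem wedge_zero {p : ℕ} (a : V [⋀^Fin p]→L[ℝ] ℝ) (q : ℕ) :
    wedge a (0 : V [⋀^Fin q]→L[ℝ] ℝ) = 0 := map_zero (wedgeLeft a q)

/-- The wedge product with a `1`-form. -/
def wedge₁ {p : ℕ} (a : V [⋀^Fin p]→L[ℝ] ℝ) (θ : V [⋀^Fin 1]→L[ℝ] ℝ) :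
    V [⋀^Fin (p + 1)]→L[ℝ] ℝ := wedge a θ

/-- The wedge product with a `2`-form. -/
def wedge₂ {p : ℕ} (a : V [⋀^Fin p]→L[ℝ] ℝ) (ω : V [⋀^Fin 2]→L[ℝ] ℝ) :
    V [⋀^Fin (p + 2)]→L[ℝ] ℝ := wedge a ω

theorem wedge₁_add_left {p : ℕ} (a a' : V [⋀^Fin p]→L[ℝ] ℝ) (b : V [⋀^Fin 1]→L[ℝ] ℝ) :
    wedge₁ (a + a') b = wedge₁ a b + wedge₁ a' b := wedge_add_left a a' b

theorem wedge₁_smul_left {p : ℕ} (c : ℝ) (a : V [⋀^Fin p]→L[ℝ] ℝ) (b : V [⋀^Fin 1]→L[ℝ] ℝ) :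
    wedge₁ (c • a) b = c • wedge₁ a b := wedge_smul_left c a b

theorem wedge₁_add_right {p : ℕ} (a : V [⋀^Fin p]→L[ℝ] ℝ) (b b' : V [⋀^Fin 1]→L[ℝ] ℝ) :
    wedge₁ a (b + b') = wedge₁ a b + wedge₁ a b' := wedge_add_right a b b'

theorem wedge₁_smul_right {p : ℕ} (c : ℝ) (a : V [⋀^Fin p]→L[ℝ] ℝ) (b : V [⋀^Fin 1]→L[ℝ] ℝ) :
    wedge₁ a (c • b) = c • wedge₁ a b := wedge_smul_right c a b

theorem zero_wedge₁ {p : ℕ} (b : V [⋀^Fin 1]→L[ℝ] ℝ) :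
    wedge₁ (0 : V [⋀^Fin p]→L[ℝ] ℝ) b = 0 := zero_wedge p b

theorem wedge₂_add_left {p : ℕ} (a a' : V [⋀^Fin p]→L[ℝ] ℝ) (b : V [⋀^Fin 2]→L[ℝ] ℝ) :
    wedge₂ (a + a') b = wedge₂ a b + wedge₂ a' b := wedge_add_left a a' b

theorem wedge₂_smul_left {p : ℕ} (c : ℝ) (a : V [⋀^Fin p]→L[ℝ] ℝ) (b : V [⋀^Fin 2]→L[ℝ] ℝ) :
    wedge₂ (c • a) b = c • wedge₂ a b := wedge_smul_left c a b

theorem contract_wedge_one {p : ℕ} (v : V) (a : V [⋀^Fin (p + 1)]→L[ℝ] ℝ)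
    (θ : V [⋀^Fin 1]→L[ℝ] ℝ) :
    contract v (wedge₁ a θ) = wedge₁ (contract v a) θ + ((-1) ^ (p + 1) * θ ![v]) • a := by
  ext u
  refine (wedge_vecCons a θ rfl v u).trans ?_
  rw [ContinuousAlternatingMap.add_apply]
  congr 1
  rw [wedge_zero_right, ContinuousAlternatingMap.smul_apply, ContinuousAlternatingMap.smul_apply,
    smul_eq_mul, smul_eq_mul, mul_assoc]
  rfl

theorem contract_zero_wedge_one (v : V) (a : V [⋀^Fin 0]→L[ℝ] ℝ) (θ : V [⋀^Fin 1]→L[ℝ] ℝ) :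
    contract v (wedge₁ a θ) = θ ![v] • a := by
  ext u
  refine (wedge_zero_left a θ (Matrix.vecCons v u)).trans ?_
  rw [mul_comm, ContinuousAlternatingMap.smul_apply, smul_eq_mul]
  congr 2
  · funext i
    fin_cases i
    rfl
  · exact Subsingleton.elim _ _

theorem contract_wedge_two {p : ℕ} (v : V) (a : V [⋀^Fin (p + 1)]→L[ℝ] ℝ)
    (ω : V [⋀^Fin 2]→L[ℝ] ℝ) :
    contract v (wedge₂ a ω) =
      wedge₂ (contract v a) ω + (-1 : ℝ) ^ (p + 1) • wedge₁ a (contract v ω) := by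
  ext u
  exact wedge_vecCons a ω rfl v u

theorem contract_zero_wedge_two (v : V) (a : V [⋀^Fin 0]→L[ℝ] ℝ) (ω : V [⋀^Fin 2]→L[ℝ] ℝ) :
    contract v (wedge₂ a ω) = wedge₁ a (contract v ω) := by
  ext u
  refine (wedge_zero_left a ω (Matrix.vecCons v u)).trans ?_
  refine Eq.trans ?_ (wedge_zero_left a (contract v ω) u).symm
  rw [contract_apply]
  congr 2
  funext i
  fin_cases i <;> rfl

theorem wedge_one_wedge_one {p : ℕ} (a : V [⋀^Fin p]→L[ℝ] ℝ) (θ θ' : V [⋀^Fin 1]→L[ℝ] ℝ) :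
    wedge₁ (wedge₁ a θ) θ' = -wedge₁ (wedge₁ a θ') θ := by
  induction p with
  | zero =>
    refine ext_contract fun v => ?_
    rw [map_neg, contract_wedge_one, contract_wedge_one, contract_zero_wedge_one,
      contract_zero_wedge_one, wedge₁_smul_left, wedge₁_smul_left]
    module
  | succ p ih =>
    refine ext_contract fun v => ?_
    rw [map_neg, contract_wedge_one, contract_wedge_one,
      contract_wedge_one, contract_wedge_one]
    simp only [wedge₁_add_left, wedge₁_smul_left]
    rw [ih]
    module

/-- Contracting both sides leaves the same statement in lower degree, together with terms `a ∧ ι_v ω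
∧ θ`, which match by the anticommutation of 1-forms. This replaces general associativity and graded
commutativity. -/
theorem wedge_two_wedge_one {p : ℕ} (a : V [⋀^Fin p]→L[ℝ] ℝ) (ω : V [⋀^Fin 2]→L[ℝ] ℝ)
    (θ : V [⋀^Fin 1]→L[ℝ] ℝ) :
    wedge₁ (wedge₂ a ω) θ = wedge₂ (wedge₁ a θ) ω := by
  induction p with
  | zero =>
    refine ext_contract fun v => ?_
    refine (contract_wedge_one (p := 1) v (wedge₂ a ω) θ).trans ?_
    refine Eq.trans ?_ (contract_wedge_two (p := 0) v (wedge₁ a θ) ω).symm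
    rw [contract_zero_wedge_one, contract_zero_wedge_two, wedge₂_smul_left,
      wedge_one_wedge_one a θ]
    module
  | succ p ih =>
    refine ext_contract fun v => ?_
    refine (contract_wedge_one (p := p + 2) v (wedge₂ a ω) θ).trans ?_
    refine Eq.trans ?_ (contract_wedge_two (p := p + 1) v (wedge₁ a θ) ω).symm
    rw [contract_wedge_one, contract_wedge_two]
    simp only [wedge₁_add_left, wedge₁_smul_left, wedge₂_add_left, wedge₂_smul_left]
    rw [← ih, wedge_one_wedge_one a θ]
    module

/-! ### Alternatization of derivatives of wedge products -/

open ContinuousAlternatingMap (alternatizeUncurryFin alternatizeUncurryFin_apply)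

/-- Cartan's formula for the constant field `v`. With `A = Dα` the alternatization is `dα`, and the
identity reads `ι_v dα = D_v α - d(ι_v α)`. -/
theorem contract_alternatizeUncurryFin {m : ℕ} (v : V)
    (A : V →L[ℝ] V [⋀^Fin (m + 1)]→L[ℝ] ℝ) :
    contract v (alternatizeUncurryFin A) =
      A v - alternatizeUncurryFin ((contract v).comp A) := by
  ext u
  rw [contract_apply, alternatizeUncurryFin_apply, Fin.sum_univ_succ,
    ContinuousAlternatingMap.sub_apply, alternatizeUncurryFin_apply, sub_eq_add_neg,
    ← Finset.sum_neg_distrib]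
  congr 1
  · simp
  · refine Finset.sum_congr rfl fun i _ => ?_
    have : i.succ.removeNth (Matrix.vecCons v u) = Matrix.vecCons v (i.removeNth u) := by
      funext j
      refine Fin.cases ?_ (fun j => ?_) j
      · simp [Fin.removeNth]
      · simp [Fin.removeNth]
    rw [this, ContinuousLinearMap.comp_apply, contract_apply]
    simp [pow_succ]

theorem contract_alternatizeUncurryFin_zero (v : V) (A : V →L[ℝ] V [⋀^Fin 0]→L[ℝ] ℝ) :
    contract v (alternatizeUncurryFin A) = A v := by
  ext u
  rw [contract_apply, alternatizeUncurryFin_apply]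
  simp

theorem alternatizeUncurryFin_apply_one (C : V →L[ℝ] V [⋀^Fin 0]→L[ℝ] ℝ) (v : V) :
    alternatizeUncurryFin C ![v] = C v ![] := by
  rw [alternatizeUncurryFin_apply]
  simp

/-- The pointwise content of `d(α ∧ θ) = dα ∧ θ` for a constant `θ`, with `A` in the role of `Dα`.
Contractions of both sides agree by Cartan's formula and induction. -/
theorem alternatizeUncurryFin_wedgeRight_one {p : ℕ} (A : V →L[ℝ] V [⋀^Fin p]→L[ℝ] ℝ)
    (θ : V [⋀^Fin 1]→L[ℝ] ℝ) :
    alternatizeUncurryFin ((wedgeRight p θ).comp A) = wedge₁ (alternatizeUncurryFin A) θ := by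
  induction p with
  | zero =>
    refine ext_contract fun v => ?_
    rw [contract_wedge_one, contract_alternatizeUncurryFin_zero]
    refine (contract_alternatizeUncurryFin (m := 0) v _).trans ?_
    have h : (contract v).comp ((wedgeRight 0 θ).comp A) = θ ![v] • A := by
      ext1 w
      exact contract_zero_wedge_one v (A w) θ
    refine (congrArg (fun B => wedge₁ (A v) θ - alternatizeUncurryFin B) h).trans ?_
    rw [ContinuousAlternatingMap.alternatizeUncurryFin_smul]
    module
  | succ p ih =>
    refine ext_contract fun v => ?_
    rw [contract_wedge_one, contract_alternatizeUncurryFin v A]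
    refine (contract_alternatizeUncurryFin (m := p + 1) v _).trans ?_
    have h : (contract v).comp ((wedgeRight (p + 1) θ).comp A) =
        (wedgeRight p θ).comp ((contract v).comp A) + ((-1) ^ (p + 1) * θ ![v]) • A := by
      ext1 w
      exact contract_wedge_one v (A w) θ
    refine (congrArg (fun B => wedge₁ (A v) θ - alternatizeUncurryFin B) h).trans ?_
    rw [ContinuousAlternatingMap.alternatizeUncurryFin_add,
      ContinuousAlternatingMap.alternatizeUncurryFin_smul, ih, sub_eq_add_neg (A v),
      wedge₁_add_left, ← neg_one_smul ℝ (alternatizeUncurryFin ((contract v).comp A)),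
      wedge₁_smul_left]
    module

theorem alternatizeUncurryFin_wedgeRight_two {p : ℕ} (A : V →L[ℝ] V [⋀^Fin p]→L[ℝ] ℝ)
    (ω : V [⋀^Fin 2]→L[ℝ] ℝ) :
    alternatizeUncurryFin ((wedgeRight p ω).comp A) = wedge₂ (alternatizeUncurryFin A) ω := by
  induction p with
  | zero =>
    refine ext_contract fun v => ?_
    refine Eq.trans ?_ (contract_wedge_two (p := 0) v (alternatizeUncurryFin A) ω).symm
    rw [contract_alternatizeUncurryFin_zero, ← alternatizeUncurryFin_wedgeRight_one]
    refine (contract_alternatizeUncurryFin (m := 1) v _).trans ?_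
    have h : (contract v).comp ((wedgeRight 0 ω).comp A) =
        (wedgeRight 0 (contract v ω)).comp A := by
      ext1 w
      exact contract_zero_wedge_two v (A w) ω
    refine (congrArg (fun B => wedge₂ (A v) ω - alternatizeUncurryFin B) h).trans ?_
    module
  | succ p ih =>
    refine ext_contract fun v => ?_
    refine Eq.trans ?_ (contract_wedge_two (p := p + 1) v (alternatizeUncurryFin A) ω).symm
    rw [contract_alternatizeUncurryFin v A, ← alternatizeUncurryFin_wedgeRight_one]
    refine (contract_alternatizeUncurryFin (m := p + 1 + 1) v _).trans ?_
    have h : (contract v).comp ((wedgeRight (p + 1) ω).comp A) =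
        (wedgeRight p ω).comp ((contract v).comp A) +
          (-1 : ℝ) ^ (p + 1) • (wedgeRight (p + 1) (contract v ω)).comp A := by
      ext1 w
      exact contract_wedge_two v (A w) ω
    refine (congrArg (fun B => wedge₂ (A v) ω - alternatizeUncurryFin B) h).trans ?_
    rw [ContinuousAlternatingMap.alternatizeUncurryFin_add,
      ContinuousAlternatingMap.alternatizeUncurryFin_smul, sub_eq_add_neg (A v),
      wedge₂_add_left, ← neg_one_smul ℝ (alternatizeUncurryFin ((contract v).comp A)),
      wedge₂_smul_left]
    refine (congrArg (fun B => wedge₂ (A v) ω - (B + (-1 : ℝ) ^ (p + 1) • alternatizeUncurryFin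
      ((wedgeRight (p + 1) (contract v ω)).comp A))) (ih ((contract v).comp A))).trans ?_
    module

/-- The map `c ↦ c • a` on `0`-forms. -/
def scaleForm {p : ℕ} (a : V [⋀^Fin p]→L[ℝ] ℝ) :
    (V [⋀^Fin 0]→L[ℝ] ℝ) →L[ℝ] V [⋀^Fin p]→L[ℝ] ℝ :=
  (ContinuousAlternatingMap.apply ℝ V ℝ ![]).smulRight a

theorem scaleForm_apply {p : ℕ} (a : V [⋀^Fin p]→L[ℝ] ℝ) (c : V [⋀^Fin 0]→L[ℝ] ℝ) :
    scaleForm a c = c ![] • a := rfl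

theorem neg_one_pow_mul_self (p : ℕ) : ((-1 : ℝ) ^ p) * (-1 : ℝ) ^ p = 1 := by
  rw [← mul_pow]
  simp

/-- The pointwise content of `d(f a) = (-1)^p a ∧ df` for a constant form `a` and a function `f`. -/
theorem alternatizeUncurryFin_scaleForm {p : ℕ} (a : V [⋀^Fin p]→L[ℝ] ℝ)
    (C : V →L[ℝ] V [⋀^Fin 0]→L[ℝ] ℝ) :
    alternatizeUncurryFin ((scaleForm a).comp C) =
      (-1 : ℝ) ^ p • wedge₁ a (alternatizeUncurryFin C) := by
  induction p with
  | zero =>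
    refine ext_contract fun v => ?_
    rw [map_smul, contract_zero_wedge_one, alternatizeUncurryFin_apply_one, pow_zero, one_smul]
    exact contract_alternatizeUncurryFin_zero v _
  | succ p ih =>
    refine ext_contract fun v => ?_
    rw [map_smul, contract_wedge_one, alternatizeUncurryFin_apply_one,
      contract_alternatizeUncurryFin]
    have h : (contract v).comp ((scaleForm a).comp C) = (scaleForm (contract v a)).comp C := by
      ext1 w
      exact (contract v).map_smul (C w ![]) a
    rw [h, ih, smul_add, smul_smul, ← mul_assoc, neg_one_pow_mul_self,
      ContinuousLinearMap.comp_apply, scaleForm_apply]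
    module

theorem wedge_contract_alternatizeUncurryFin {p : ℕ} (a : V [⋀^Fin p]→L[ℝ] ℝ)
    (B : V →L[ℝ] V [⋀^Fin 1]→L[ℝ] ℝ) (v : V) :
    wedge₁ a (contract v (alternatizeUncurryFin B)) = wedge₁ a (B v) -
      (-1 : ℝ) ^ p • alternatizeUncurryFin ((scaleForm a).comp ((contract v).comp B)) := by
  rw [contract_alternatizeUncurryFin, sub_eq_add_neg, wedge₁_add_right, ← neg_one_smul ℝ,
    wedge₁_smul_right, alternatizeUncurryFin_scaleForm, smul_smul, neg_one_pow_mul_self]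
  module

/-- The other half of the Leibniz rule, `d(a ∧ β) = (-1)^p a ∧ dβ` for constant `a` and a 1-form
`β`. Contraction of `a ∧ β` produces the function `β(v)`, whence the appearance of `scaleForm`. -/
theorem alternatizeUncurryFin_wedgeLeft_one {p : ℕ} (a : V [⋀^Fin p]→L[ℝ] ℝ)
    (B : V →L[ℝ] V [⋀^Fin 1]→L[ℝ] ℝ) :
    (alternatizeUncurryFin ((wedgeLeft a 1).comp B) : V [⋀^Fin (p + 1 + 1)]→L[ℝ] ℝ) =
      (-1 : ℝ) ^ p • wedge₂ a (alternatizeUncurryFin B) := by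
  induction p with
  | zero =>
    refine ext_contract fun v => ?_
    rw [map_smul, contract_zero_wedge_two, wedge_contract_alternatizeUncurryFin]
    refine (contract_alternatizeUncurryFin (m := 0) v _).trans ?_
    have h : (contract v).comp ((wedgeLeft a 1).comp B) =
        (scaleForm a).comp ((contract v).comp B) := by
      ext1 w
      exact contract_zero_wedge_one v a (B w)
    refine (congrArg (fun B' => wedge₁ a (B v) - alternatizeUncurryFin B') h).trans ?_
    module
  | succ p ih =>
    refine ext_contract fun v => ?_
    rw [map_smul, contract_wedge_two, wedge_contract_alternatizeUncurryFin]
    refine (contract_alternatizeUncurryFin (m := p + 1) v _).trans ?_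
    have h : (contract v).comp ((wedgeLeft a 1).comp B) = (wedgeLeft (contract v a) 1).comp B +
        (-1 : ℝ) ^ (p + 1) • (scaleForm a).comp ((contract v).comp B) := by
      ext1 w
      refine (contract_wedge_one v a (B w)).trans ?_
      rw [mul_smul]
      rfl
    refine (congrArg (fun B' => wedge₁ a (B v) - alternatizeUncurryFin B') h).trans ?_
    rw [ContinuousAlternatingMap.alternatizeUncurryFin_add,
      ContinuousAlternatingMap.alternatizeUncurryFin_smul, smul_add, smul_smul _ _ (_ - _),
      neg_one_pow_mul_self]
    refine (congrArg (fun x => wedge₁ a (B v) - (x + (-1 : ℝ) ^ (p + 1) • alternatizeUncurryFin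
      ((scaleForm a).comp ((contract v).comp B)))) (ih (contract v a))).trans ?_
    module

theorem alternatizeUncurryFin_wedgeLeft_contract {p : ℕ} (a : V [⋀^Fin p]→L[ℝ] ℝ)
    {B : V →L[ℝ] V [⋀^Fin 2]→L[ℝ] ℝ} (hB : alternatizeUncurryFin B = 0) (v : V) :
    (alternatizeUncurryFin ((wedgeLeft a 1).comp ((contract v).comp B)) :
        V [⋀^Fin (p + 1 + 1)]→L[ℝ] ℝ) = (-1 : ℝ) ^ p • wedge₂ a (B v) := by
  rw [alternatizeUncurryFin_wedgeLeft_one]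
  congr 2
  -- When the alternatization of `B` vanishes, Cartan's formula says that `B v` is the
  -- alternatization of `ι_v B`.
  have := contract_alternatizeUncurryFin v B
  rw [hB, map_zero] at this
  exact (sub_eq_zero.1 this.symm).symm

/-- For a symplectic form only the closed case of the Leibniz rule matters, and restricting to it
avoids products with 3-forms. -/
theorem alternatizeUncurryFin_wedgeLeft_two {p : ℕ} (a : V [⋀^Fin p]→L[ℝ] ℝ)
    {B : V →L[ℝ] V [⋀^Fin 2]→L[ℝ] ℝ} (hB : alternatizeUncurryFin B = 0) :
    alternatizeUncurryFin ((wedgeLeft a 2).comp B) = 0 := by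
  induction p with
  | zero =>
    refine ext_contract fun v => ?_
    refine (contract_alternatizeUncurryFin (m := 1) v _).trans ?_
    have h : (contract v).comp ((wedgeLeft a 2).comp B) =
        (wedgeLeft a 1).comp ((contract v).comp B) := by
      ext1 w
      exact contract_zero_wedge_two v a (B w)
    refine (congrArg (fun B' => wedge₂ a (B v) - alternatizeUncurryFin B') h).trans ?_
    rw [map_zero]
    refine (congrArg (fun x => wedge₂ a (B v) - x)
      (alternatizeUncurryFin_wedgeLeft_contract a hB v)).trans ?_
    module
  | succ p ih =>
    refine ext_contract fun v => ?_
    refine (contract_alternatizeUncurryFin (m := p + 2) v _).trans ?_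
    have h : (contract v).comp ((wedgeLeft a 2).comp B) = (wedgeLeft (contract v a) 2).comp B +
        (-1 : ℝ) ^ (p + 1) • (wedgeLeft a 1).comp ((contract v).comp B) := by
      ext1 w
      exact contract_wedge_two v a (B w)
    refine (congrArg (fun B' => wedge₂ a (B v) - alternatizeUncurryFin B') h).trans ?_
    refine (congrArg (fun x => wedge₂ a (B v) - x)
      (ContinuousAlternatingMap.alternatizeUncurryFin_add _ _)).trans ?_
    refine (congrArg₂ (fun x y => wedge₂ a (B v) - (x + y)) (ih (contract v a))
      ((ContinuousAlternatingMap.alternatizeUncurryFin_smul _ _).trans (congrArg _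
        (alternatizeUncurryFin_wedgeLeft_contract a hB v)))).trans ?_
    rw [map_zero, smul_smul, neg_one_pow_mul_self]
    module

end

/-! ### Linear Lefschetz theory -/

section

variable {V : Type*} [NormedAddCommGroup V] [NormedSpace ℝ V]

/-- The operator `a ↦ a ∧ w^k` on alternating forms. -/
def lefPt (w : V [⋀^Fin 2]→L[ℝ] ℝ) :
    (k : ℕ) → {q : ℕ} → (V [⋀^Fin q]→L[ℝ] ℝ) →L[ℝ] V [⋀^Fin (q + 2 * k)]→L[ℝ] ℝ
  | 0, q => ContinuousLinearMap.id ℝ (V [⋀^Fin q]→L[ℝ] ℝ)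
  | k + 1, q => (wedgeRight (q + 2 * k) w).comp (lefPt w k)

theorem lefPt_succ (w : V [⋀^Fin 2]→L[ℝ] ℝ) (k : ℕ) {q : ℕ} (a : V [⋀^Fin q]→L[ℝ] ℝ) :
    lefPt w (k + 1) a = wedge₂ (lefPt w k a) w := rfl

theorem heq_wedge_two {p q : ℕ} (h : p = q) {a : V [⋀^Fin p]→L[ℝ] ℝ} {b : V [⋀^Fin q]→L[ℝ] ℝ}
    (hab : HEq a b) (w : V [⋀^Fin 2]→L[ℝ] ℝ) : HEq (wedge₂ a w) (wedge₂ b w) := by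
  subst h
  rw [eq_of_heq hab]

theorem heq_lefPt_succ (w : V [⋀^Fin 2]→L[ℝ] ℝ) (k : ℕ) {q : ℕ} (a : V [⋀^Fin q]→L[ℝ] ℝ) :
    HEq (lefPt w (k + 1) a) (lefPt w k (wedge₂ a w)) := by
  induction k with
  | zero => rfl
  | succ k ih => exact heq_wedge_two (by omega) ih w

theorem eq_zero_iff_of_heq {p q : ℕ} (h : p = q) {a : V [⋀^Fin p]→L[ℝ] ℝ}
    {b : V [⋀^Fin q]→L[ℝ] ℝ} (hab : HEq a b) : a = 0 ↔ b = 0 := by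
  subst h
  rw [eq_of_heq hab]

/-- A factor `w` is moved from the outside to the inside. The degrees `q + 2(k+1)` and `(q+2) + 2k`
are only propositionally equal, so just the vanishing is transported across the `HEq`. -/
theorem lefPt_succ_eq_zero_iff (w : V [⋀^Fin 2]→L[ℝ] ℝ) (k : ℕ) {q : ℕ}
    (a : V [⋀^Fin q]→L[ℝ] ℝ) : lefPt w (k + 1) a = 0 ↔ lefPt w k (wedge₂ a w) = 0 :=
  eq_zero_iff_of_heq (by omega) (heq_lefPt_succ w k a)

theorem lefPt_wedge_one_eq_zero {w : V [⋀^Fin 2]→L[ℝ] ℝ} {k q : ℕ} {a : V [⋀^Fin q]→L[ℝ] ℝ}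
    (h : lefPt w k a = 0) (θ : V [⋀^Fin 1]→L[ℝ] ℝ) : lefPt w k (wedge₁ a θ) = 0 := by
  induction k generalizing q with
  | zero =>
    obtain rfl : a = 0 := h
    rw [zero_wedge₁, map_zero]
  | succ k ih =>
    rw [lefPt_succ_eq_zero_iff] at h ⊢
    rw [← wedge_two_wedge_one]
    exact ih h

/-- Contracting `a ∧ w^k = 0` gives `ι_v a ∧ w^k` plus a multiple of `a ∧ ι_v w ∧ w^{k-1}`; one more
factor `w` kills the second term. The degree drops by one while `k` grows by one, so their sum is
preserved. -/
theorem lefPt_contract_eq_zero {w : V [⋀^Fin 2]→L[ℝ] ℝ} {k q : ℕ}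
    {a : V [⋀^Fin (q + 1)]→L[ℝ] ℝ} (h : lefPt w k a = 0) (v : V) :
    lefPt w (k + 1) (contract v a) = 0 := by
  induction k generalizing q with
  | zero =>
    obtain rfl : a = 0 := h
    rw [map_zero, map_zero]
  | succ k ih =>
    have h' := (lefPt_succ_eq_zero_iff w k a).1 h
    have h2 := ih (q := q + 2) h'
    have h3 : contract v (wedge₂ a w) = _ := contract_wedge_two v a w
    rw [lefPt_succ_eq_zero_iff]
    have h4 := lefPt_wedge_one_eq_zero h (contract v w)
    have h5 : lefPt w (k + 1)
        (wedge₂ (contract v a) w + (-1 : ℝ) ^ (q + 1) • wedge₁ a (contract v w)) = 0 := by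
      rw [← h3]
      exact h2
    rw [map_add, map_smul] at h5
    have h6 : lefPt w (k + 1) (wedge₂ (contract v a) w) +
      (-1 : ℝ) ^ (q + 1) • lefPt w (k + 1) (wedge₁ a (contract v w)) = 0 := h5
    rwa [h4, smul_zero, add_zero] at h6

/-- Contraction of the identity `a ∧ w^{k+1} = 0`. -/
theorem lefPt_derivation {w : V [⋀^Fin 2]→L[ℝ] ℝ} {k q : ℕ}
    {a : V [⋀^Fin (q + 1)]→L[ℝ] ℝ} (h : lefPt w (k + 1) a = 0) (v : V) :
    lefPt w k (wedge₂ (contract v a) w +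
      ((k + 1) * (-1 : ℝ) ^ (q + 1)) • wedge₁ a (contract v w)) = 0 := by
  induction k generalizing q with
  | zero =>
    have h1 : wedge₂ a w = 0 := h
    have h3 := contract_wedge_two v a w
    rw [h1, map_zero] at h3
    rw [Nat.cast_zero, zero_add, one_mul, ← h3, map_zero]
  | succ k ih =>
    -- The induction hypothesis is applied to `a ∧ w`. Contracting its factor `w` contributes one
    -- further copy of `a ∧ ι_v w ∧ w`, which raises the coefficient from `k + 1` to `k + 2`.
    have h' := (lefPt_succ_eq_zero_iff w (k + 1) a).1 h
    have h2 := ih (q := q + 2) h'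
    have h3 : contract v (wedge₂ a w) = _ := contract_wedge_two v a w
    rw [lefPt_succ_eq_zero_iff]
    refine Eq.trans ?_ h2
    refine congrArg (fun x : V [⋀^Fin (q + 2 + 2)]→L[ℝ] ℝ => lefPt w k x) ?_
    refine Eq.trans ?_ (congrArg₂ (fun (x : V [⋀^Fin (q + 2)]→L[ℝ] ℝ)
      (y : V [⋀^Fin (q + 2 + 2)]→L[ℝ] ℝ) => wedge₂ x w +
      ((k + 1) * (-1 : ℝ) ^ (q + 2 + 1)) • y) h3 (wedge_two_wedge_one a w (contract v w))).symm
    simp only [wedge₂_add_left, wedge₂_smul_left]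
    push_cast
    module

theorem lefPt_derivation_zero {w : V [⋀^Fin 2]→L[ℝ] ℝ} {k : ℕ}
    {a : V [⋀^Fin 0]→L[ℝ] ℝ} (h : lefPt w (k + 1) a = 0) (v : V) :
    lefPt w k (wedge₁ a (contract v w)) = 0 := by
  cases k with
  | zero =>
    have h1 : wedge₂ a w = 0 := h
    have h3 := contract_zero_wedge_two v a w
    rw [h1, map_zero] at h3
    rw [← h3, map_zero]
  | succ k =>
    have h2 := lefPt_derivation (q := 1) ((lefPt_succ_eq_zero_iff w (k + 1) a).1 h) v
    have h3 : contract v (wedge₂ a w) = _ := contract_zero_wedge_two v a w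
    rw [lefPt_succ_eq_zero_iff]
    -- The factor `k + 2` is `1 + (k + 1)`: one copy from contracting `a ∧ w`, and `k + 1` copies
    -- from the remaining powers of `w`.
    have h4 : lefPt w k (((k : ℝ) + 2) • wedge₂ (wedge₁ a (contract v w)) w) = 0 := by
      refine Eq.trans ?_ h2
      refine congrArg (fun x : V [⋀^Fin (1 + 2)]→L[ℝ] ℝ => lefPt w k x) ?_
      refine Eq.trans ?_ (congrArg₂ (fun (x : V [⋀^Fin 1]→L[ℝ] ℝ)
        (y : V [⋀^Fin (1 + 2)]→L[ℝ] ℝ) => wedge₂ x w +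
        ((k + 1) * (-1 : ℝ) ^ (1 + 1)) • y) h3 (wedge_two_wedge_one a w (contract v w))).symm
      module
    rw [map_smul] at h4
    exact (smul_eq_zero.1 h4).resolve_left (by positivity)

theorem lefPt_compContinuousLinearMap {W : Type*} [NormedAddCommGroup W] [NormedSpace ℝ W]
    (f : W →L[ℝ] V) (w : V [⋀^Fin 2]→L[ℝ] ℝ) (k : ℕ) {q : ℕ} (a : V [⋀^Fin q]→L[ℝ] ℝ) :
    (lefPt w k a).compContinuousLinearMap f =
      lefPt (w.compContinuousLinearMap f) k (a.compContinuousLinearMap f) := by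
  induction k with
  | zero => rfl
  | succ k ih =>
    refine (wedge_compContinuousLinearMap (lefPt w k a) w f).trans ?_
    rw [ih]
    rfl

/-- A nondegenerate alternating bilinear form. -/
def Nondeg (w : V [⋀^Fin 2]→L[ℝ] ℝ) : Prop := ∀ v, (∀ u, w ![v, u] = 0) → v = 0

/-! ### Nondegenerate 2-forms and the nonvanishing of their powers. -/

theorem two_form_self (w : V [⋀^Fin 2]→L[ℝ] ℝ) (v : V) : w ![v, v] = 0 :=
  w.map_eq_zero_of_eq _ (i := 0) (j := 1) rfl (by simp)

theorem two_form_swap (w : V [⋀^Fin 2]→L[ℝ] ℝ) (v u : V) : w ![v, u] = -w ![u, v] := by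
  have := w.toAlternatingMap.map_swap ![u, v] (i := 0) (j := 1) (by simp)
  refine Eq.trans (congrArg w ?_) this
  funext i
  fin_cases i <;> rfl

theorem contract_two_apply (w : V [⋀^Fin 2]→L[ℝ] ℝ) (v u : V) :
    contract v w ![u] = w ![v, u] := rfl

/-- The linear functional `w (v, ·)`. -/
def pairing (w : V [⋀^Fin 2]→L[ℝ] ℝ) (v : V) : V →L[ℝ] ℝ :=
  (ContinuousAlternatingMap.ofSubsingleton ℝ V ℝ (0 : Fin 1)).symm (contract v w)

theorem pairing_apply (w : V [⋀^Fin 2]→L[ℝ] ℝ) (v u : V) : pairing w v u = w ![v, u] := by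
  refine Eq.trans ?_ (contract_two_apply w v u)
  simp only [pairing]
  refine (congrArg (contract v w) ?_)
  funext i
  fin_cases i
  rfl

/-- The powers `w^k`, `2k ≤ dim V`, of a nondegenerate form are nonzero. -/
theorem lefPt_zero_form_ne_zero {k : ℕ} {V : Type*} [NormedAddCommGroup V] [NormedSpace ℝ V]
    [FiniteDimensional ℝ V] {w : V [⋀^Fin 2]→L[ℝ] ℝ} (hw : Nondeg w)
    (hk : 2 * k ≤ Module.finrank ℝ V) {c : V [⋀^Fin 0]→L[ℝ] ℝ} (hc : c ≠ 0) :
    lefPt w k c ≠ 0 := by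
  induction k generalizing V with
  | zero => exact hc
  | succ k ih =>
    intro h
    have : Nontrivial V := Module.nontrivial_of_finrank_pos (R := ℝ) (by omega)
    obtain ⟨v, hv⟩ := exists_ne (0 : V)
    obtain ⟨u, hu⟩ : ∃ u, w ![v, u] ≠ 0 := by
      by_contra! hcon
      exact hv (hw v hcon)
    have h1 := lefPt_derivation_zero h v
    -- Induction through the symplectic complement of the plane spanned by `v` and `u`. Contracting
    -- `c w^{k+1} = 0` with `v` gives `b ∧ w^k = 0` for `b = c ι_v w`. Contracting again with `u`
    -- gives `w(v,u) c w^k` plus a multiple of `b ∧ ι_u w ∧ w^{k-1}`, and the latter dies on `U`,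
    -- where `b` vanishes.
    let U : Submodule ℝ V := LinearMap.ker (pairing w v).toLinearMap ⊓
      LinearMap.ker (pairing w u).toLinearMap
    have hU : ∀ x : U, w ![v, x] = 0 ∧ w ![u, x] = 0 := fun x =>
      ⟨(pairing_apply w v x).symm.trans x.2.1, (pairing_apply w u x).symm.trans x.2.2⟩
    set b : V [⋀^Fin 1]→L[ℝ] ℝ := wedge₁ c (contract v w) with hb
    have hbU : b.compContinuousLinearMap U.subtypeL = 0 := by
      refine (wedge_compContinuousLinearMap c (contract v w) U.subtypeL).trans ?_
      have : (contract v w).compContinuousLinearMap U.subtypeL = 0 := by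
        ext x
        have hx : x = ![x 0] := by
          funext i
          fin_cases i
          rfl
        rw [hx]
        refine Eq.trans ?_ (hU (x 0)).1
        rw [← contract_two_apply, ContinuousAlternatingMap.compContinuousLinearMap_apply]
        refine congrArg (contract v w) ?_
        funext i
        fin_cases i
        rfl
      rw [this]
      exact wedge_zero _ 1
    cases k with
    | zero =>
      have h2 : b = 0 := h1
      have h3 := contract_zero_wedge_one u c (contract v w)
      rw [← hb, h2, map_zero, contract_two_apply] at h3
      exact (smul_ne_zero hu hc) h3.symm
    | succ k =>
      have h2 := congrArg (fun x => x.compContinuousLinearMap U.subtypeL)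
        (lefPt_derivation (q := 0) h1 u)
      simp only [lefPt_compContinuousLinearMap] at h2
      have h3 : lefPt (w.compContinuousLinearMap U.subtypeL) (k + 1)
          (c.compContinuousLinearMap U.subtypeL) = 0 := by
        rw [lefPt_succ_eq_zero_iff]
        have h4 : (wedge₂ (contract u b) w +
            (((k : ℝ) + 1) * (-1 : ℝ) ^ (0 + 1)) • wedge₁ b (contract u w)).compContinuousLinearMap
              U.subtypeL = w ![v, u] • wedge₂ (c.compContinuousLinearMap U.subtypeL)
                (w.compContinuousLinearMap U.subtypeL) := by
          rw [hb, contract_zero_wedge_one, ← hb]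
          refine (congrArg₂ (fun x y => x + (((k : ℝ) + 1) * (-1 : ℝ) ^ (0 + 1)) • y)
            (wedge_compContinuousLinearMap _ w U.subtypeL)
            (wedge_compContinuousLinearMap b (contract u w) U.subtypeL)).trans ?_
          rw [hbU]
          refine (congrArg (fun y => _ + (((k : ℝ) + 1) * (-1 : ℝ) ^ (0 + 1)) • y)
            (zero_wedge 1 _)).trans ?_
          rw [smul_zero, add_zero]
          exact wedge₂_smul_left _ (c.compContinuousLinearMap U.subtypeL) _
        rw [h4, map_smul] at h2
        exact (smul_eq_zero.1 (h2.trans rfl)).resolve_left hu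
      refine ih (V := U) ?_ ?_ ?_ h3
      · intro x hx
        have : (x : V) = 0 := by
          refine hw x fun y => ?_
          have hxU : ∀ z ∈ U, pairing w x z = 0 := by
            intro z hz
            rw [pairing_apply]
            refine Eq.trans ?_ (hx ⟨z, hz⟩)
            rw [ContinuousAlternatingMap.compContinuousLinearMap_apply]
            refine congrArg w ?_
            funext i
            fin_cases i <;> rfl
          have e1 : pairing w x v = 0 := by
            rw [pairing_apply, two_form_swap, (hU x).1, neg_zero]
          have e2 : pairing w x u = 0 := by
            rw [pairing_apply, two_form_swap, (hU x).2, neg_zero]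
          -- The projection of `y` to `U` along the plane spanned by `v` and `u`. An `x` in `U`
          -- pairs to zero with that plane, so `w(x, y) = 0` follows.
          have hz := hxU (y + (w ![u, y] / w ![v, u]) • v - (w ![v, y] / w ![v, u]) • u) (by
            refine ⟨?_, ?_⟩
            · change pairing w v _ = 0
              rw [map_sub, map_add, map_smul, map_smul, pairing_apply, pairing_apply,
                pairing_apply, two_form_self, smul_zero, smul_eq_mul]
              field_simp
              ring
            · change pairing w u _ = 0
              rw [map_sub, map_add, map_smul, map_smul, pairing_apply, pairing_apply,
                pairing_apply, two_form_self, smul_zero, smul_eq_mul, two_form_swap w u v]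
              field_simp
              ring)
          rw [map_sub, map_add, map_smul, map_smul, e1, e2] at hz
          simpa [pairing_apply] using hz
        exact Subtype.ext this
      -- `U` is the kernel of a map to `ℝ × ℝ`, so its codimension is at most 2.
      · have hrank := LinearMap.finrank_range_add_finrank_ker
          ((pairing w v).toLinearMap.prod (pairing w u).toLinearMap)
        rw [LinearMap.ker_prod] at hrank
        have hle := Submodule.finrank_le
          (LinearMap.range ((pairing w v).toLinearMap.prod (pairing w u).toLinearMap))
        rw [Module.finrank_prod, Module.finrank_self] at hle
        change 2 * (k + 1) ≤ Module.finrank ℝ U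
        change _ + Module.finrank ℝ U = _ at hrank
        omega
      · intro h0
        apply hc
        ext x
        have := congrArg (fun z => z ![]) h0
        refine Eq.trans (congrArg c (Subsingleton.elim _ _)) this

/-! ### Dimensions of spaces of alternating forms. -/

theorem continuous_alternatingMap [FiniteDimensional ℝ V] {q : ℕ} (f : V [⋀^Fin q]→ₗ[ℝ] ℝ) :
    Continuous f := by
  let b := Module.finBasis ℝ V
  have h : (f : (Fin q → V) → ℝ) = fun v => ∑ r : Fin q → Fin (Module.finrank ℝ V),
      (∏ i, b.repr (v i) (r i)) * f (fun i => b (r i)) := by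
    funext v
    have h1 : f v = f.toMultilinearMap fun i => ∑ j, b.repr (v i) j • b j := by
      simp only [b.sum_repr]
      rfl
    rw [h1, MultilinearMap.map_sum]
    refine Finset.sum_congr rfl fun r _ => ?_
    exact f.toMultilinearMap.map_smul_univ (fun i => b.repr (v i) (r i)) fun i => b (r i)
  rw [h]
  refine continuous_finsetSum _ fun r _ => Continuous.mul (continuous_finsetProd _ fun i _ => ?_)
    continuous_const
  exact (b.coord (r i)).continuous_of_finiteDimensional.comp (continuous_apply i)

/-- In finite dimensions, alternating maps are continuous. -/
def alternatingEquiv [FiniteDimensional ℝ V] (q : ℕ) :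
    (V [⋀^Fin q]→L[ℝ] ℝ) ≃ₗ[ℝ] V [⋀^Fin q]→ₗ[ℝ] ℝ where
  toFun f := f.toAlternatingMap
  map_add' _ _ := rfl
  map_smul' _ _ := rfl
  invFun f := { f with cont := continuous_alternatingMap f }
  left_inv _ := rfl
  right_inv _ := rfl

/-- Alternating forms as functionals on the exterior power. -/
def formEquivDual (V : Type*) [NormedAddCommGroup V] [NormedSpace ℝ V] [FiniteDimensional ℝ V]
    (q : ℕ) : (V [⋀^Fin q]→L[ℝ] ℝ) ≃ₗ[ℝ] Module.Dual ℝ (⋀[ℝ]^q V) :=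
  (alternatingEquiv q).trans exteriorPower.alternatingMapLinearEquiv

instance [FiniteDimensional ℝ V] (q : ℕ) : FiniteDimensional ℝ (V [⋀^Fin q]→L[ℝ] ℝ) :=
  Module.Finite.equiv (formEquivDual V q).symm

theorem finrank_form [FiniteDimensional ℝ V] (q : ℕ) :
    Module.finrank ℝ (V [⋀^Fin q]→L[ℝ] ℝ) = (Module.finrank ℝ V).choose q := by
  rw [(formEquivDual V q).finrank_eq, Subspace.dual_finrank_eq, exteriorPower.finrank_eq]

theorem form_eq_zero_of_finrank_lt [FiniteDimensional ℝ V] {q : ℕ}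
    (h : Module.finrank ℝ V < q) (a : V [⋀^Fin q]→L[ℝ] ℝ) : a = 0 := by
  have := Module.finrank_zero_iff.1 ((finrank_form (V := V) q).trans (Nat.choose_eq_zero_of_lt h))
  exact Subsingleton.elim _ _

/-- Contraction replaces `(p, k)` by `(p - 1, k + 1)` and keeps `p + k ≤ n`. The induction ends at
0-forms, where the claim is that `w^k ≠ 0`. -/
theorem lefPt_injective [FiniteDimensional ℝ V] {w : V [⋀^Fin 2]→L[ℝ] ℝ} (hw : Nondeg w)
    {n : ℕ} (hn : Module.finrank ℝ V = 2 * n) {p k : ℕ} (hpk : p + k ≤ n)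
    {a : V [⋀^Fin p]→L[ℝ] ℝ} (ha : lefPt w k a = 0) : a = 0 := by
  induction p generalizing k with
  | zero =>
    by_contra hc
    exact lefPt_zero_form_ne_zero hw (by omega) hc ha
  | succ p ih =>
    refine ext_contract fun v => ?_
    rw [map_zero]
    exact ih (by omega) (lefPt_contract_eq_zero ha v)

/-- Injectivity suffices because the spaces of `p`- and `(2n-p)`-forms have equal dimension. -/
theorem lefPt_bijective [FiniteDimensional ℝ V] {w : V [⋀^Fin 2]→L[ℝ] ℝ} (hw : Nondeg w)
    {n : ℕ} (hn : Module.finrank ℝ V = 2 * n) {p k : ℕ} (hpk : p + k = n) :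
    Function.Bijective (lefPt w k (q := p)) := by
  have hinj : Function.Injective (lefPt w k (q := p)).toLinearMap :=
    (injective_iff_map_eq_zero _).2 fun a ha => lefPt_injective hw hn hpk.le ha
  refine ⟨hinj, ?_⟩
  refine (LinearMap.injective_iff_surjective_of_finrank_eq_finrank ?_).1 hinj
  rw [finrank_form, finrank_form, hn]
  exact Nat.choose_symm_of_eq_add (by omega)

theorem lefPt_isInvertible [FiniteDimensional ℝ V] {w : V [⋀^Fin 2]→L[ℝ] ℝ} (hw : Nondeg w)
    {n : ℕ} (hn : Module.finrank ℝ V = 2 * n) {p k : ℕ} (hpk : p + k = n) :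
    (lefPt w k (q := p)).IsInvertible :=
  ⟨(LinearEquiv.ofBijective (lefPt w k (q := p)).toLinearMap
    (lefPt_bijective hw hn hpk)).toContinuousLinearEquiv, by ext1; rfl⟩

/-- Smooth dependence of `L_w^k` on `w`, needed for the smoothness of its pointwise inverse along a
symplectic form. -/
theorem contDiff_lefPt (k p : ℕ) :
    ContDiff ℝ ((⊤ : ℕ∞) : WithTop ℕ∞)
      (fun w : V [⋀^Fin 2]→L[ℝ] ℝ => lefPt w k (q := p)) := by
  induction k with
  | zero => exact contDiff_const
  | succ k ih =>
    let F : (V [⋀^Fin 2]→L[ℝ] ℝ) →L[ℝ] (V [⋀^Fin (p + 2 * k)]→L[ℝ] ℝ) →L[ℝ]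
        V [⋀^Fin (p + 2 * k + 2)]→L[ℝ] ℝ :=
      (isBoundedBilinearMap_wedge (p + 2 * k) 2).toContinuousLinearMap.flip
    have hF : ContDiff ℝ ((⊤ : ℕ∞) : WithTop ℕ∞) F := by fun_prop
    exact ContDiff.clm_comp (g := fun w => F w) hF ih

end

section

variable {E : Type*} [NormedAddCommGroup E] [NormedSpace ℝ E]
variable {M : Type*} [TopologicalSpace M] [ChartedSpace E M]

/-! ### Smooth forms in charts -/

/-- The value of a form at a point, as an alternating form on the model space. -/
def ptForm {q : ℕ} (α : RoughForm E M q) (x : M) : E [⋀^Fin q]→L[ℝ] ℝ := α x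

/-- The derivative of the inverse of a chart. -/
def chartDeriv (E : Type*) [NormedAddCommGroup E] [NormedSpace ℝ E] {M : Type*}
    [TopologicalSpace M] [ChartedSpace E M] (x₀ : M) (y : E) : E →L[ℝ] E :=
  mfderiv 𝓘(ℝ, E) 𝓘(ℝ, E) (extChartAt 𝓘(ℝ, E) x₀).symm y

theorem localRep_eq {q : ℕ} (α : RoughForm E M q) (x₀ : M) (y : E) :
    localRep α x₀ y = (ptForm α ((extChartAt 𝓘(ℝ, E) x₀).symm y)).compContinuousLinearMap
      (chartDeriv E x₀ y) := rfl

theorem ptForm_lefPow (ω : Form E M 2) (k : ℕ) {q : ℕ} (α : Form E M q) (x : M) :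
    ptForm (lefPow ω k α).1 x = lefPt (ptForm ω.1 x) k (ptForm α.1 x) := by
  induction k with
  | zero => rfl
  | succ k ih =>
    rw [lefPt_succ, ← ih]
    rfl

theorem contDiffAt_localRep {q : ℕ} (α : Form E M q) {x₀ : M} {y : E}
    (hy : y ∈ (extChartAt 𝓘(ℝ, E) x₀).target) :
    ContDiffAt ℝ ((⊤ : ℕ∞) : WithTop ℕ∞) (localRep α.1 x₀) y :=
  (α.2 x₀).contDiffAt ((isOpen_extChartAt_target x₀).mem_nhds hy)

theorem form_eq_zero [FiniteDimensional ℝ E] {q : ℕ} (h : Module.finrank ℝ E < q)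
    (α : Form E M q) : α = 0 :=
  Subtype.ext (funext fun x => form_eq_zero_of_finrank_lt h (ptForm α.1 x))

variable [IsManifold 𝓘(ℝ, E) ((⊤ : ℕ∞) : WithTop ℕ∞) M]

theorem isInvertible_chartDeriv {x₀ : M} {y : E} (hy : y ∈ (extChartAt 𝓘(ℝ, E) x₀).target) :
    (chartDeriv E x₀ y).IsInvertible := by
  have : IsManifold 𝓘(ℝ, E) 1 M := IsManifold.of_le (n := ((⊤ : ℕ∞) : WithTop ℕ∞)) (by simp)
  have h := isInvertible_mfderivWithin_extChartAt_symm (I := 𝓘(ℝ, E)) hy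
  rw [ModelWithCorners.range_eq_univ, mfderivWithin_univ] at h
  exact h

theorem compContinuousLinearMap_injective {q : ℕ} {f : E →L[ℝ] E} (hf : f.IsInvertible)
    {a b : E [⋀^Fin q]→L[ℝ] ℝ}
    (h : a.compContinuousLinearMap f = b.compContinuousLinearMap f) : a = b := by
  obtain ⟨e, rfl⟩ := hf
  ext v
  have := congrArg (fun c : E [⋀^Fin q]→L[ℝ] ℝ => c fun i => e.symm (v i)) h
  simpa [Function.comp_def] using this

theorem roughForm_ext {q : ℕ} {α β : RoughForm E M q}
    (h : ∀ (x₀ : M), ∀ y ∈ (extChartAt 𝓘(ℝ, E) x₀).target, localRep α x₀ y = localRep β x₀ y) :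
    α = β := by
  funext x
  have h1 := h x _ (mem_extChartAt_target (I := 𝓘(ℝ, E)) x)
  rw [localRep_eq, localRep_eq, extChartAt_to_inv] at h1
  exact compContinuousLinearMap_injective
    (isInvertible_chartDeriv (mem_extChartAt_target (I := 𝓘(ℝ, E)) x)) h1

theorem form_ext {q : ℕ} {α β : Form E M q}
    (h : ∀ (x₀ : M), ∀ y ∈ (extChartAt 𝓘(ℝ, E) x₀).target,
      localRep α.1 x₀ y = localRep β.1 x₀ y) : α = β :=
  Subtype.ext (roughForm_ext h)

theorem localRep_d {q : ℕ} (α : Form E M q) (x₀ : M) {y : E}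
    (hy : y ∈ (extChartAt 𝓘(ℝ, E) x₀).target) :
    localRep (d α).1 x₀ y = extDeriv (localRep α.1 x₀) y := localRep_extD α.2 x₀ hy

theorem d_d {q : ℕ} (α : Form E M q) : d (d α) = 0 := by
  refine form_ext fun x₀ y hy => ?_
  have hev : localRep (d α).1 x₀ =ᶠ[𝓝 y] extDeriv (localRep α.1 x₀) := by
    filter_upwards [(isOpen_extChartAt_target x₀).mem_nhds hy] with z hz
    exact localRep_d α x₀ hz
  rw [localRep_d _ _ hy, hev.extDeriv_eq, extDeriv_extDeriv_apply (contDiffAt_localRep α hy)]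
  · rfl
  · rw [minSmoothness_of_isRCLikeNormedField]
    exact WithTop.coe_le_coe.2 le_top

/-! ### The Leibniz rule -/

/-- The product rule for the bilinear map `wedge`, followed by alternatization. Each summand freezes
one factor at its value at `y`, which is why the Leibniz rules above need only constant forms. -/
theorem extDeriv_wedge {p q : ℕ} (α : Form E M p) (β : Form E M q) (x₀ : M) {y : E}
    (hy : y ∈ (extChartAt 𝓘(ℝ, E) x₀).target) :
    localRep (d (wedgeForm α β)).1 x₀ y =
      ContinuousAlternatingMap.alternatizeUncurryFin
        ((wedgeLeft (localRep α.1 x₀ y) q).comp (fderiv ℝ (localRep β.1 x₀) y)) +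
      ContinuousAlternatingMap.alternatizeUncurryFin
        ((wedgeRight p (localRep β.1 x₀ y)).comp (fderiv ℝ (localRep α.1 x₀) y)) := by
  rw [localRep_d _ _ hy, ← ContinuousAlternatingMap.alternatizeUncurryFin_add, extDeriv]
  congr 1
  have h1 := ((contDiffAt_localRep α hy).differentiableAt (by simp)).hasFDerivAt
  have h2 := ((contDiffAt_localRep β hy).differentiableAt (by simp)).hasFDerivAt
  have h3 := ((isBoundedBilinearMap_wedge (V := E) p q).hasFDerivAt
    (localRep α.1 x₀ y, localRep β.1 x₀ y)).comp y (h1.prodMk h2)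
  have h4 : localRep (wedgeForm α β).1 x₀ =
      (fun ab : (E [⋀^Fin p]→L[ℝ] ℝ) × (E [⋀^Fin q]→L[ℝ] ℝ) => wedge ab.1 ab.2) ∘
        fun z => (localRep α.1 x₀ z, localRep β.1 x₀ z) :=
    funext fun z => localRep_wedge α.1 β.1 x₀ z
  rw [h4, h3.fderiv]
  ext1 v
  rfl

theorem d_wedgeForm_one {p : ℕ} (α : Form E M p) (θ : Form E M 1) :
    (d (wedgeForm α θ) : Form E M (p + 1 + 1)) =
      wedgeForm (d α) θ + (-1 : ℝ) ^ p • (wedgeForm α (d θ) : Form E M (p + 2)) := by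
  refine form_ext fun x₀ y hy => ?_
  refine (extDeriv_wedge α θ x₀ hy).trans ?_
  refine (congrArg₂ (· + ·) (alternatizeUncurryFin_wedgeLeft_one _ _)
    (alternatizeUncurryFin_wedgeRight_one _ _)).trans ?_
  refine (add_comm _ _).trans ?_
  have e1 : localRep (wedgeForm (d α) θ).1 x₀ y =
      wedge₁ (extDeriv (localRep α.1 x₀) y) (localRep θ.1 x₀ y) := by
    rw [← localRep_d _ _ hy]
    exact localRep_wedge _ _ _ _
  have e2 : localRep (wedgeForm α (d θ)).1 x₀ y =
      wedge₂ (localRep α.1 x₀ y) (extDeriv (localRep θ.1 x₀) y) := by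
    rw [← localRep_d _ _ hy]
    exact localRep_wedge _ _ _ _
  exact (congrArg₂ (fun x z : E [⋀^Fin (p + 1 + 1)]→L[ℝ] ℝ => x + (-1 : ℝ) ^ p • z) e1 e2).symm

theorem d_lef {ω : Form E M 2} (hω : d ω = 0) {p : ℕ} (α : Form E M p) :
    (d (lef ω α) : Form E M (p + 2 + 1)) = lef ω (d α) := by
  refine form_ext fun x₀ y hy => ?_
  have h0 : ContinuousAlternatingMap.alternatizeUncurryFin (fderiv ℝ (localRep ω.1 x₀) y) = 0 := by
    refine (localRep_d ω x₀ hy).symm.trans ?_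
    rw [hω]
    rfl
  refine (extDeriv_wedge α ω x₀ hy).trans ?_
  refine (congrArg₂ (· + ·) (alternatizeUncurryFin_wedgeLeft_two _ h0)
    (alternatizeUncurryFin_wedgeRight_two _ _)).trans ?_
  rw [zero_add]
  refine ((localRep_wedge _ _ _ _).trans ?_).symm
  rw [localRep_d _ _ hy]
  rfl

/-! ### The pointwise Lefschetz isomorphisms on smooth forms -/

theorem nondeg_localRep {ω : Form E M 2} (hω : IsSymplectic ω) {x₀ : M} {y : E}
    (hy : y ∈ (extChartAt 𝓘(ℝ, E) x₀).target) : Nondeg (localRep ω.1 x₀ y) := by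
  intro v hv
  obtain ⟨e, he⟩ := isInvertible_chartDeriv hy
  have h1 := hω.2 ((extChartAt 𝓘(ℝ, E) x₀).symm y) (e v) fun u => by
    refine Eq.trans ?_ (hv (e.symm u))
    rw [localRep_eq, ← he, ContinuousAlternatingMap.compContinuousLinearMap_apply]
    refine congrArg (ptForm ω.1 _) ?_
    funext i
    fin_cases i
    · rfl
    · exact (e.apply_symm_apply u).symm
  exact e.injective (h1.trans (map_zero e).symm)

theorem nondeg_ptForm {ω : Form E M 2} (hω : IsSymplectic ω) (x : M) : Nondeg (ptForm ω.1 x) :=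
  hω.2 x

variable [FiniteDimensional ℝ E]

theorem lefPow_injective {ω : Form E M 2} (hω : IsSymplectic ω) {n : ℕ}
    (hn : Module.finrank ℝ E = 2 * n) {p k : ℕ} (hpk : p + k ≤ n) {α : Form E M p}
    (h : lefPow ω k α = 0) : α = 0 := by
  refine Subtype.ext (funext fun x => ?_)
  refine lefPt_injective (nondeg_ptForm hω x) hn hpk (a := ptForm α.1 x) (k := k) ?_
  rw [← ptForm_lefPow, h]
  rfl

/-- The preimage is taken pointwise by inverting the Lefschetz isomorphism. It is smooth because, in
each chart, it is obtained from smooth data by inversion of linear maps, and inversion is smooth at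
invertible maps. -/
theorem lefPow_surjective {ω : Form E M 2} (hω : IsSymplectic ω) {n : ℕ}
    (hn : Module.finrank ℝ E = 2 * n) {p k : ℕ} (hpk : p + k = n) (η : Form E M (p + 2 * k)) :
    ∃ γ : Form E M p, lefPow ω k γ = η := by
  let γ : RoughForm E M p := fun x => (lefPt (ptForm ω.1 x) k (q := p)).inverse (ptForm η.1 x)
  have hγ : ∀ x, lefPt (ptForm ω.1 x) k (ptForm γ x) = ptForm η.1 x := fun x =>
    (lefPt_isInvertible (nondeg_ptForm hω x) hn hpk).self_apply_inverse _
  have hloc : ∀ x₀ : M, ∀ y ∈ (extChartAt 𝓘(ℝ, E) x₀).target, localRep γ x₀ y =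
      (lefPt (localRep ω.1 x₀ y) k (q := p)).inverse (localRep η.1 x₀ y) := by
    intro x₀ y hy
    rw [eq_comm, (lefPt_isInvertible (nondeg_localRep hω hy) hn hpk).inverse_apply_eq,
      localRep_eq γ, localRep_eq ω.1, ← lefPt_compContinuousLinearMap, hγ]
    rfl
  have hsm : IsSmoothForm γ := by
    intro x₀
    refine ContDiffOn.congr ?_ (hloc x₀)
    intro y hy
    refine ContDiffAt.contDiffWithinAt ?_
    have h1 : ContDiffAt ℝ ((⊤ : ℕ∞) : WithTop ℕ∞)
        (fun z => lefPt (localRep ω.1 x₀ z) k (q := p)) y :=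
      (contDiff_lefPt (V := E) k p).contDiffAt.comp y (contDiffAt_localRep ω hy)
    have h2 : ContDiffAt ℝ ((⊤ : ℕ∞) : WithTop ℕ∞)
        (ContinuousLinearMap.inverse (R := ℝ) (M := E [⋀^Fin p]→L[ℝ] ℝ)
          (M₂ := E [⋀^Fin (p + 2 * k)]→L[ℝ] ℝ)) (lefPt (localRep ω.1 x₀ y) k) :=
      (lefPt_isInvertible (nondeg_localRep hω hy) hn hpk).contDiffAt_map_inverse
    exact (h2.comp y h1).clm_apply (contDiffAt_localRep η hy)
  refine ⟨⟨γ, hsm⟩, Subtype.ext (funext fun x => ?_)⟩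
  exact (ptForm_lefPow ω k ⟨γ, hsm⟩ x).trans (hγ x)

end

/-! ### Subquotients -/

section Subquotients

variable {V W : Type*} [AddCommGroup V] [Module ℝ V] [AddCommGroup W] [Module ℝ W]

/-- The class of an element in a subquotient. -/
def Subquot.mk {Z : Submodule ℝ V} (B : Submodule ℝ V) (z : Z) : Subquot Z B :=
  (B.submoduleOf Z).mkQ z

theorem Subquot.mk_surjective {Z B : Submodule ℝ V} (x : Subquot Z B) :
    ∃ z : Z, Subquot.mk B z = x :=
  (B.submoduleOf Z).mkQ_surjective x

theorem Subquot.mk_eq_zero {Z B : Submodule ℝ V} (z : Z) :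
    Subquot.mk B z = 0 ↔ (z : V) ∈ B := by
  rw [Subquot.mk, Submodule.mkQ_apply, Submodule.Quotient.mk_eq_zero]
  rfl

/-- The map of subquotients induced by a linear map. -/
def Subquot.map {Z B : Submodule ℝ V} {Z' B' : Submodule ℝ W} (f : V →ₗ[ℝ] W)
    (hZ : ∀ z ∈ Z, f z ∈ Z') (hB : ∀ z ∈ B, f z ∈ B') : Subquot Z B →ₗ[ℝ] Subquot Z' B' :=
  Submodule.mapQ _ _ (f.restrict hZ) fun z hz => hB z hz

theorem Subquot.map_mk {Z B : Submodule ℝ V} {Z' B' : Submodule ℝ W} (f : V →ₗ[ℝ] W)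
    (hZ : ∀ z ∈ Z, f z ∈ Z') (hB : ∀ z ∈ B, f z ∈ B') (z : Z) :
    Subquot.map f hZ hB (Subquot.mk B z) = Subquot.mk B' ⟨f z, hZ z z.2⟩ := rfl

theorem Subquot.mk_sub {Z B : Submodule ℝ V} (z z' : Z) :
    Subquot.mk B (z - z') = Subquot.mk B z - Subquot.mk B z' := map_sub _ _ _

theorem Subquot.mk_eq_mk {Z B : Submodule ℝ V} (z z' : Z) :
    Subquot.mk B z = Subquot.mk B z' ↔ (z : V) - z' ∈ B := by
  rw [← sub_eq_zero, ← Subquot.mk_sub, Subquot.mk_eq_zero]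
  rfl

theorem Subquot.map_injective {Z B : Submodule ℝ V} {Z' B' : Submodule ℝ W} {f : V →ₗ[ℝ] W}
    {hZ : ∀ z ∈ Z, f z ∈ Z'} {hB : ∀ z ∈ B, f z ∈ B'} (h : ∀ z ∈ Z, f z ∈ B' → z ∈ B) :
    Function.Injective (Subquot.map f hZ hB) := by
  refine (injective_iff_map_eq_zero _).2 fun x hx => ?_
  obtain ⟨z, rfl⟩ := Subquot.mk_surjective x
  rw [Subquot.map_mk, Subquot.mk_eq_zero] at hx
  exact (Subquot.mk_eq_zero z).2 (h z z.2 hx)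

theorem Subquot.map_surjective {Z B : Submodule ℝ V} {Z' B' : Submodule ℝ W} {f : V →ₗ[ℝ] W}
    {hZ : ∀ z ∈ Z, f z ∈ Z'} {hB : ∀ z ∈ B, f z ∈ B'}
    (h : ∀ w ∈ Z', ∃ z ∈ Z, f z - w ∈ B') :
    Function.Surjective (Subquot.map f hZ hB) := by
  intro x
  obtain ⟨w, rfl⟩ := Subquot.mk_surjective x
  obtain ⟨z, hz, hzw⟩ := h w w.2
  exact ⟨Subquot.mk B ⟨z, hz⟩, (Subquot.mk_eq_mk _ _).2 hzw⟩

/-- The middle term is an extension of `ker i` by `coker f`. The outer spaces need not be finite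
dimensional, as only the ranks of `f` and `i` enter. -/
theorem finite_finrank_of_exact {V₀ V₁ V₂ V₃ V₄ : Type*} [AddCommGroup V₀] [Module ℝ V₀]
    [AddCommGroup V₁] [Module ℝ V₁] [AddCommGroup V₂] [Module ℝ V₂] [AddCommGroup V₃]
    [Module ℝ V₃] [AddCommGroup V₄] [Module ℝ V₄] [Module.Finite ℝ V₁] [Module.Finite ℝ V₃]
    {f : V₀ →ₗ[ℝ] V₁} {g : V₁ →ₗ[ℝ] V₂} {h : V₂ →ₗ[ℝ] V₃} {i : V₃ →ₗ[ℝ] V₄}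
    (hfg : Function.Exact f g) (hgh : Function.Exact g h) (hhi : Function.Exact h i) :
    Module.Finite ℝ V₂ ∧ Module.finrank ℝ V₂ + Module.finrank ℝ (LinearMap.range f) +
      Module.finrank ℝ (LinearMap.range i) = Module.finrank ℝ V₁ + Module.finrank ℝ V₃ := by
  have e1 := LinearMap.exact_iff.1 hfg
  have e2 := LinearMap.exact_iff.1 hgh
  have e3 := LinearMap.exact_iff.1 hhi
  have h1 : Module.Finite ℝ (LinearMap.ker h) := by
    rw [e2]
    infer_instance
  have h2 : Module.Finite ℝ (V₂ ⧸ LinearMap.ker h) :=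
    Module.Finite.equiv h.quotKerEquivRange.symm
  have hfin : Module.Finite ℝ V₂ := Module.Finite.of_submodule_quotient (LinearMap.ker h)
  refine ⟨hfin, ?_⟩
  have r1 := LinearMap.finrank_range_add_finrank_ker g
  have r2 := LinearMap.finrank_range_add_finrank_ker h
  have r3 := LinearMap.finrank_range_add_finrank_ker i
  rw [e1] at r1
  rw [e2] at r2
  rw [e3] at r3
  omega

end Subquotients

/-! ### The cohomology of a mapping cone -/

section Cone

variable {A₀ A₁ B₁ B₂ : Type*} [AddCommGroup A₀] [Module ℝ A₀] [AddCommGroup A₁] [Module ℝ A₁]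
  [AddCommGroup B₁] [Module ℝ B₁] [AddCommGroup B₂] [Module ℝ B₂]

/-- Cocycles of the mapping cone: the pairs `(α, γ)` with `dα = Lγ` and `dγ = 0`. -/
def coneClosed (dB : B₁ →ₗ[ℝ] B₂) (L₁ : A₁ →ₗ[ℝ] B₂) (ZA₁ : Submodule ℝ A₁) :
    Submodule ℝ (B₁ × A₁) :=
  LinearMap.ker (dB.comp (LinearMap.fst ℝ B₁ A₁) - L₁.comp (LinearMap.snd ℝ B₁ A₁)) ⊓
    ZA₁.comap (LinearMap.snd ℝ B₁ A₁)

/-- Coboundaries of the mapping cone: the pairs `(Lβ + η, dβ)` with `η` exact. -/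
def coneExact (dA : A₀ →ₗ[ℝ] A₁) (L₀ : A₀ →ₗ[ℝ] B₁) (EB₁ : Submodule ℝ B₁) :
    Submodule ℝ (B₁ × A₁) :=
  LinearMap.range (L₀.prod dA) ⊔ EB₁.map (LinearMap.inl ℝ B₁ A₁)

variable {dA : A₀ →ₗ[ℝ] A₁} {dB : B₁ →ₗ[ℝ] B₂} {L₀ : A₀ →ₗ[ℝ] B₁} {L₁ : A₁ →ₗ[ℝ] B₂}
  {EA₀ : Submodule ℝ A₀} {ZA₁ EA₁ : Submodule ℝ A₁} {EB₁ : Submodule ℝ B₁} {ZB₂ : Submodule ℝ B₂}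

theorem mem_coneClosed {x : B₁ × A₁} :
    x ∈ coneClosed dB L₁ ZA₁ ↔ dB x.1 = L₁ x.2 ∧ x.2 ∈ ZA₁ := by
  rw [coneClosed, Submodule.mem_inf, LinearMap.mem_ker, Submodule.mem_comap]
  exact and_congr sub_eq_zero Iff.rfl

theorem mem_coneExact {x : B₁ × A₁} :
    x ∈ coneExact dA L₀ EB₁ ↔ ∃ β, x.1 - L₀ β ∈ EB₁ ∧ dA β = x.2 := by
  rw [coneExact, Submodule.mem_sup]
  constructor
  · rintro ⟨_, ⟨β, rfl⟩, _, ⟨η, hη, rfl⟩, rfl⟩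
    refine ⟨β, ?_, ?_⟩
    · simpa using hη
    · simp
  · rintro ⟨β, h1, h2⟩
    refine ⟨_, ⟨β, rfl⟩, _, ⟨_, h1, rfl⟩, ?_⟩
    ext <;> simp [h2]

/-- The long exact sequence of the mapping cone, in terms of dimensions. -/
theorem finrank_cone (hcomm : ∀ a, dB (L₀ a) = L₁ (dA a)) (hEA₁ : LinearMap.range dA = EA₁)
    (hL₀Z : ∀ z ∈ LinearMap.ker dA, L₀ z ∈ LinearMap.ker dB) (hL₀E : ∀ z ∈ EA₀, L₀ z ∈ EB₁)
    (hL₁Z : ∀ z ∈ ZA₁, L₁ z ∈ ZB₂) (hL₁E : ∀ z ∈ EA₁, L₁ z ∈ LinearMap.range dB)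
    [Module.Finite ℝ (Subquot (LinearMap.ker dB) EB₁)] [Module.Finite ℝ (Subquot ZA₁ EA₁)] :
    Module.Finite ℝ (Subquot (coneClosed dB L₁ ZA₁) (coneExact dA L₀ EB₁)) ∧
      Module.finrank ℝ (Subquot (coneClosed dB L₁ ZA₁) (coneExact dA L₀ EB₁)) +
        Module.finrank ℝ (LinearMap.range (Subquot.map (B := EA₀) (B' := EB₁) L₀ hL₀Z hL₀E)) +
        Module.finrank ℝ (LinearMap.range (Subquot.map (B := EA₁) (Z' := ZB₂) L₁ hL₁Z hL₁E)) =
      Module.finrank ℝ (Subquot (LinearMap.ker dB) EB₁) +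
        Module.finrank ℝ (Subquot ZA₁ EA₁) := by
  subst hEA₁
  have hg1 : ∀ z ∈ LinearMap.ker dB, LinearMap.inl ℝ B₁ A₁ z ∈ coneClosed dB L₁ ZA₁ := by
    intro z hz
    rw [mem_coneClosed]
    simpa using hz
  have hg2 : ∀ z ∈ EB₁, LinearMap.inl ℝ B₁ A₁ z ∈ coneExact dA L₀ EB₁ := by
    intro z hz
    rw [mem_coneExact]
    exact ⟨0, by simpa using hz, by simp⟩
  have hh1 : ∀ z ∈ coneClosed dB L₁ ZA₁, LinearMap.snd ℝ B₁ A₁ z ∈ ZA₁ :=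
    fun z hz => (mem_coneClosed.1 hz).2
  have hh2 : ∀ z ∈ coneExact dA L₀ EB₁, LinearMap.snd ℝ B₁ A₁ z ∈ LinearMap.range dA := by
    intro z hz
    obtain ⟨β, -, h⟩ := mem_coneExact.1 hz
    exact ⟨β, h⟩
  -- The sequence is `ker dA / EA₀ → ker dB / EB₁ → H(cone) → ZA₁ / EA₁ → ZB₂ / im dB`, with inner
  -- maps `α ↦ (α, 0)` and `(α, γ) ↦ γ`. The connecting map is `L₁`.
  refine finite_finrank_of_exact (g := Subquot.map (LinearMap.inl ℝ B₁ A₁) hg1 hg2)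
    (h := Subquot.map (LinearMap.snd ℝ B₁ A₁) hh1 hh2) ?_ ?_ ?_
  · intro x
    obtain ⟨z, rfl⟩ := Subquot.mk_surjective x
    rw [Subquot.map_mk, Subquot.mk_eq_zero, mem_coneExact]
    constructor
    · rintro ⟨β, h1, h2⟩
      refine ⟨Subquot.mk _ ⟨β, h2⟩, ?_⟩
      rw [Subquot.map_mk, Subquot.mk_eq_mk]
      simpa using EB₁.neg_mem h1
    · rintro ⟨y, hy⟩
      obtain ⟨β, rfl⟩ := Subquot.mk_surjective y
      rw [Subquot.map_mk, Subquot.mk_eq_mk] at hy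
      exact ⟨β, by simpa using EB₁.neg_mem hy, β.2⟩
  · intro x
    obtain ⟨z, rfl⟩ := Subquot.mk_surjective x
    obtain ⟨hz1, hz2⟩ := mem_coneClosed.1 z.2
    rw [Subquot.map_mk, Subquot.mk_eq_zero]
    constructor
    · rintro ⟨β, h⟩
      have h : dA β = z.1.2 := h
      refine ⟨Subquot.mk _ ⟨z.1.1 - L₀ β, ?_⟩, ?_⟩
      · rw [LinearMap.mem_ker, map_sub, hcomm, hz1, h, sub_self]
      · rw [Subquot.map_mk, Subquot.mk_eq_mk, mem_coneExact]
        exact ⟨-β, by simp, by simp [h]⟩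
    · rintro ⟨y, hy⟩
      obtain ⟨b, rfl⟩ := Subquot.mk_surjective y
      rw [Subquot.map_mk, Subquot.mk_eq_mk, mem_coneExact] at hy
      obtain ⟨β, -, h⟩ := hy
      exact ⟨-β, by simpa using congrArg Neg.neg h⟩
  · intro x
    obtain ⟨z, rfl⟩ := Subquot.mk_surjective x
    rw [Subquot.map_mk, Subquot.mk_eq_zero]
    constructor
    · rintro ⟨α, h⟩
      have h : dB α = L₁ z := h
      exact ⟨Subquot.mk _ ⟨(α, z.1), mem_coneClosed.2 ⟨h, z.2⟩⟩, rfl⟩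
    · rintro ⟨y, hy⟩
      obtain ⟨t, rfl⟩ := Subquot.mk_surjective y
      obtain ⟨ht1, ht2⟩ := mem_coneClosed.1 t.2
      rw [Subquot.map_mk, Subquot.mk_eq_mk] at hy
      obtain ⟨β, hβ⟩ := hy
      have hβ : dA β = t.1.2 - z.1 := hβ
      refine ⟨t.1.1 - L₀ β, ?_⟩
      rw [map_sub, hcomm, hβ, ht1, map_sub, sub_sub_cancel]

/-- If `L₁` is injective, the cone computes the cohomology of the quotient by the image of `L₀`. -/
theorem exists_equiv_cone_of_injective (hcomm : ∀ a, dB (L₀ a) = L₁ (dA a))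
    (hEB₁ : EB₁ ≤ LinearMap.ker dB) (hinj : Function.Injective L₁) {I P : Submodule ℝ B₁}
    (hI : ∀ b, b ∈ I ↔ ∃ a, L₀ a = b) (hP : ∀ b, b ∈ P ↔ ∃ a ∈ ZA₁, L₁ a = dB b) :
    Nonempty (Subquot (coneClosed dB L₁ ZA₁) (coneExact dA L₀ EB₁) ≃ₗ[ℝ]
      Subquot (P.map I.mkQ) (EB₁.map I.mkQ)) := by
  have h1 : ∀ z ∈ coneClosed dB L₁ ZA₁,
      I.mkQ.comp (LinearMap.fst ℝ B₁ A₁) z ∈ P.map I.mkQ := by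
    intro z hz
    obtain ⟨hz1, hz2⟩ := mem_coneClosed.1 hz
    exact ⟨z.1, (hP _).2 ⟨z.2, hz2, hz1.symm⟩, rfl⟩
  have h2 : ∀ z ∈ coneExact dA L₀ EB₁,
      I.mkQ.comp (LinearMap.fst ℝ B₁ A₁) z ∈ EB₁.map I.mkQ := by
    intro z hz
    obtain ⟨β, hβ, -⟩ := mem_coneExact.1 hz
    refine ⟨_, hβ, ?_⟩
    have : I.mkQ (L₀ β) = 0 := by
      rw [Submodule.mkQ_apply, Submodule.Quotient.mk_eq_zero]
      exact (hI _).2 ⟨β, rfl⟩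
    rw [map_sub, this, sub_zero]
    rfl
  refine ⟨LinearEquiv.ofBijective (Subquot.map _ h1 h2)
    ⟨Subquot.map_injective fun z hz hz' => ?_, Subquot.map_surjective fun w hw => ?_⟩⟩
  · obtain ⟨hz1, hz2⟩ := mem_coneClosed.1 hz
    obtain ⟨η, hη, h⟩ := hz'
    have h' : I.mkQ (z.1 - η) = 0 := by
      rw [map_sub, h]
      exact sub_self _
    rw [Submodule.mkQ_apply, Submodule.Quotient.mk_eq_zero, hI] at h'
    obtain ⟨β, hβ⟩ := h'
    -- The equation `dβ = γ` is tested after applying the injective `L₁`: with `L₀ β = α - η` and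
    -- `dη = 0`, both sides become `dα`.
    refine mem_coneExact.2 ⟨β, ?_, hinj ?_⟩
    · rw [hβ, sub_sub_cancel]
      exact hη
    · rw [← hcomm, hβ, map_sub, hEB₁ hη, sub_zero, hz1]
  · obtain ⟨α, hα, rfl⟩ := hw
    obtain ⟨γ, hγ, h⟩ := (hP α).1 hα
    refine ⟨(α, γ), mem_coneClosed.2 ⟨h.symm, hγ⟩, ?_⟩
    have : I.mkQ.comp (LinearMap.fst ℝ B₁ A₁) (α, γ) - I.mkQ α = 0 := sub_self _
    rw [this]
    exact Submodule.zero_mem _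

/-- If `L₀` is surjective, the cone computes the cohomology of the kernel of `L₁`. -/
theorem exists_equiv_cone_of_surjective (hcomm : ∀ a, dB (L₀ a) = L₁ (dA a))
    (hsurj : Function.Surjective L₀) (hZA : LinearMap.range dA ≤ ZA₁)
    {B : Submodule ℝ A₁} (hB : ∀ c, c ∈ B ↔ ∃ a, L₀ a ∈ EB₁ ∧ dA a = c) :
    Nonempty (Subquot (LinearMap.ker L₁ ⊓ ZA₁) B ≃ₗ[ℝ]
      Subquot (coneClosed dB L₁ ZA₁) (coneExact dA L₀ EB₁)) := by
  have h1 : ∀ z ∈ LinearMap.ker L₁ ⊓ ZA₁, LinearMap.inr ℝ B₁ A₁ z ∈ coneClosed dB L₁ ZA₁ := by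
    intro z hz
    refine mem_coneClosed.2 ⟨?_, hz.2⟩
    have : L₁ z = 0 := hz.1
    simp [this]
  have h2 : ∀ z ∈ B, LinearMap.inr ℝ B₁ A₁ z ∈ coneExact dA L₀ EB₁ := by
    intro z hz
    obtain ⟨a, ha, h⟩ := (hB z).1 hz
    exact mem_coneExact.2 ⟨a, by simpa using ha, h⟩
  refine ⟨LinearEquiv.ofBijective (Subquot.map _ h1 h2)
    ⟨Subquot.map_injective fun z hz hz' => ?_, Subquot.map_surjective fun w hw => ?_⟩⟩
  · obtain ⟨β, hβ, h⟩ := mem_coneExact.1 hz'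
    exact (hB z).2 ⟨β, by simpa using hβ, h⟩
  · obtain ⟨hw1, hw2⟩ := mem_coneClosed.1 hw
    obtain ⟨β, hβ⟩ := hsurj w.1
    -- Subtracting the coboundary `(L₀ β, dβ)`, where `L₀ β = α`, makes the first component of the
    -- cocycle zero.
    refine ⟨w.2 - dA β, ⟨?_, ZA₁.sub_mem hw2 (hZA ⟨β, rfl⟩)⟩, mem_coneExact.2 ⟨-β, ?_, ?_⟩⟩
    · change L₁ _ = 0
      rw [map_sub, ← hcomm, hβ, hw1, sub_self]
    · simp [hβ]
    · simp

end Cone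

/-! ### The operators `L_ω^k` between forms of given degrees -/

section

variable {E : Type*} [NormedAddCommGroup E] [NormedSpace ℝ E]
variable {M : Type*} [TopologicalSpace M] [ChartedSpace E M]

/-- The identification of forms of equal degrees. -/
def castForm {p q : ℕ} (h : p = q) : Form E M p ≃ₗ[ℝ] Form E M q :=
  h ▸ LinearEquiv.refl ℝ (Form E M p)

/-- The operator `L_ω^k` as a map to forms of a given degree `q = p + 2k`. -/
def lefTo (ω : Form E M 2) {k p q : ℕ} (h : p + 2 * k = q) : Form E M p →ₗ[ℝ] Form E M q :=
  (castForm h).toLinearMap.comp (lefPow ω k)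

theorem lefEq_iff {ω : Form E M 2} {k p q : ℕ} (h : p + 2 * k = q) {γ : Form E M p}
    {η : Form E M q} : LefEq ω k γ η ↔ lefTo ω h γ = η := by
  subst h
  exact ⟨fun ⟨_, h⟩ => h, fun h => ⟨rfl, h⟩⟩

theorem lefEq_lefTo (ω : Form E M 2) {k p q : ℕ} (h : p + 2 * k = q) (γ : Form E M p) :
    LefEq ω k γ (lefTo ω h γ) := (lefEq_iff h).2 rfl

theorem LefEq.succ {ω : Form E M 2} {k p q : ℕ} {γ : Form E M p} {η : Form E M q}
    (h : LefEq ω k γ η) : LefEq ω (k + 1) γ (lef ω η) := by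
  obtain ⟨rfl, rfl⟩ := h
  exact ⟨rfl, rfl⟩

theorem LefEq.lefPow {ω : Form E M 2} {j k p q : ℕ} {γ : Form E M p} {η : Form E M q}
    (h : LefEq ω j γ η) : LefEq ω (j + k) γ (lefPow ω k η) := by
  induction k with
  | zero => exact h
  | succ k ih => exact ih.succ

theorem LefEq.trans {ω : Form E M 2} {j k p q r : ℕ} {γ : Form E M p} {η : Form E M q}
    {ζ : Form E M r} (h : LefEq ω j γ η) (h' : LefEq ω k η ζ) : LefEq ω (j + k) γ ζ := by
  obtain ⟨rfl, rfl⟩ := h'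
  exact h.lefPow

theorem LefEq.unique {ω : Form E M 2} {k p q : ℕ} {γ : Form E M p} {η η' : Form E M q}
    (h : LefEq ω k γ η) (h' : LefEq ω k γ η') : η = η' :=
  ((lefEq_iff h.1).1 h).symm.trans ((lefEq_iff h.1).1 h')

theorem ker_lefTo (ω : Form E M 2) {k p q : ℕ} (h : p + 2 * k = q) :
    LinearMap.ker (lefTo ω h) = coeffective ω k p := by
  subst h
  rfl

variable [IsManifold 𝓘(ℝ, E) ((⊤ : ℕ∞) : WithTop ℕ∞) M]

theorem exactForms_le_closedForms (q : ℕ) : exactForms E M q ≤ closedForms E M q := by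
  cases q with
  | zero => exact bot_le
  | succ q =>
    rintro _ ⟨β, rfl⟩
    exact d_d β

theorem lefEq_d {ω : Form E M 2} (hω : d ω = 0) {k p q : ℕ} {γ : Form E M p} {η : Form E M q}
    (h : LefEq ω k γ η) : LefEq ω k (d γ) (d η) := by
  obtain ⟨rfl, rfl⟩ := h
  change LefEq ω k (d γ) (d (lefPow ω k γ))
  induction k with
  | zero => exact ⟨rfl, rfl⟩
  | succ k ih =>
    have h := d_lef hω (lefPow ω k γ)
    refine Eq.mpr (congrArg (LefEq ω (k + 1) (d γ)) h) ih.succ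

theorem d_lefTo {ω : Form E M 2} (hω : d ω = 0) {k p q : ℕ} (h : p + 2 * k = q)
    (h' : p + 1 + 2 * k = q + 1) (γ : Form E M p) :
    d (lefTo ω h γ) = lefTo ω h' (d γ) :=
  ((lefEq_iff h').1 (lefEq_d hω (lefEq_lefTo ω h γ))).symm

theorem lefTo_mem_closedForms {ω : Form E M 2} (hω : d ω = 0) {k p q : ℕ} (h : p + 2 * k = q)
    {γ : Form E M p} (hγ : γ ∈ closedForms E M p) : lefTo ω h γ ∈ closedForms E M q := by
  have hγ : d γ = 0 := hγ
  have h1 := d_lefTo hω h (by omega) γ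
  rw [hγ, map_zero] at h1
  exact h1

/-- If `ω` is exact, then `α ∧ ω^k` is exact for closed `α` and `k ≥ 1`. -/
theorem lefTo_mem_exactForms_of_exact {ω : Form E M 2} (hω : ω ∈ exactForms E M 2) {k p q : ℕ}
    (hk : 1 ≤ k) (h : p + 2 * k = q) {γ : Form E M p} (hγ : γ ∈ closedForms E M p) :
    lefTo ω h γ ∈ exactForms E M q := by
  have hω0 : d ω = 0 := exactForms_le_closedForms 2 hω
  obtain ⟨θ, rfl⟩ := hω
  obtain ⟨k, rfl⟩ := Nat.exists_eq_add_of_le' hk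
  subst h
  set α := lefPow (d θ) k γ with hα
  have hα0 : d α = 0 := lefTo_mem_closedForms (k := k) hω0 rfl hγ
  change (wedgeForm α (d θ) : Form E M (p + 2 * k + 2)) ∈ LinearMap.range d
  -- With `α = γ ∧ ω^{k-1}` closed, `d(α ∧ θ) = ± α ∧ dθ = ± γ ∧ ω^k`; the scalar undoes the sign.
  refine ⟨(-1 : ℝ) ^ (p + 2 * k) • wedgeForm α θ, ?_⟩
  rw [map_smul]
  refine (congrArg (fun x => (-1 : ℝ) ^ (p + 2 * k) • x) (d_wedgeForm_one α θ)).trans ?_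
  have h0 : wedgeForm (d α) θ = 0 := by
    rw [hα0]
    refine Subtype.ext (funext fun x => ?_)
    exact zero_wedge (p + 2 * k + 1) (ptForm θ.1 x)
  rw [h0, zero_add, smul_smul, neg_one_pow_mul_self, one_smul]

variable [FiniteDimensional ℝ E]

theorem lefTo_injective {ω : Form E M 2} (hω : IsSymplectic ω) {n : ℕ}
    (hn : Module.finrank ℝ E = 2 * n) {p k q : ℕ} (h : p + 2 * k = q) (hpk : p + k ≤ n) :
    Function.Injective (lefTo ω h) := by
  subst h
  exact (injective_iff_map_eq_zero _).2 fun α hα => lefPow_injective hω hn hpk hα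

/-- For `q ≤ 2n`, write `q = n + j + k`. The Lefschetz isomorphism `L^{j+k} : Ω^{n-j-k} → Ω^q`
factors as `L^j` into `Ω^p` followed by `L^k`, so the last factor is onto. For `q > 2n` the target
is zero. -/
theorem lefTo_surjective {ω : Form E M 2} (hω : IsSymplectic ω) {n : ℕ}
    (hn : Module.finrank ℝ E = 2 * n) {p k q : ℕ} (h : p + 2 * k = q) (hpk : n ≤ p + k) :
    Function.Surjective (lefTo ω h) := by
  intro η
  rcases lt_or_ge (2 * n) q with hq | hq
  · exact ⟨0, (form_eq_zero (hn ▸ hq) _).trans (form_eq_zero (hn ▸ hq) η).symm⟩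
  · obtain ⟨j, rfl⟩ : ∃ j, q = n + (j + k) := ⟨q - n - k, by omega⟩
    have hr : n - (j + k) + 2 * (j + k) = n + (j + k) := by omega
    obtain ⟨γ₀, hγ₀⟩ := lefPow_surjective hω hn (show n - (j + k) + (j + k) = n by omega)
      (castForm hr.symm η)
    have h1 : LefEq ω (j + k) γ₀ η := by
      refine (lefEq_iff hr).2 ?_
      rw [lefTo, LinearMap.comp_apply, hγ₀]
      have hcast : ∀ {a b : ℕ} (e : a = b) (ζ : Form E M b),
          castForm e (castForm e.symm ζ) = ζ := by
        rintro a _ rfl ζ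
        rfl
      exact hcast hr η
    refine ⟨lefTo ω (k := j) (by omega) γ₀, ?_⟩
    exact ((lefEq_lefTo ω _ γ₀).trans (lefEq_lefTo ω h _)).unique h1

/-- Under the Hard Lefschetz Condition, `L^k : H^p(M) → H^{p+2k}(M)` is surjective for
`p + k ≥ n`. -/
theorem HardLefschetz.exists_closed {ω : Form E M 2} (hω : d ω = 0) {n : ℕ}
    (hn : Module.finrank ℝ E = 2 * n) (hL : HardLefschetz ω n) {p k q : ℕ} (hk : 1 ≤ k)
    (h : p + 2 * k = q) (hpk : n ≤ p + k) {β : Form E M q} (hβ : β ∈ closedForms E M q) :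
    ∃ α ∈ closedForms E M p, lefTo ω h α - β ∈ exactForms E M q := by
  rcases lt_or_ge (2 * n) q with hq | hq
  · refine ⟨0, Submodule.zero_mem _, ?_⟩
    rw [form_eq_zero (hn ▸ hq) (lefTo ω h 0 - β)]
    exact Submodule.zero_mem _
  -- The factorization `L^{j+k} = L^k L^j` again, now on cohomology and with the HLC for `j + k`.
  · obtain ⟨j, hj⟩ : ∃ j, q = n + (j + k) := ⟨q - n - k, by omega⟩
    have hr : n - (j + k) + 2 * (j + k) = q := by omega
    obtain ⟨γ, hγ, hγ'⟩ : ∃ γ ∈ closedForms E M (n - (j + k)),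
        β - lefTo ω hr γ ∈ exactForms E M q := by
      have hn' : n - (j + k) + (j + k) = n := by omega
      clear h hj hq
      subst hr
      exact hL (j + k) (n - (j + k)) (by omega) hn' β hβ
    refine ⟨lefTo ω (k := j) (by omega) γ, lefTo_mem_closedForms hω _ hγ, ?_⟩
    rw [((lefEq_lefTo ω _ γ).trans (lefEq_lefTo ω h _)).unique (lefEq_lefTo ω hr γ)]
    rw [← neg_sub]
    exact Submodule.neg_mem _ hγ'

end

/-! ### The dimensions of the extended coeffective cohomology -/

section Ranks

variable {V W : Type*} [AddCommGroup V] [Module ℝ V] [AddCommGroup W] [Module ℝ W]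
  {Z B : Submodule ℝ V} {Z' B' : Submodule ℝ W} {f : V →ₗ[ℝ] W}
  {hZ : ∀ z ∈ Z, f z ∈ Z'} {hB : ∀ z ∈ B, f z ∈ B'}

theorem Subquot.finrank_range_map_eq_zero (h : ∀ z ∈ Z, f z ∈ B') :
    Module.finrank ℝ (LinearMap.range (Subquot.map f hZ hB)) = 0 := by
  have h0 : Subquot.map f hZ hB = 0 := by
    ext x
    exact (Subquot.mk_eq_zero _).2 (h x x.2)
  rw [h0, LinearMap.range_zero, finrank_bot]

theorem Subquot.finrank_range_map_eq (h : ∀ w ∈ Z', ∃ z ∈ Z, f z - w ∈ B') :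
    Module.finrank ℝ (LinearMap.range (Subquot.map f hZ hB)) =
      Module.finrank ℝ (Subquot Z' B') := by
  rw [LinearMap.range_eq_top.2 (Subquot.map_surjective h), finrank_top]

end Ranks

section

variable {E : Type*} [NormedAddCommGroup E] [NormedSpace ℝ E]
variable {M : Type*} [TopologicalSpace M] [ChartedSpace E M]
theorem mem_lefImage_of_lt {ω : Form E M 2} {k q : ℕ} (hq : q < 2 * k) (η : Form E M q) :
    η ∈ lefImage ω k q ↔ η = 0 := by
  constructor
  · rintro (h | ⟨p, γ, h, -⟩)
    · exact h
    · omega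
  · exact Or.inl

theorem mem_lefImage {ω : Form E M 2} {k p q : ℕ} (h : p + 2 * k = q) (η : Form E M q) :
    η ∈ lefImage ω k q ↔ ∃ γ, lefTo ω h γ = η := by
  constructor
  · rintro (rfl | ⟨p', γ, h'⟩)
    · exact ⟨0, map_zero _⟩
    · obtain rfl : p' = p := by
        have := h'.1
        omega
      exact ⟨γ, (lefEq_iff h).1 h'⟩
  · rintro ⟨γ, rfl⟩
    exact Or.inr ⟨p, γ, lefEq_lefTo ω h γ⟩

variable [IsManifold 𝓘(ℝ, E) ((⊤ : ℕ∞) : WithTop ℕ∞) M]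

theorem betti_natCast (q : ℕ) : betti E M (q : ℤ) = Module.finrank ℝ (DeRham E M q) := rfl

theorem betti_of_neg {z : ℤ} (h : z < 0) : betti E M z = 0 := by
  obtain ⟨m, rfl⟩ := Int.eq_negSucc_of_lt_zero h
  rfl

/-- The dimension of `Ȟ^q_{(k)}(M)` is determined by the ranks `r₀`, `r₁` of the operators `L^k`
with values in `H^q(M)` and `H^{q+1}(M)`. -/
def HasRankFormula (ω : Form E M 2) (n k q : ℕ) : Prop :=
  Module.Finite ℝ (checkH ω n k q) ∧ ∃ r₀ r₁ : ℕ,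
    checkC ω n k q + r₀ + r₁ = betti E M (q : ℤ) + betti E M ((q : ℤ) - 2 * k + 1) ∧
    r₀ ≤ betti E M (q : ℤ) ∧ r₁ ≤ betti E M ((q : ℤ) + 1) ∧
    (ω ∈ exactForms E M 2 → r₀ = 0 ∧ r₁ = 0) ∧
    (HardLefschetz ω n → n + k ≤ q → r₀ = betti E M (q : ℤ) ∧ r₁ = betti E M ((q : ℤ) + 1))

/-- The source complex `A` is kept abstract so that it can be the de Rham complex in degrees `p`, `p
+ 1`, or the zero space when these degrees are negative. -/
theorem hasRankFormula_of_cone {ω : Form E M 2} (hfin : FiniteType E M) {n k q : ℕ}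
    {A₀ A₁ : Type*} [AddCommGroup A₀] [Module ℝ A₀] [AddCommGroup A₁] [Module ℝ A₁]
    {dA : A₀ →ₗ[ℝ] A₁} {L₀ : A₀ →ₗ[ℝ] Form E M q} {L₁ : A₁ →ₗ[ℝ] Form E M (q + 1)}
    {ZA₁ EA₁ : Submodule ℝ A₁} (hcomm : ∀ a, d (L₀ a) = L₁ (dA a))
    (hEA₁ : LinearMap.range dA = EA₁) (hL₁Z : ∀ z ∈ ZA₁, L₁ z ∈ closedForms E M (q + 1))
    (e : Nonempty (Subquot (coneClosed d L₁ ZA₁) (coneExact dA L₀ (exactForms E M q)) ≃ₗ[ℝ]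
      checkH ω n k q))
    (hA₁fin : Module.Finite ℝ (Subquot ZA₁ EA₁))
    (hA₁ : Module.finrank ℝ (Subquot ZA₁ EA₁) = betti E M ((q : ℤ) - 2 * k + 1))
    (hex : ω ∈ exactForms E M 2 → (∀ z, dA z = 0 → L₀ z ∈ exactForms E M q) ∧
      ∀ z ∈ ZA₁, L₁ z ∈ exactForms E M (q + 1))
    (hHL : HardLefschetz ω n → n + k ≤ q →
      (∀ β ∈ closedForms E M q, ∃ z, dA z = 0 ∧ L₀ z - β ∈ exactForms E M q) ∧
      ∀ β ∈ closedForms E M (q + 1), ∃ z ∈ ZA₁, L₁ z - β ∈ exactForms E M (q + 1)) :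
    HasRankFormula ω n k q := by
  obtain ⟨e⟩ := e
  have : Module.Finite ℝ (Subquot (LinearMap.ker (d (E := E) (M := M) (q := q)))
    (exactForms E M q)) := hfin q
  have := hfin q
  have := hfin (q + 1)
  have hL₀Z : ∀ z ∈ LinearMap.ker dA, L₀ z ∈ LinearMap.ker (d (E := E) (M := M) (q := q)) := by
    intro z hz
    rw [LinearMap.mem_ker, hcomm, hz, map_zero]
  -- Exact elements of `A₀` need not be divided out: only the image of `L₀` in `H^q(M)` matters, and
  -- it is the same for all closed representatives.
  have hL₀E : ∀ z ∈ (⊥ : Submodule ℝ A₀), L₀ z ∈ exactForms E M q := by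
    rintro _ rfl
    rw [map_zero]
    exact Submodule.zero_mem _
  have hL₁E : ∀ z ∈ EA₁, L₁ z ∈ LinearMap.range (d (E := E) (M := M) (q := q)) := by
    rw [← hEA₁]
    rintro _ ⟨a, rfl⟩
    exact ⟨L₀ a, hcomm a⟩
  obtain ⟨hf, hrank⟩ := finrank_cone (EA₀ := ⊥) (EB₁ := exactForms E M q)
    (ZB₂ := closedForms E M (q + 1)) hcomm hEA₁ hL₀Z hL₀E hL₁Z hL₁E
  refine ⟨Module.Finite.equiv e, Module.finrank ℝ (LinearMap.range (Subquot.map (B := ⊥)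
      (Z' := closedForms E M q) (B' := exactForms E M q) L₀ hL₀Z hL₀E)),
    Module.finrank ℝ (LinearMap.range (Subquot.map (B := EA₁) (Z' := closedForms E M (q + 1))
      (B' := exactForms E M (q + 1)) L₁ hL₁Z hL₁E)), ?_, ?_, ?_, ?_, ?_⟩
  · rw [checkC, ← e.finrank_eq, ← hA₁]
    exact hrank
  · exact Submodule.finrank_le _
  · exact Submodule.finrank_le _
  · intro h
    exact ⟨Subquot.finrank_range_map_eq_zero (hex h).1,
      Subquot.finrank_range_map_eq_zero (hex h).2⟩
  · intro h hq
    exact ⟨Subquot.finrank_range_map_eq (hHL h hq).1, Subquot.finrank_range_map_eq (hHL h hq).2⟩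

/-! ### The terms of the complex as mapping cones -/

theorem mem_preKerD {ω : Form E M 2} {n k p q : ℕ} (h : p + 2 * k = q + 1) (hp : n - k = p)
    (α : Form E M q) :
    α ∈ preKerD ω n k q ↔ ∃ γ ∈ closedForms E M p, lefTo ω h γ = d α := by
  subst hp
  constructor
  · rintro (rfl | ⟨γ, h1, h2⟩)
    · exact ⟨0, Submodule.zero_mem _, by rw [map_zero, map_zero]⟩
    · exact ⟨γ, h2, (lefEq_iff h).1 h1⟩
  · rintro ⟨γ, h1, h2⟩
    exact Or.inr ⟨γ, (lefEq_iff h).2 h2, h1⟩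

/-- In degrees `q < n + k`, the group `Ȟ^q_{(k)}(M)` is the cohomology of classes of forms `α` such
that `dα = L^k γ` for a closed form `γ`. -/
theorem exists_equiv_checkH_low [FiniteDimensional ℝ E] {ω : Form E M 2} (hω : IsSymplectic ω)
    {n : ℕ} (hn : Module.finrank ℝ E = 2 * n) {k p q : ℕ} (h : p + 2 * k = q + 1)
    (hq : q < n + k) {P : Submodule ℝ (Form E M q)}
    (hP : ∀ α, α ∈ P ↔ ∃ γ ∈ closedForms E M p, lefTo ω h γ = d α) :
    Nonempty (Subquot (P.map (lefImage ω k q).mkQ) ((exactForms E M q).map (lefImage ω k q).mkQ)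
      ≃ₗ[ℝ] checkH ω n k q) := by
  rcases Nat.lt_or_ge (q + 1) (n + k) with hq' | hq'
  · rw [checkH, if_pos hq']
    have : (lefImage ω k (q + 1)).comap d = P := by
      ext α
      rw [hP, Submodule.mem_comap, mem_lefImage h]
      constructor
      · rintro ⟨γ, hγ⟩
        refine ⟨γ, ?_, hγ⟩
        -- Strictly below degree `n + k - 1`, closedness of `γ` is automatic: `L^k dγ = d dα = 0`,
        -- and `L^k` is still injective on `(p+1)`-forms.
        refine lefTo_injective hω hn (show p + 1 + 2 * k = q + 1 + 1 by omega) (by omega) ?_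
        rw [← d_lefTo hω.1 h, hγ, d_d, map_zero]
      · rintro ⟨γ, -, hγ⟩
        exact ⟨γ, hγ⟩
    rw [checkClosed, this]
    exact ⟨LinearEquiv.refl ℝ _⟩
  -- In degree `n + k - 1` the condition `dγ = 0` is exactly membership in the kernel of `D`.
  · rw [checkH, if_neg (by omega), if_pos (by omega)]
    have : preKerD ω n k q = P := by
      ext α
      rw [hP, mem_preKerD h (by omega)]
    rw [kerD, this]
    exact ⟨LinearEquiv.refl ℝ _⟩

theorem lefTo_mem_exactForms_iff (ω : Form E M 2) {k m p q : ℕ} (h : p + 2 * k = q)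
    (hm : q = m + 1) (γ : Form E M p) :
    lefTo ω h γ ∈ exactForms E M q ↔ ∃ α : Form E M m, LefEq ω k γ (d α) := by
  subst hm
  simp only [lefEq_iff h]
  exact exists_congr fun _ => eq_comm

theorem mem_imD {ω : Form E M 2} {n k q : ℕ} (hk : 1 ≤ k) (h : n - k + 2 * k = q)
    (hq : q = n + k) (c : Form E M (n - k + 1)) :
    c ∈ imD ω n k ↔ ∃ a : Form E M (n - k), lefTo ω h a ∈ exactForms E M q ∧ d a = c := by
  simp only [lefTo_mem_exactForms_iff ω h (show q = n + k - 1 + 1 by omega)]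
  constructor
  · rintro (rfl | ⟨γ, α, h1, rfl⟩)
    · exact ⟨0, ⟨0, by rw [map_zero]; exact (lefEq_iff (by omega)).2 (map_zero _)⟩, map_zero _⟩
    · exact ⟨γ, ⟨α, h1⟩, rfl⟩
  · rintro ⟨γ, ⟨α, h1⟩, rfl⟩
    exact Or.inr ⟨γ, α, h1, rfl⟩

/-- Coboundaries of the cone involve `a` with `L^k a` merely exact. Above degree `n + k` the
primitive of `L^k a` is itself `L^k β`, so `a - dβ` is coeffective and has the same differential. In
degree `n + k` the weaker condition is built into `imD`. -/
theorem mem_map_d_coeffective [FiniteDimensional ℝ E] {ω : Form E M 2} (hω : IsSymplectic ω)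
    {n : ℕ} (hn : Module.finrank ℝ E = 2 * n) {k p q : ℕ} (hkn : k ≤ n) (h : p + 2 * k = q)
    (hq : n + k < q) (c : Form E M (p + 1)) :
    c ∈ (coeffective ω k p).map d ↔
      ∃ a : Form E M p, lefTo ω h a ∈ exactForms E M q ∧ d a = c := by
  constructor
  · rintro ⟨a, ha, rfl⟩
    rw [← ker_lefTo ω h] at ha
    refine ⟨a, ?_, rfl⟩
    have ha : lefTo ω h a = 0 := ha
    rw [ha]
    exact Submodule.zero_mem _
  · rintro ⟨a, ha, rfl⟩
    obtain ⟨m, rfl⟩ : ∃ m, q = m + 1 := ⟨q - 1, by omega⟩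
    obtain ⟨p, rfl⟩ : ∃ p', p = p' + 1 := ⟨p - 1, by omega⟩
    obtain ⟨α, hα⟩ := ha
    have h' : p + 2 * k = m := by omega
    obtain ⟨β, rfl⟩ := lefTo_surjective hω hn h' (by omega) α
    refine ⟨a - d β, ?_, ?_⟩
    · rw [← ker_lefTo ω h]
      change lefTo ω h (a - d β) = 0
      rw [map_sub, ← hα, d_lefTo hω.1 h' h, sub_self]
    · rw [map_sub, d_d, sub_zero]

/-- In degrees `q ≥ n + k`, the group `Ȟ^q_{(k)}(M)` is the cohomology of a mapping cone. -/
theorem exists_equiv_checkH_high [FiniteDimensional ℝ E] {ω : Form E M 2} (hω : IsSymplectic ω)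
    {n : ℕ} (hn : Module.finrank ℝ E = 2 * n) {k p q : ℕ} (hk : 1 ≤ k) (hkn : k ≤ n)
    (h : p + 2 * k = q) (h' : p + 1 + 2 * k = q + 1) (hq : n + k ≤ q) :
    Nonempty (Subquot (coneClosed d (lefTo ω h') (closedForms E M (p + 1)))
      (coneExact d (lefTo ω h) (exactForms E M q)) ≃ₗ[ℝ] checkH ω n k q) := by
  have hcomm := d_lefTo hω.1 h h'
  have hsurj := lefTo_surjective hω hn h (show n ≤ p + k by omega)
  have hZ : LinearMap.range (d (E := E) (M := M) (q := p)) ≤ closedForms E M (p + 1) :=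
    exactForms_le_closedForms (p + 1)
  rcases Nat.eq_or_lt_of_le hq with hq' | hq'
  · rw [checkH, if_neg (by omega), if_neg (by omega), if_pos hq'.symm]
    obtain rfl : n - k = p := by omega
    obtain ⟨e⟩ := exists_equiv_cone_of_surjective hcomm hsurj hZ
      (mem_imD (ω := ω) hk h hq'.symm)
    rw [ker_lefTo] at e
    exact ⟨e.symm⟩
  · rw [checkH, if_neg (by omega), if_neg (by omega), if_neg (by omega)]
    obtain rfl : q - 2 * k = p := by omega
    obtain ⟨e⟩ := exists_equiv_cone_of_surjective hcomm hsurj hZ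
      (mem_map_d_coeffective hω hn hkn h hq')
    rw [ker_lefTo] at e
    exact ⟨e.symm⟩

/-! ### The rank formula in the ranges `q ≥ 2k`, `q = 2k - 1` and `q < 2k - 1`. -/

theorem hasRankFormula_of_two_mul_le [FiniteDimensional ℝ E] {ω : Form E M 2}
    (hω : IsSymplectic ω) (hfin : FiniteType E M) {n : ℕ} (hn : Module.finrank ℝ E = 2 * n)
    {k q : ℕ} (hk : 1 ≤ k) (hkn : k ≤ n) (hq : 2 * k ≤ q) : HasRankFormula ω n k q := by
  obtain ⟨p, h⟩ : ∃ p, p + 2 * k = q := ⟨q - 2 * k, by omega⟩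
  have h' : p + 1 + 2 * k = q + 1 := by omega
  have hcomm := d_lefTo hω.1 h h'
  have e : Nonempty (Subquot (coneClosed d (lefTo ω h') (closedForms E M (p + 1)))
      (coneExact d (lefTo ω h) (exactForms E M q)) ≃ₗ[ℝ] checkH ω n k q) := by
    rcases Nat.lt_or_ge q (n + k) with hlt | hge
    · let P : Submodule ℝ (Form E M q) := ((closedForms E M (p + 1)).map (lefTo ω h')).comap d
      have hP : ∀ α, α ∈ P ↔ ∃ γ ∈ closedForms E M (p + 1), lefTo ω h' γ = d α :=
        fun _ => Iff.rfl
      obtain ⟨e₁⟩ := exists_equiv_cone_of_injective hcomm (exactForms_le_closedForms q)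
        (lefTo_injective hω hn h' (by omega)) (mem_lefImage h) hP
      obtain ⟨e₂⟩ := exists_equiv_checkH_low hω hn h' hlt hP
      exact ⟨e₁.trans e₂⟩
    · exact exists_equiv_checkH_high hω hn hk hkn h h' hge
  refine hasRankFormula_of_cone hfin (EA₁ := exactForms E M (p + 1)) hcomm rfl
    (fun z hz => lefTo_mem_closedForms hω.1 h' hz) e (hfin (p + 1)) ?_ ?_ ?_
  · rw [← betti_natCast]
    congr 1
    omega
  · intro hex
    exact ⟨fun z hz => lefTo_mem_exactForms_of_exact hex hk h hz,
      fun z hz => lefTo_mem_exactForms_of_exact hex hk h' hz⟩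
  · intro hL hq'
    exact ⟨fun β hβ => hL.exists_closed hω.1 hn hk h (by omega) hβ,
      fun β hβ => hL.exists_closed hω.1 hn hk h' (by omega) hβ⟩

/-- The forms of degree `q - 2k = -1` are modelled by `PUnit`, so only `L^k` on functions remains.
Since `2k - 1 < n + k`, the HLC clause is vacuous. -/
theorem hasRankFormula_of_two_mul_eq [FiniteDimensional ℝ E] {ω : Form E M 2}
    (hω : IsSymplectic ω) (hfin : FiniteType E M) {n : ℕ} (hn : Module.finrank ℝ E = 2 * n)
    {k q : ℕ} (hk : 1 ≤ k) (hkn : k ≤ n) (hq : q + 1 = 2 * k) : HasRankFormula ω n k q := by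
  have h' : 0 + 2 * k = q + 1 := by omega
  let P : Submodule ℝ (Form E M q) := ((closedForms E M 0).map (lefTo ω h')).comap d
  have hP : ∀ α, α ∈ P ↔ ∃ γ ∈ closedForms E M 0, lefTo ω h' γ = d α := fun _ => Iff.rfl
  have hcomm : ∀ a : PUnit.{1}, d ((0 : PUnit.{1} →ₗ[ℝ] Form E M q) a) =
      lefTo ω h' ((0 : PUnit.{1} →ₗ[ℝ] Form E M 0) a) := by
    intro a
    rw [LinearMap.zero_apply, LinearMap.zero_apply, map_zero, map_zero]
  have hI : ∀ b, b ∈ lefImage ω k q ↔ ∃ a, (0 : PUnit.{1} →ₗ[ℝ] Form E M q) a = b := by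
    intro b
    rw [mem_lefImage_of_lt (by omega)]
    exact ⟨fun h => ⟨0, h.symm⟩, fun ⟨_, h⟩ => h.symm⟩
  obtain ⟨e₁⟩ := exists_equiv_cone_of_injective hcomm (exactForms_le_closedForms q)
    (lefTo_injective hω hn h' (by omega)) hI hP
  obtain ⟨e₂⟩ := exists_equiv_checkH_low hω hn h' (by omega) hP
  refine hasRankFormula_of_cone hfin (EA₁ := exactForms E M 0) hcomm LinearMap.range_zero
    (fun z hz => lefTo_mem_closedForms hω.1 h' hz) ⟨e₁.trans e₂⟩ (hfin 0) ?_ ?_ ?_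
  · rw [← betti_natCast]
    congr 1
    omega
  · intro hex
    exact ⟨fun z _ => Submodule.zero_mem _,
      fun z hz => lefTo_mem_exactForms_of_exact hex hk h' hz⟩
  · intro hL hq'
    omega

/-- Nothing is divided out in degrees `q` and `q + 1`, so the complex is the de Rham complex there:
the cone over the zero space. -/
theorem hasRankFormula_of_lt_two_mul {ω : Form E M 2} (hfin : FiniteType E M) {n k q : ℕ}
    (hkn : k ≤ n) (hq : q + 1 < 2 * k) : HasRankFormula ω n k q := by
  have hP : ∀ α, α ∈ (lefImage ω k (q + 1)).comap d ↔
      ∃ γ ∈ (⊤ : Submodule ℝ PUnit.{1}), (0 : PUnit.{1} →ₗ[ℝ] Form E M (q + 1)) γ = d α := by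
    intro α
    rw [Submodule.mem_comap, mem_lefImage_of_lt hq]
    exact ⟨fun h => ⟨0, trivial, h.symm⟩, fun ⟨_, _, h⟩ => h.symm⟩
  have hcomm : ∀ a : PUnit.{1}, d ((0 : PUnit.{1} →ₗ[ℝ] Form E M q) a) =
      (0 : PUnit.{1} →ₗ[ℝ] Form E M (q + 1)) ((0 : PUnit.{1} →ₗ[ℝ] PUnit.{1}) a) := by
    intro a
    rw [LinearMap.zero_apply, map_zero, LinearMap.zero_apply]
  have hI : ∀ b, b ∈ lefImage ω k q ↔ ∃ a, (0 : PUnit.{1} →ₗ[ℝ] Form E M q) a = b := by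
    intro b
    rw [mem_lefImage_of_lt (by omega)]
    exact ⟨fun h => ⟨0, h.symm⟩, fun ⟨_, h⟩ => h.symm⟩
  obtain ⟨e⟩ := exists_equiv_cone_of_injective hcomm (exactForms_le_closedForms q)
    (Function.injective_of_subsingleton _) hI hP
  have hc : checkH ω n k q = .of ℝ (Subquot (checkClosed ω k q) (checkExact ω k q)) := by
    rw [checkH, if_pos (by omega)]
  refine hasRankFormula_of_cone hfin (EA₁ := ⊥) hcomm LinearMap.range_zero
    (fun z _ => Submodule.zero_mem _) (by rw [hc]; exact ⟨e⟩) inferInstance ?_ ?_ ?_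
  · rw [betti_of_neg (by omega)]
    exact Module.finrank_zero_of_subsingleton
  · intro _
    exact ⟨fun z _ => Submodule.zero_mem _, fun z _ => Submodule.zero_mem _⟩
  · intro hL hq'
    omega

theorem hasRankFormula [FiniteDimensional ℝ E] {ω : Form E M 2} (hω : IsSymplectic ω)
    (hfin : FiniteType E M) {n : ℕ} (hn : Module.finrank ℝ E = 2 * n) {k : ℕ} (hk : 1 ≤ k)
    (hkn : k ≤ n) (q : ℕ) : HasRankFormula ω n k q := by
  rcases lt_trichotomy (q + 1) (2 * k) with h | h | h
  · exact hasRankFormula_of_lt_two_mul hfin hkn h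
  · exact hasRankFormula_of_two_mul_eq hω hfin hn hk hkn h
  · exact hasRankFormula_of_two_mul_le hω hfin hn hk hkn (by omega)

end

/-! ### Integrals depending on a parameter -/

section Parametric

universe u

theorem intervalIntegrable_slice {E : Type*} [NormedAddCommGroup E] {G : Type*}
    [NormedAddCommGroup G] [NormedSpace ℝ G]
    {W : Set (E × ℝ)} {f : E × ℝ → G} (hf : ContinuousOn f W) {y : E}
    (hy : ∀ t ∈ Set.Icc (0 : ℝ) 1, (y, t) ∈ W) :
    IntervalIntegrable (fun t => f (y, t)) MeasureTheory.volume 0 1 := by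
  refine ContinuousOn.intervalIntegrable ?_
  rw [Set.uIcc_of_le zero_le_one]
  exact hf.comp (by fun_prop) hy

variable {E : Type u} [NormedAddCommGroup E] [NormedSpace ℝ E] [FiniteDimensional ℝ E]

/-- Differentiation under the integral sign; the dominating constant bounds the derivative on the
compact set `closedBall y r × [0, 1]`. -/
theorem hasFDerivAt_integral_slice {G : Type*} [NormedAddCommGroup G] [NormedSpace ℝ G]
    {W : Set (E × ℝ)} (hW : IsOpen W) {U : Set E} (hU : IsOpen U)
    (hUW : ∀ y ∈ U, ∀ t ∈ Set.Icc (0 : ℝ) 1, (y, t) ∈ W) {f : E × ℝ → G}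
    (hf : ContDiffOn ℝ 1 f W) {y : E} (hy : y ∈ U) :
    HasFDerivAt (fun z => ∫ t in (0 : ℝ)..1, f (z, t))
      (∫ t in (0 : ℝ)..1, (fderiv ℝ f (y, t)).comp (ContinuousLinearMap.inl ℝ E ℝ)) y := by
  obtain ⟨r, hr, hrU⟩ := Metric.nhds_basis_closedBall.mem_iff.1 (hU.mem_nhds hy)
  have hsub : Metric.closedBall y r ×ˢ Set.Icc (0 : ℝ) 1 ⊆ W := fun x hx =>
    hUW x.1 (hrU hx.1) x.2 hx.2
  have hcont : ContinuousOn (fun x => (fderiv ℝ f x).comp (ContinuousLinearMap.inl ℝ E ℝ)) W :=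
    (hf.continuousOn_fderiv_of_isOpen hW le_rfl).clm_comp continuousOn_const
  obtain ⟨C, hC⟩ := ((isCompact_closedBall y r).prod isCompact_Icc).exists_bound_of_continuousOn
    (hcont.mono hsub)
  have hIoc : ∀ t ∈ Set.uIoc (0 : ℝ) 1, t ∈ Set.Icc (0 : ℝ) 1 := by
    intro t ht
    rw [Set.uIoc_of_le zero_le_one] at ht
    exact Set.Ioc_subset_Icc_self ht
  refine intervalIntegral.hasFDerivAt_integral_of_dominated_of_fderiv_le (𝕜 := ℝ)
    (F := fun z t => f (z, t))
    (F' := fun z t => (fderiv ℝ f (z, t)).comp (ContinuousLinearMap.inl ℝ E ℝ))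
    (bound := fun _ => C) (Metric.closedBall_mem_nhds y hr) ?_
    (intervalIntegrable_slice hf.continuousOn (hUW y hy))
    (IntervalIntegrable.def' (intervalIntegrable_slice hcont (hUW y hy))).aestronglyMeasurable ?_
    intervalIntegrable_const ?_
  · filter_upwards [hU.mem_nhds hy] with z hz
    exact (IntervalIntegrable.def'
      (intervalIntegrable_slice hf.continuousOn (hUW z hz))).aestronglyMeasurable
  · exact Filter.Eventually.of_forall fun t ht z hz => hC (z, t) ⟨hz, hIoc t ht⟩
  · refine Filter.Eventually.of_forall fun t ht z hz => ?_
    have h1 : HasFDerivAt f (fderiv ℝ f (z, t)) (z, t) :=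
      ((hf.contDiffAt (hW.mem_nhds (hsub ⟨hz, hIoc t ht⟩))).differentiableAt
        one_ne_zero).hasFDerivAt
    exact h1.comp z (hasFDerivAt_prodMk_left z t)

/-- One order of smoothness is given up, since continuity is read off from differentiability; this
is harmless for smooth `f`. The induction replaces `G` by `E →L[ℝ] G`, hence the common universe. -/
theorem contDiffOn_integral_slice_nat {W : Set (E × ℝ)} (hW : IsOpen W) {U : Set E}
    (hU : IsOpen U) (hUW : ∀ y ∈ U, ∀ t ∈ Set.Icc (0 : ℝ) 1, (y, t) ∈ W) (m : ℕ) {G : Type u}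
    [NormedAddCommGroup G] [NormedSpace ℝ G] {f : E × ℝ → G}
    (hf : ContDiffOn ℝ ((m + 1 : ℕ) : WithTop ℕ∞) f W) :
    ContDiffOn ℝ (m : WithTop ℕ∞) (fun z => ∫ t in (0 : ℝ)..1, f (z, t)) U := by
  induction m generalizing G with
  | zero =>
    rw [Nat.cast_zero, contDiffOn_zero]
    intro y hy
    exact (hasFDerivAt_integral_slice hW hU hUW (by simpa using hf)
      hy).continuousAt.continuousWithinAt
  | succ m ih =>
    have hf1 : ContDiffOn ℝ 1 f W := hf.of_le (by norm_cast; omega)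
    rw [Nat.cast_add_one, contDiffOn_succ_iff_fderiv_of_isOpen hU]
    refine ⟨fun y hy => (hasFDerivAt_integral_slice hW hU hUW hf1
      hy).differentiableAt.differentiableWithinAt, by simp, ?_⟩
    have hf' : ContDiffOn ℝ ((m + 1 : ℕ) : WithTop ℕ∞)
        (fun x => (fderiv ℝ f x).comp (ContinuousLinearMap.inl ℝ E ℝ)) W :=
      (hf.fderiv_of_isOpen hW (by norm_cast)).clm_comp contDiffOn_const
    exact (ih hf').congr fun y hy => (hasFDerivAt_integral_slice hW hU hUW hf1 hy).fderiv

theorem contDiffOn_integral_slice {W : Set (E × ℝ)} (hW : IsOpen W) {U : Set E}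
    (hU : IsOpen U) (hUW : ∀ y ∈ U, ∀ t ∈ Set.Icc (0 : ℝ) 1, (y, t) ∈ W) {G : Type u}
    [NormedAddCommGroup G] [NormedSpace ℝ G] {f : E × ℝ → G}
    (hf : ContDiffOn ℝ ((⊤ : ℕ∞) : WithTop ℕ∞) f W) :
    ContDiffOn ℝ ((⊤ : ℕ∞) : WithTop ℕ∞) (fun z => ∫ t in (0 : ℝ)..1, f (z, t)) U :=
  contDiffOn_infty.2 fun m => contDiffOn_integral_slice_nat hW hU hUW m
    (hf.of_le (by exact_mod_cast le_top))

/-- The homotopy formula of the Poincaré lemma, for an abstract contraction `c` and an abstract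
alternatization `A`. -/
theorem exists_primitive_of_homotopy {X Y : Type u} [NormedAddCommGroup X] [NormedSpace ℝ X]
    [CompleteSpace X] [NormedAddCommGroup Y] [NormedSpace ℝ Y] [CompleteSpace Y]
    (c : X →L[ℝ] E →L[ℝ] Y)
    (A : (E →L[ℝ] Y) →L[ℝ] X) (q : ℕ) (hA : ∀ x, A (c x) = ((q : ℝ) + 1) • x)
    {U : Set E} (hU : IsOpen U)
    (hstar : ∀ y ∈ U, ∀ t ∈ Set.Icc (0 : ℝ) 1, t • y ∈ U)
    {α : E → X} (hα : ContDiffOn ℝ ((⊤ : ℕ∞) : WithTop ℕ∞) α U)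
    (hd : ∀ z ∈ U, ∀ y, A ((c.flip y).comp (fderiv ℝ α z)) = fderiv ℝ α z y) :
    ∃ β : E → Y, ContDiffOn ℝ ((⊤ : ℕ∞) : WithTop ℕ∞) β U ∧
      ∀ y ∈ U, A (fderiv ℝ β y) = α y := by
  let W : Set (E × ℝ) := (fun x : E × ℝ => x.2 • x.1) ⁻¹' U
  have hW : IsOpen W := hU.preimage (by fun_prop)
  -- The radial primitive `β(z) = ∫₀¹ t^q ι_z α(tz) dt`.
  let f : E × ℝ → Y := fun x => x.2 ^ q • c (α (x.2 • x.1)) x.1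
  have hsm : ContDiff ℝ ((⊤ : ℕ∞) : WithTop ℕ∞) fun x : E × ℝ => x.2 • x.1 :=
    contDiff_snd.smul contDiff_fst
  have hαW : ContDiffOn ℝ ((⊤ : ℕ∞) : WithTop ℕ∞) (fun x : E × ℝ => c (α (x.2 • x.1))) W :=
    c.contDiff.comp_contDiffOn (hα.comp hsm.contDiffOn fun _ h => h)
  have hf : ContDiffOn ℝ ((⊤ : ℕ∞) : WithTop ℕ∞) f W :=
    (contDiff_snd.pow q).contDiffOn.smul (hαW.clm_apply contDiff_fst.contDiffOn)
  refine ⟨fun z => ∫ t in (0 : ℝ)..1, f (z, t), contDiffOn_integral_slice hW hU hstar hf,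
    fun y hy => ?_⟩
  have hf1 : ContDiffOn ℝ 1 f W := hf.of_le (by exact_mod_cast le_top)
  have hint : IntervalIntegrable (fun t => (fderiv ℝ f (y, t)).comp
      (ContinuousLinearMap.inl ℝ E ℝ)) MeasureTheory.volume 0 1 :=
    intervalIntegrable_slice (f := fun x => (fderiv ℝ f x).comp (ContinuousLinearMap.inl ℝ E ℝ))
      ((hf1.continuousOn_fderiv_of_isOpen hW le_rfl).clm_comp continuousOn_const) (hstar y hy)
  have hαd : ∀ t ∈ Set.Icc (0 : ℝ) 1, HasFDerivAt α (fderiv ℝ α (t • y)) (t • y) := fun t ht =>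
    ((hα.contDiffAt (hU.mem_nhds (hstar y hy t ht))).differentiableAt (by simp)).hasFDerivAt
  have hder : ∀ t ∈ Set.Icc (0 : ℝ) 1, HasDerivAt (fun s : ℝ => s ^ (q + 1) • α (s • y))
      (A ((fderiv ℝ f (y, t)).comp (ContinuousLinearMap.inl ℝ E ℝ))) t := by
    intro t ht
    have h1 : HasFDerivAt (fun z => f (z, t)) ((fderiv ℝ f (y, t)).comp
        (ContinuousLinearMap.inl ℝ E ℝ)) y :=
      ((hf1.contDiffAt (hW.mem_nhds (hstar y hy t ht))).differentiableAt
        one_ne_zero).hasFDerivAt.comp y (hasFDerivAt_prodMk_left y t)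
    have h2 : HasFDerivAt (fun z => f (z, t))
        (t ^ q • (c (α (t • y)) + t • (c.flip y).comp (fderiv ℝ α (t • y)))) y := by
      have h3 := (hαd t ht).comp y ((hasFDerivAt_id y).const_smul t)
      have h4 := ((c.hasFDerivAt.comp y h3).clm_apply (hasFDerivAt_id y)).const_smul (t ^ q)
      refine h4.congr_fderiv ?_
      ext1 w
      simp
    -- Alternatizing the `y`-derivative of the integrand gives `t^q ((q+1) α(ty) + t Dα(ty) y)`,
    -- which is `d/dt (t^{q+1} α(ty))`. The integral telescopes to `α(y)`, the endpoint `t = 0`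
    -- contributing zero because `q + 1 ≥ 1`.
    rw [h1.unique h2, map_smul, map_add, map_smul, hd _ (hstar y hy t ht), hA]
    have h7 := (hαd t ht).comp_hasDerivAt t ((hasDerivAt_id t).smul_const y)
    refine ((hasDerivAt_pow (q + 1) t).smul h7).congr_deriv ?_
    simp only [id_eq, one_smul, Function.comp_apply, Nat.cast_add, Nat.cast_one,
      Nat.add_sub_cancel]
    module
  rw [(hasFDerivAt_integral_slice hW hU hstar hf1 hy).fderiv,
    ← A.intervalIntegral_comp_comm hint]
  have hint' : IntervalIntegrable (fun t => A ((fderiv ℝ f (y, t)).comp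
      (ContinuousLinearMap.inl ℝ E ℝ))) MeasureTheory.volume 0 1 :=
    ⟨A.integrable_comp hint.1, A.integrable_comp hint.2⟩
  refine (intervalIntegral.integral_eq_sub_of_hasDerivAt (fun t ht => hder t ?_) hint').trans ?_
  · rwa [Set.uIcc_of_le zero_le_one] at ht
  · simp

/-! ### The Poincaré lemma -/

open ContinuousAlternatingMap (alternatizeUncurryFin alternatizeUncurryFinCLM)

/-- Alternatizing a contracted `(q+1)`-form multiplies it by `q + 1`, and Cartan's formula for a
closed form supplies the remaining hypothesis of the homotopy formula. -/
theorem poincare_lemma {U : Set E} (hU : IsOpen U)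
    (hstar : ∀ y ∈ U, ∀ t ∈ Set.Icc (0 : ℝ) 1, t • y ∈ U) {q : ℕ}
    {α : E → E [⋀^Fin (q + 1)]→L[ℝ] ℝ} (hα : ContDiffOn ℝ ((⊤ : ℕ∞) : WithTop ℕ∞) α U)
    (hd : ∀ y ∈ U, extDeriv α y = 0) :
    ∃ β : E → E [⋀^Fin q]→L[ℝ] ℝ, ContDiffOn ℝ ((⊤ : ℕ∞) : WithTop ℕ∞) β U ∧
      ∀ y ∈ U, extDeriv β y = α y := by
  refine exists_primitive_of_homotopy (X := E [⋀^Fin (q + 1)]→L[ℝ] ℝ) (Y := E [⋀^Fin q]→L[ℝ] ℝ)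
    (ContinuousAlternatingMap.curryLeftLI (𝕜 := ℝ) (E := E) (F := ℝ)).toContinuousLinearMap
    (alternatizeUncurryFinCLM ℝ E ℝ) q (fun x => ?_) hU hstar hα fun z hz y => ?_
  · refine (ContinuousAlternatingMap.alternatizeUncurryFin_curryLeft x).trans ?_
    rw [← Nat.cast_smul_eq_nsmul ℝ, Nat.cast_add_one]
  · have h := contract_alternatizeUncurryFin y (fderiv ℝ α z)
    have h0 : alternatizeUncurryFin (fderiv ℝ α z) = 0 := hd z hz
    rw [h0, map_zero] at h
    exact (sub_eq_zero.1 h.symm).symm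

end Parametric

section

universe u
variable {E : Type u} [NormedAddCommGroup E] [NormedSpace ℝ E]

/-! ### Forms on open subsets of a vector space -/

section OpenSubset

variable {U : TopologicalSpace.Opens E}

theorem extChartAt_opens_target (x₀ : U) : (extChartAt 𝓘(ℝ, E) x₀).target = U := by
  simp only [extChartAt, TopologicalSpace.Opens.chartAt_eq, mfld_simps]
  change ((OpenPartialHomeomorph.refl E).subtypeRestr _).target = _
  simp [OpenPartialHomeomorph.subtypeRestr, mfld_simps]

theorem extChartAt_opens_symm (x₀ : U) {y : E} (hy : y ∈ U) :
    (((extChartAt 𝓘(ℝ, E) x₀).symm y : U) : E) = y :=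
  (extChartAt 𝓘(ℝ, E) x₀).right_inv (by rwa [extChartAt_opens_target])

/-- The derivative of the inclusion of an open subset. -/
def inclDeriv (x : U) : E →L[ℝ] E :=
  mfderiv 𝓘(ℝ, E) 𝓘(ℝ, E) (Subtype.val : U → E) x

/-- The charts of an open subset are restrictions of the identity, so the inclusion undoes the
inverse chart. Hence a restricted form has the original form as its chart expression. -/
theorem inclDeriv_comp_chartDeriv (x₀ : U) {y : E} (hy : y ∈ U) :
    (inclDeriv ((extChartAt 𝓘(ℝ, E) x₀).symm y)).comp (chartDeriv E x₀ y) = .id ℝ E := by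
  have hmem : (extChartAt 𝓘(ℝ, E) x₀).target ∈ 𝓝 y :=
    (isOpen_extChartAt_target x₀).mem_nhds (by rwa [extChartAt_opens_target])
  have hS : MDifferentiableAt 𝓘(ℝ, E) 𝓘(ℝ, E) (extChartAt 𝓘(ℝ, E) x₀).symm y :=
    ((contMDiffOn_extChartAt_symm (n := 1) x₀).contMDiffAt hmem).mdifferentiableAt (by simp)
  have hV : MDifferentiableAt 𝓘(ℝ, E) 𝓘(ℝ, E) (Subtype.val : U → E)
      ((extChartAt 𝓘(ℝ, E) x₀).symm y) :=
    (contMDiff_subtype_val (n := 1)).contMDiffAt.mdifferentiableAt (by simp)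
  have hid : (Subtype.val : U → E) ∘ (extChartAt 𝓘(ℝ, E) x₀).symm =ᶠ[𝓝 y] id := by
    filter_upwards [hmem] with z hz
    exact (extChartAt 𝓘(ℝ, E) x₀).right_inv hz
  have h2 := hid.mfderiv_eq (I := 𝓘(ℝ, E)) (I' := 𝓘(ℝ, E))
  rw [mfderiv_comp y hV hS, mfderiv_id] at h2
  exact h2

/-- The restriction to `U` of a form on the vector space, as a rough form. -/
def restrictRough (U : TopologicalSpace.Opens E) {q : ℕ} (β : E → E [⋀^Fin q]→L[ℝ] ℝ) :
    RoughForm E U q :=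
  fun x => ((β x.1).compContinuousLinearMap (inclDeriv x) : E [⋀^Fin q]→L[ℝ] ℝ)

theorem localRep_restrictRough {q : ℕ} (β : E → E [⋀^Fin q]→L[ℝ] ℝ) (x₀ : U) {y : E}
    (hy : y ∈ U) : localRep (restrictRough U β) x₀ y = β y := by
  have h1 : localRep (restrictRough U β) x₀ y =
      (β ((extChartAt 𝓘(ℝ, E) x₀).symm y).1).compContinuousLinearMap
        ((inclDeriv ((extChartAt 𝓘(ℝ, E) x₀).symm y)).comp (chartDeriv E x₀ y)) := rfl
  rw [h1, inclDeriv_comp_chartDeriv x₀ hy, extChartAt_opens_symm x₀ hy]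
  rfl

/-- The restriction to `U` of a form which is smooth on `U`. -/
def restrictForm {q : ℕ} (β : E → E [⋀^Fin q]→L[ℝ] ℝ)
    (hβ : ContDiffOn ℝ ((⊤ : ℕ∞) : WithTop ℕ∞) β U) : Form E U q :=
  ⟨restrictRough U β, fun x₀ => by
    rw [extChartAt_opens_target]
    exact hβ.congr fun y hy => localRep_restrictRough β x₀ hy⟩

theorem localRep_restrictForm {q : ℕ} (β : E → E [⋀^Fin q]→L[ℝ] ℝ)
    (hβ : ContDiffOn ℝ ((⊤ : ℕ∞) : WithTop ℕ∞) β U) (x₀ : U) {y : E} (hy : y ∈ U) :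
    localRep (restrictForm β hβ).1 x₀ y = β y := localRep_restrictRough β x₀ hy

theorem localRep_opens_eq {q : ℕ} (α : RoughForm E U q) (x₀ x₁ : U) :
    localRep α x₀ = localRep α x₁ := rfl

theorem form_opens_ext (x₀ : U) {q : ℕ} {α β : Form E U q}
    (h : ∀ y ∈ U, localRep α.1 x₀ y = localRep β.1 x₀ y) : α = β :=
  form_ext fun x₁ y hy => by
    rw [localRep_opens_eq _ x₁ x₀, localRep_opens_eq _ x₁ x₀]
    exact h y (by rwa [extChartAt_opens_target] at hy)

theorem localRep_d_opens {q : ℕ} (α : Form E U q) (x₀ : U) {y : E} (hy : y ∈ U) :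
    localRep (d α).1 x₀ y = extDeriv (localRep α.1 x₀) y :=
  localRep_d α x₀ (by rwa [extChartAt_opens_target])

theorem extDeriv_localRep_eq_zero {q : ℕ} {α : Form E U q} (hα : α ∈ closedForms E U q) (x₀ : U)
    {y : E} (hy : y ∈ U) : extDeriv (localRep α.1 x₀) y = 0 := by
  rw [← localRep_d_opens α x₀ hy, show d α = 0 from hα]
  rfl

theorem contDiffOn_localRep {q : ℕ} (α : Form E U q) (x₀ : U) :
    ContDiffOn ℝ ((⊤ : ℕ∞) : WithTop ℕ∞) (localRep α.1 x₀) U := by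
  have h := α.2 x₀
  rwa [extChartAt_opens_target] at h

/-! ### The cohomology of convex open sets -/

theorem closedForms_le_exactForms_opens [FiniteDimensional ℝ E] (hU : Convex ℝ (U : Set E))
    (h0 : (0 : E) ∈ U) (q : ℕ) : closedForms E U (q + 1) ≤ exactForms E U (q + 1) := by
  intro α hα
  obtain ⟨β, hβ, hd⟩ := poincare_lemma U.2
    (fun y hy t ht => hU.smul_mem_of_zero_mem h0 hy ht)
    (contDiffOn_localRep α ⟨0, h0⟩) fun y hy => extDeriv_localRep_eq_zero hα ⟨0, h0⟩ hy
  refine ⟨restrictForm β hβ, form_opens_ext ⟨0, h0⟩ fun y hy => ?_⟩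
  rw [localRep_d_opens _ _ hy, ← hd y hy]
  refine Filter.EventuallyEq.extDeriv_eq ?_
  filter_upwards [U.2.mem_nhds hy] with z hz
  exact localRep_restrictForm β hβ _ hz

theorem subsingleton_deRham_opens [FiniteDimensional ℝ E] (hU : Convex ℝ (U : Set E))
    (h0 : (0 : E) ∈ U) (q : ℕ) : Subsingleton (DeRham E U (q + 1)) := by
  refine Submodule.Quotient.subsingleton_iff.2 (Submodule.submoduleOf_eq_top.2 ?_)
  exact closedForms_le_exactForms_opens hU h0 q

theorem localRep_eq_const (hU : Convex ℝ (U : Set E)) (h0 : (0 : E) ∈ U) {α : Form E U 0}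
    (hα : α ∈ closedForms E U 0) {y : E} (hy : y ∈ U) :
    localRep α.1 ⟨0, h0⟩ y = localRep α.1 ⟨0, h0⟩ 0 := by
  refine U.2.is_const_of_fderiv_eq_zero hU.isPreconnected
    ((contDiffOn_localRep α _).differentiableOn (by simp)) (fun z hz => ?_) hy h0
  ext1 v
  rw [← contract_alternatizeUncurryFin_zero v]
  have h := extDeriv_localRep_eq_zero hα ⟨0, h0⟩ hz
  rw [extDeriv] at h
  rw [h, map_zero]
  rfl

theorem d_restrictForm_const {q : ℕ} (c : E [⋀^Fin q]→L[ℝ] ℝ) (x₀ : U) :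
    d (restrictForm (U := U) (fun _ => c) contDiffOn_const) = 0 := by
  refine form_opens_ext x₀ fun y hy => ?_
  rw [localRep_d_opens _ _ hy]
  have h : localRep (restrictForm (U := U) (fun _ => c) contDiffOn_const).1 x₀ =ᶠ[𝓝 y]
      fun _ => c := by
    filter_upwards [U.2.mem_nhds hy] with z hz
    exact localRep_restrictForm _ _ _ hz
  rw [h.extDeriv_eq, extDeriv, fderiv_fun_const]
  exact map_zero (ContinuousAlternatingMap.alternatizeUncurryFinCLM ℝ E ℝ)

/-- Closed 0-forms on a convex set are constant, so the constant function 1 spans `H^0`. -/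
theorem finrank_deRham_zero_opens (hU : Convex ℝ (U : Set E)) (h0 : (0 : E) ∈ U) :
    Module.finrank ℝ (DeRham E U 0) = 1 := by
  let c : E [⋀^Fin 0]→L[ℝ] ℝ := ContinuousAlternatingMap.constOfIsEmpty ℝ E (Fin 0) 1
  have hc : ∀ a : E [⋀^Fin 0]→L[ℝ] ℝ, a = a 0 • c := fun a => by
    ext v
    rw [Subsingleton.elim v 0]
    simp [c]
  let α : Form E U 0 := restrictForm (fun _ => c) contDiffOn_const
  have hα : α ∈ closedForms E U 0 := d_restrictForm_const c ⟨0, h0⟩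
  refine finrank_eq_one_iff'.2 ⟨Submodule.Quotient.mk ⟨α, hα⟩, ?_, ?_⟩
  · intro h
    have h1 : α = 0 := (Submodule.Quotient.mk_eq_zero _).1 h
    have h2 := localRep_restrictForm (U := U) (fun _ => c) contDiffOn_const ⟨0, h0⟩ h0
    have h3 : localRep α.1 ⟨0, h0⟩ 0 = 0 := by rw [h1]; rfl
    have h4 := congrArg (fun a : E [⋀^Fin 0]→L[ℝ] ℝ => a 0) (h2.symm.trans h3)
    simp [c] at h4
  · intro w
    obtain ⟨⟨β, hβ⟩, rfl⟩ := Submodule.Quotient.mk_surjective _ w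
    refine ⟨localRep β.1 ⟨0, h0⟩ 0 0, ?_⟩
    rw [← Submodule.Quotient.mk_smul]
    congr 1
    refine Subtype.ext (form_opens_ext ⟨0, h0⟩ fun y hy => ?_)
    rw [localRep_eq_const hU h0 hβ hy]
    refine Eq.trans ?_ (hc _).symm
    exact congrArg (fun a => (localRep β.1 ⟨0, h0⟩ 0) 0 • a)
      (localRep_restrictForm (fun _ => c) contDiffOn_const ⟨0, h0⟩ hy)

theorem finiteType_opens [FiniteDimensional ℝ E] (hU : Convex ℝ (U : Set E)) (h0 : (0 : E) ∈ U) :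
    FiniteType E U := by
  rintro (_ | q)
  · exact Module.finite_of_finrank_eq_succ (finrank_deRham_zero_opens hU h0)
  · have := subsingleton_deRham_opens hU h0 q
    infer_instance

theorem betti_zero_opens (hU : Convex ℝ (U : Set E)) (h0 : (0 : E) ∈ U) : betti E U 0 = 1 :=
  finrank_deRham_zero_opens hU h0

theorem betti_opens_of_ne_zero [FiniteDimensional ℝ E] (hU : Convex ℝ (U : Set E))
    (h0 : (0 : E) ∈ U) {z : ℤ} (hz : z ≠ 0) : betti E U z = 0 := by
  rcases lt_or_gt_of_ne hz with h | h
  · exact betti_of_neg h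
  · obtain ⟨q, rfl⟩ : ∃ q : ℕ, z = ((q + 1 : ℕ) : ℤ) := ⟨(z - 1).toNat, by omega⟩
    rw [betti_natCast]
    have := subsingleton_deRham_opens hU h0 q
    exact Module.finrank_zero_of_subsingleton

end OpenSubset

/-! ### The standard symplectic disk -/

theorem convex_disk (n : ℕ) : Convex ℝ (disk n : Set (R2 n)) := convex_ball 0 1

theorem zero_mem_disk (n : ℕ) : (0 : R2 n) ∈ disk n := Metric.mem_ball_self one_pos

theorem wedge_dx_apply {n : ℕ} (i j : Fin (2 * n)) (v w : R2 n) :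
    wedge (dx i) (dx j) ![v, w] = v i * w j - w i * v j := by
  have h : ∀ (l : Fin (2 * n)) (u : Fin 1 → R2 n), dx l u = u 0 l := fun l u => rfl
  have hdet := Matrix.det_fin_two !![v i, v j; w i, w j]
  rw [Matrix.det_apply'] at hdet
  rw [wedge_apply]
  refine Eq.trans ?_ (hdet.trans ?_)
  · simp only [Nat.factorial_one, Nat.cast_one, mul_one, inv_one, one_mul]
    refine Finset.sum_congr rfl fun σ _ => ?_
    rw [Fin.prod_univ_two, h, h]
    congr 2
    · change (![v, w] (σ 0)) i = _
      generalize σ 0 = a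
      fin_cases a <;> rfl
    · change (![v, w] (σ 1)) j = _
      generalize σ 1 = a
      fin_cases a <;> rfl
  · simp
    ring

theorem nondeg_stdOmega (n : ℕ) : Nondeg (stdOmega n) := by
  intro v hv
  have key : ∀ w : R2 n, ∑ i : Fin n, (v ⟨i, by omega⟩ * w ⟨n + i, by omega⟩ -
      w ⟨i, by omega⟩ * v ⟨n + i, by omega⟩) = 0 := by
    intro w
    refine Eq.trans ?_ (hv w)
    rw [stdOmega, ContinuousAlternatingMap.sum_apply]
    exact Finset.sum_congr rfl fun i _ => (wedge_dx_apply _ _ v w).symm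
  ext l
  rcases lt_or_ge l.1 n with hl | hl
  -- Pairing with the conjugate basis vector isolates one coordinate of `v`.
  · have h := key (EuclideanSpace.single ⟨n + l, by omega⟩ 1)
    rw [Finset.sum_eq_single ⟨l, hl⟩] at h
    · simpa [Fin.ext_iff, show n ≠ 0 by omega] using h
    · intro i _ hi
      have : (i : ℕ) ≠ l := fun h => hi (Fin.ext h)
      have h2 : (i : ℕ) ≠ n + l := by omega
      simp [Fin.ext_iff, this, h2]
    · simp
  · have h := key (EuclideanSpace.single ⟨l - n, by omega⟩ 1)
    rw [Finset.sum_eq_single ⟨l - n, by omega⟩] at h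
    · have e : n + (l - n : ℕ) = l := by omega
      simpa [Fin.ext_iff, e, show (l : ℕ) ≠ l - n by omega] using h
    · intro i _ hi
      have : (i : ℕ) ≠ l - n := fun h => hi (Fin.ext h)
      have h2 : n + (i : ℕ) ≠ l - n := by omega
      simp [Fin.ext_iff, this, h2]
    · simp

theorem isSymplectic_diskForm (n : ℕ) : IsSymplectic (diskForm n) := by
  refine ⟨d_restrictForm_const (stdOmega n) ⟨0, zero_mem_disk n⟩, fun x v hv => ?_⟩
  have hx := inclDeriv_comp_chartDeriv x x.2
  obtain ⟨e, he⟩ := isInvertible_chartDeriv (E := R2 n) (mem_extChartAt_target (I := 𝓘(ℝ, R2 n)) x)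
  have hxx : (extChartAt 𝓘(ℝ, R2 n) x).symm x.1 = x := Subtype.ext (extChartAt_opens_symm x x.2)
  rw [hxx] at hx
  have h1 : ∀ u, inclDeriv x (e u) = u := fun u => by
    have := congrArg (fun T : R2 n →L[ℝ] R2 n => T u) hx
    rw [show chartDeriv (R2 n) x x.1 = e from he.symm] at this
    exact this
  -- Nondegeneracy transfers from `ℝ^{2n}` because every vector `u` is the image of `e u` under the
  -- derivative of the inclusion.
  have h2 : inclDeriv x v = 0 := nondeg_stdOmega n _ fun u => by
    refine Eq.trans ?_ (hv (e u))
    refine congrArg (stdOmega n) ?_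
    funext i
    fin_cases i
    · rfl
    · exact (h1 u).symm
  obtain ⟨u, rfl⟩ : ∃ u, e u = v := e.surjective v
  rw [(h1 u).symm.trans h2]
  exact map_zero e

/-- The closed form `ω` is exact on the disk by the Poincaré lemma, so both ranks in the rank
formula vanish. -/
theorem checkC_diskForm {n k : ℕ} (hk : 1 ≤ k) (hkn : k ≤ n) (q : ℕ) :
    Module.Finite ℝ (checkH (diskForm n) n k q) ∧ checkC (diskForm n) n k q =
      betti (R2 n) (disk n) (q : ℤ) + betti (R2 n) (disk n) ((q : ℤ) - 2 * k + 1) := by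
  obtain ⟨h1, r₀, r₁, h2, -, -, h3, -⟩ := hasRankFormula (isSymplectic_diskForm n)
    (finiteType_opens (convex_disk n) (zero_mem_disk n)) finrank_euclideanSpace_fin hk hkn q
  obtain ⟨rfl, rfl⟩ := h3 (closedForms_le_exactForms_opens (convex_disk n) (zero_mem_disk n) 1
    (isSymplectic_diskForm n).1)
  exact ⟨h1, h2⟩

end
end SympCoh

end

/-! ### The proposition, read off from the rank formula. -/

theorem mainTheorem5 (n k : ℕ) (hk : 1 ≤ k) (hkn : k ≤ n) :
    (∀ (M : Type*) [TopologicalSpace M] [T2Space M] [SecondCountableTopology M]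
      [ChartedSpace (EuclideanSpace ℝ (Fin (2 * n))) M]
      [IsManifold 𝓘(ℝ, EuclideanSpace ℝ (Fin (2 * n))) ((⊤ : ℕ∞) : WithTop ℕ∞) M]
      (ω : SympCoh.Form (EuclideanSpace ℝ (Fin (2 * n))) M 2),
      SympCoh.IsSymplectic ω → SympCoh.FiniteType (EuclideanSpace ℝ (Fin (2 * n))) M →
      -- finiteness and bounds
      (∀ q : ℕ, q ≤ 2 * n + 2 * k - 1 →
        Module.Finite ℝ (SympCoh.checkH ω n k q) ∧
        (SympCoh.betti (EuclideanSpace ℝ (Fin (2 * n))) M ((q : ℤ) - 2 * k + 1) : ℤ) -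
            SympCoh.betti (EuclideanSpace ℝ (Fin (2 * n))) M ((q : ℤ) + 1) ≤
          SympCoh.checkC ω n k q ∧
        SympCoh.checkC ω n k q ≤
          SympCoh.betti (EuclideanSpace ℝ (Fin (2 * n))) M ((q : ℤ) - 2 * k + 1) +
            SympCoh.betti (EuclideanSpace ℝ (Fin (2 * n))) M (q : ℤ)) ∧
      -- symplectic manifolds satisfying the HLC
      (SympCoh.HardLefschetz ω n → ∀ q : ℕ, n + k ≤ q → q ≤ 2 * n + 2 * k - 1 →
        (SympCoh.checkC ω n k q : ℤ) =
          (SympCoh.betti (EuclideanSpace ℝ (Fin (2 * n))) M ((q : ℤ) - 2 * k + 1) : ℤ) -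
            SympCoh.betti (EuclideanSpace ℝ (Fin (2 * n))) M ((q : ℤ) + 1)) ∧
      -- exact symplectic manifolds
      (ω ∈ SympCoh.exactForms (EuclideanSpace ℝ (Fin (2 * n))) M 2 →
        ∀ q : ℕ, q ≤ 2 * n + 2 * k - 1 →
        SympCoh.checkC ω n k q =
          SympCoh.betti (EuclideanSpace ℝ (Fin (2 * n))) M ((q : ℤ) - 2 * k + 1) +
            SympCoh.betti (EuclideanSpace ℝ (Fin (2 * n))) M (q : ℤ))) ∧
    -- the standard symplectic disk
    (SympCoh.IsSymplectic (SympCoh.diskForm n) ∧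
      (∀ q : ℕ, q ≤ 2 * n + 2 * k - 1 →
        Module.Finite ℝ (SympCoh.checkH (SympCoh.diskForm n) n k q)) ∧
      SympCoh.checkC (SympCoh.diskForm n) n k 0 = 1 ∧
      SympCoh.checkC (SympCoh.diskForm n) n k (2 * k - 1) = 1 ∧
      ∀ q : ℕ, q ≤ 2 * n + 2 * k - 1 → q ≠ 0 → q ≠ 2 * k - 1 →
        SympCoh.checkC (SympCoh.diskForm n) n k q = 0) := by
  refine ⟨fun M _ _ _ _ _ ω hω hfin => ⟨fun q _ => ?_, fun hHL q hq _ => ?_, fun hex q _ => ?_⟩,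
    SympCoh.isSymplectic_diskForm n, fun q _ => (SympCoh.checkC_diskForm hk hkn q).1, ?_, ?_,
    fun q _ h0 h1 => ?_⟩
  · obtain ⟨h1, r₀, r₁, h2, h3, h4, -, -⟩ :=
      SympCoh.hasRankFormula hω hfin finrank_euclideanSpace_fin hk hkn q
    -- The lower bound uses `r₀ ≤ b_q` and `r₁ ≤ b_{q+1}`; the upper bound uses only that ranks are
    -- nonnegative.
    exact ⟨h1, by omega, by omega⟩
  · obtain ⟨-, r₀, r₁, h2, -, -, -, h3⟩ :=
      SympCoh.hasRankFormula hω hfin finrank_euclideanSpace_fin hk hkn q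
    have := h3 hHL hq
    omega
  · obtain ⟨-, r₀, r₁, h2, -, -, h3, -⟩ :=
      SympCoh.hasRankFormula hω hfin finrank_euclideanSpace_fin hk hkn q
    have := h3 hex
    omega
  -- Since `b_0` is the only nonzero Betti number, `b_q + b_{q-2k+1}` is nonzero only for `q = 0`
  -- and `q = 2k - 1`. These differ by parity, so each value is 1.
  · rw [(SympCoh.checkC_diskForm hk hkn 0).2, SympCoh.betti_opens_of_ne_zero
      (SympCoh.convex_disk n) (SympCoh.zero_mem_disk n) (z := ((0 : ℕ) : ℤ) - 2 * k + 1) (by omega)]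
    exact SympCoh.betti_zero_opens (SympCoh.convex_disk n) (SympCoh.zero_mem_disk n)
  · rw [(SympCoh.checkC_diskForm hk hkn _).2, SympCoh.betti_opens_of_ne_zero
      (SympCoh.convex_disk n) (SympCoh.zero_mem_disk n) (by omega), zero_add,
      show ((2 * k - 1 : ℕ) : ℤ) - 2 * k + 1 = 0 by omega]
    exact SympCoh.betti_zero_opens (SympCoh.convex_disk n) (SympCoh.zero_mem_disk n)
  · rw [(SympCoh.checkC_diskForm hk hkn q).2, SympCoh.betti_opens_of_ne_zero
      (SympCoh.convex_disk n) (SympCoh.zero_mem_disk n) (by omega), SympCoh.betti_opens_of_ne_zero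
      (SympCoh.convex_disk n) (SympCoh.zero_mem_disk n) (by omega)]
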